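/- **Theorem.** Polynomials are given as explicit sums of monomials, with integer coefficients and with exponents written in binary, and rational numbers as fractions of integers in binary. The *existential theory of the reals* ETR is the problem of deciding whether a given sentence $\exists x_1\cdots\exists x_n\,\Phi(x_1,\dots,x_n)$ is true over $\mathbb R$, where $\Phi$ is a quantifier-free Boolean combination of polynomial equations and inequalities with integer coefficients. The class $\exists\mathbb R$ consists of all decision problems that are polynomial-time many-one reducible to ETR; a problem is *$\exists\mathbb R$-hard* if every problem in $\exists\mathbb R$ is polynomial-time many-one reducible to it, and *$\exists\mathbb R$-complete* if it is $\exists\mathbb R$-hard and belongs to $\exists\mathbb R$. The problem *Valley-Separated Clusters* (VSC) is the following. Instance: a polynomial $f\in\mathbb Z[x_1,\dots,x_d]$ and a rational threshold $\theta>0$. Question: do there exist two points $p,q\in\mathbb R^d$ such that $$f(p)\ge\theta,\qquad f(q)\ge\theta,\qquad f\!\left(\frac{p+q}{2}\right)<\theta\ ?$$ Then VSC belongs to $\exists\mathbb R$ and is $\exists\mathbb R$-hard; that is, VSC is $\exists\mathbb R$-complete. -/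

import Mathlib

namespace ExistsReals

/-! ### Decision problems and polynomial-time many-one reductions -/

/-- A decision problem: a type of instances, written down as strings over a finite alphabet
by an injective encoding, together with the set of yes-instances. A language `L` over a finite
alphabet `Γ` is the case `Instance = List Γ`, `encode = id`. -/
structure DecisionProblem where
  Instance : Type
  Alphabet : Type
  alphabet_finite : Finite Alphabet
  encode : Instance → List Alphabet
  encode_injective : Function.Injective encode
  Yes : Set Instance

/-- Polynomial-time many-one reducibility `A ≤ₚ B`: some map from instances of `A` to instances
of `B`, computed on the encodings by a Turing machine in time polynomial in the length of the
input string, preserves and reflects yes-instances. -/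
def PolyTimeReducible (A B : DecisionProblem) : Prop :=
  ∃ f : A.Instance → B.Instance,
    Nonempty (Turing.TM2ComputableInPolyTime A.encode B.encode f) ∧
      ∀ a, a ∈ A.Yes ↔ f a ∈ B.Yes

/-! ### Polynomials as explicit sums of monomials -/

/-- A polynomial in `n` variables with integer coefficients, written as an explicit finite sum of
terms, each a coefficient together with its exponent vector. -/
abbrev SumOfMonomials (n : ℕ) : Type := List (ℤ × (Fin n → ℕ))

/-- The element of `ℤ[x₁, …, xₙ]` that an explicit sum of monomials denotes. -/
noncomputable def SumOfMonomials.toPoly {n : ℕ} (P : SumOfMonomials n) :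
    MvPolynomial (Fin n) ℤ :=
  (P.map fun t => MvPolynomial.monomial (Finsupp.equivFunOnFinite.symm t.2) t.1).sum

/-- The value of the polynomial at a real point. -/
noncomputable def SumOfMonomials.eval {n : ℕ} (P : SumOfMonomials n) (x : Fin n → ℝ) : ℝ :=
  MvPolynomial.aeval x P.toPoly

/-! ### Strings -/

/-- The alphabet in which polynomials, rationals and formulas are written. -/
inductive Symbol
  | bit (b : Bool)
  | semi
  | var
  | plus
  | minus
  | eq
  | gt
  | ge
  | not
  | and
  | or
  deriving DecidableEq, Fintype

/-- A natural number in binary (least significant bit first), terminated by `semi`. -/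
def encNat (k : ℕ) : List Symbol := k.bits.map Symbol.bit ++ [Symbol.semi]

/-- An integer: its sign, then its absolute value in binary. -/
def encInt (z : ℤ) : List Symbol :=
  (if z < 0 then Symbol.minus else Symbol.plus) :: encNat z.natAbs

/-- A term: the coefficient in binary, followed by the `n` exponents in binary. -/
def encTerm {n : ℕ} (t : ℤ × (Fin n → ℕ)) : List Symbol :=
  encInt t.1 ++ (List.ofFn t.2).flatMap encNat

/-- A polynomial: its terms one after the other (each starts with a sign), terminated by
`semi`. -/
def encPoly {n : ℕ} (P : SumOfMonomials n) : List Symbol :=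
  P.flatMap encTerm ++ [Symbol.semi]

/-- The declaration of `n` variables: one symbol per variable, terminated by `semi`. -/
def encVars (n : ℕ) : List Symbol := List.replicate n Symbol.var ++ [Symbol.semi]

/-- A positive rational: numerator and denominator (of the reduced fraction) in binary. -/
def encPosRat (θ : ℚ) : List Symbol := encNat θ.num.natAbs ++ encNat θ.den

/-! ### The existential theory of the reals -/

/-- The comparisons of a polynomial with zero: `P = 0`, `P > 0`, `P ≥ 0`. The other ones are
obtained by a change of sign or a negation. -/
inductive Comparison
  | eq
  | gt
  | ge

def Comparison.Holds : Comparison → ℝ → Prop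
  | .eq, a => a = 0
  | .gt, a => 0 < a
  | .ge, a => 0 ≤ a

/-- Quantifier-free Boolean combinations of polynomial equations and inequalities with integer
coefficients in `n` variables. -/
inductive QFFormula (n : ℕ) : Type
  | atom (c : Comparison) (P : SumOfMonomials n)
  | not (φ : QFFormula n)
  | and (φ ψ : QFFormula n)
  | or (φ ψ : QFFormula n)

/-- Truth of a quantifier-free formula at a real point. -/
def QFFormula.Holds {n : ℕ} (x : Fin n → ℝ) : QFFormula n → Prop
  | .atom c P => c.Holds (P.eval x)
  | .not φ => ¬ φ.Holds x
  | .and φ ψ => φ.Holds x ∧ ψ.Holds x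
  | .or φ ψ => φ.Holds x ∨ ψ.Holds x

def Comparison.symbol : Comparison → Symbol
  | .eq => Symbol.eq
  | .gt => Symbol.gt
  | .ge => Symbol.ge

/-- Formulas are written in prefix (Polish) notation. -/
def encFormula {n : ℕ} : QFFormula n → List Symbol
  | .atom c P => c.symbol :: encPoly P
  | .not φ => Symbol.not :: encFormula φ
  | .and φ ψ => Symbol.and :: (encFormula φ ++ encFormula ψ)
  | .or φ ψ => Symbol.or :: (encFormula φ ++ encFormula ψ)

/-- A sentence `∃ x₁ … ∃ xₙ, Φ(x₁, …, xₙ)`. -/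
structure Sentence where
  n : ℕ
  Φ : QFFormula n

def Sentence.encode (S : Sentence) : List Symbol := encVars S.n ++ encFormula S.Φ

/-- The sentence is true over the reals. -/
def Sentence.IsTrue (S : Sentence) : Prop := ∃ x : Fin S.n → ℝ, S.Φ.Holds x

/-! ### Valley-Separated Clusters -/

/-- An instance of VSC: a polynomial `f ∈ ℤ[x₁, …, x_d]` and a rational threshold `θ > 0`. -/
structure VSCInstance where
  d : ℕ
  f : SumOfMonomials d
  θ : ℚ
  θ_pos : 0 < θ

def VSCInstance.encode (I : VSCInstance) : List Symbol :=
  encVars I.d ++ (encPoly I.f ++ encPosRat I.θ)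

/-- There are two points of `ℝ^d` where `f` is at least `θ` and whose midpoint has value
strictly below `θ`. -/
def VSCInstance.HasValley (I : VSCInstance) : Prop :=
  ∃ p q : Fin I.d → ℝ,
    (I.θ : ℝ) ≤ I.f.eval p ∧ (I.θ : ℝ) ≤ I.f.eval q ∧
      I.f.eval ((1 / 2 : ℝ) • (p + q)) < (I.θ : ℝ)

/-! ### The encodings are injective -/

/-- An encoding that can be decoded from the front of a longer string. -/
def SelfDelimiting {α : Type} (enc : α → List Symbol) : Prop :=
  ∀ a b u v, enc a ++ u = enc b ++ v → a = b ∧ u = v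

theorem SelfDelimiting.injective {α : Type} {enc : α → List Symbol} (h : SelfDelimiting enc) :
    Function.Injective enc := fun a b hab => (h a b [] [] (by rw [hab])).1

theorem bits_semi_inj : ∀ (l m : List Bool) (u v : List Symbol),
    l.map Symbol.bit ++ Symbol.semi :: u = m.map Symbol.bit ++ Symbol.semi :: v →
      l = m ∧ u = v
  | [], [], u, v, h => by simpa using h
  | [], b :: m, u, v, h => by simp at h
  | a :: l, [], u, v, h => by simp at h
  | a :: l, b :: m, u, v, h => by
    simp only [List.map_cons, List.cons_append, List.cons.injEq, Symbol.bit.injEq] at h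
    obtain ⟨h1, h2⟩ := bits_semi_inj l m u v h.2
    exact ⟨by rw [h.1, h1], h2⟩

theorem encNat_selfDelimiting : SelfDelimiting encNat := by
  intro a b u v h
  simp only [encNat, List.append_assoc, List.singleton_append] at h
  obtain ⟨h1, h2⟩ := bits_semi_inj _ _ _ _ h
  refine ⟨?_, h2⟩
  have hinj : Function.LeftInverse (fun l : List Bool => l.foldr Nat.bit 0) Nat.bits := by
    intro n
    induction n using Nat.binaryRec' with
    | zero => simp
    | bit b n hn ih => simp [Nat.bits_append_bit n b hn, ih]
  exact hinj.injective h1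

theorem encInt_selfDelimiting : SelfDelimiting encInt := by
  intro a b u v h
  simp only [encInt, List.cons_append, List.cons.injEq] at h
  obtain ⟨h1, h2⟩ := encNat_selfDelimiting _ _ _ _ h.2
  refine ⟨?_, h2⟩
  have h3 := h.1
  split_ifs at h3 <;> omega

theorem encTuple_inj : ∀ (l m : List ℕ) (u v : List Symbol), l.length = m.length →
    l.flatMap encNat ++ u = m.flatMap encNat ++ v → l = m ∧ u = v
  | [], [], u, v, _, h => by simpa using h
  | [], b :: m, u, v, hl, _ => by simp at hl
  | a :: l, [], u, v, hl, _ => by simp at hl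
  | a :: l, b :: m, u, v, hl, h => by
    simp only [List.flatMap_cons, List.append_assoc] at h
    obtain ⟨h1, h2⟩ := encNat_selfDelimiting _ _ _ _ h
    obtain ⟨h3, h4⟩ := encTuple_inj l m u v (by simpa using hl) h2
    exact ⟨by rw [h1, h3], h4⟩

theorem encTerm_selfDelimiting {n : ℕ} : SelfDelimiting (encTerm (n := n)) := by
  rintro ⟨c, e⟩ ⟨c', e'⟩ u v h
  simp only [encTerm, List.append_assoc] at h
  obtain ⟨h1, h2⟩ := encInt_selfDelimiting _ _ _ _ h
  obtain ⟨h3, h4⟩ := encTuple_inj _ _ _ _ (by simp) h2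
  exact ⟨by rw [h1, List.ofFn_injective h3], h4⟩

theorem encTerm_ne_semi {n : ℕ} (t : ℤ × (Fin n → ℕ)) (u v : List Symbol) :
    encTerm t ++ u ≠ Symbol.semi :: v := by
  simp only [encTerm, encInt, List.cons_append, ne_eq, List.cons.injEq, not_and]
  intro h
  split_ifs at h

theorem encTerms_inj {n : ℕ} : ∀ (P Q : SumOfMonomials n) (u v : List Symbol),
    P.flatMap encTerm ++ Symbol.semi :: u = Q.flatMap encTerm ++ Symbol.semi :: v →
      P = Q ∧ u = v
  | [], [], u, v, h => by simpa using h
  | [], t :: Q, u, v, h => by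
    rw [List.flatMap_cons, List.append_assoc] at h
    exact absurd h.symm (encTerm_ne_semi _ _ _)
  | s :: P, [], u, v, h => by
    rw [List.flatMap_cons, List.append_assoc] at h
    exact absurd h (encTerm_ne_semi _ _ _)
  | s :: P, t :: Q, u, v, h => by
    simp only [List.flatMap_cons, List.append_assoc] at h
    obtain ⟨h1, h2⟩ := encTerm_selfDelimiting _ _ _ _ h
    obtain ⟨h3, h4⟩ := encTerms_inj P Q u v h2
    exact ⟨by rw [h1, h3], h4⟩

theorem encPoly_selfDelimiting {n : ℕ} : SelfDelimiting (encPoly (n := n)) := by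
  intro P Q u v h
  simp only [encPoly, List.append_assoc, List.singleton_append] at h
  exact encTerms_inj P Q u v h

theorem encVars_selfDelimiting : SelfDelimiting encVars := by
  intro a
  induction a with
  | zero =>
    intro b u v h
    cases b <;> simp_all [encVars, List.replicate_succ]
  | succ a ih =>
    intro b u v h
    cases b with
    | zero => simp [encVars, List.replicate_succ] at h
    | succ b =>
      simp only [encVars, List.replicate_succ, List.cons_append, List.cons.injEq,
        true_and] at h
      obtain ⟨h1, h2⟩ := ih b u v h
      exact ⟨by rw [h1], h2⟩

theorem encPosRat_inj {a b : ℚ} (ha : 0 < a) (hb : 0 < b) (h : encPosRat a = encPosRat b) :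
    a = b := by
  obtain ⟨h1, h2⟩ := encNat_selfDelimiting _ _ _ _ h
  have h3 := encNat_selfDelimiting.injective h2
  have := Rat.num_pos.mpr ha
  have := Rat.num_pos.mpr hb
  exact Rat.ext (by omega) h3

theorem encFormula_selfDelimiting {n : ℕ} : SelfDelimiting (encFormula (n := n)) := by
  intro φ
  induction φ with
  | atom c P =>
    intro ψ u v h
    cases ψ with
    | atom c' Q =>
      simp only [encFormula, List.cons_append, List.cons.injEq] at h
      obtain ⟨h1, h2⟩ := encPoly_selfDelimiting _ _ _ _ h.2
      have h3 : c = c' := by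
        have h4 := h.1
        cases c <;> cases c' <;> simp_all [Comparison.symbol]
      exact ⟨by rw [h1, h3], h2⟩
    | _ => cases c <;> simp [encFormula, Comparison.symbol] at h
  | not φ ih =>
    intro ψ u v h
    cases ψ with
    | atom c Q => cases c <;> simp [encFormula, Comparison.symbol] at h
    | not ψ =>
      simp only [encFormula, List.cons_append, List.cons.injEq, true_and] at h
      obtain ⟨h1, h2⟩ := ih _ _ _ h
      exact ⟨by rw [h1], h2⟩
    | _ => simp [encFormula] at h
  | and φ₁ φ₂ ih₁ ih₂ =>
    intro ψ u v h
    cases ψ with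
    | atom c Q => cases c <;> simp [encFormula, Comparison.symbol] at h
    | and ψ₁ ψ₂ =>
      simp only [encFormula, List.cons_append, List.append_assoc, List.cons.injEq,
        true_and] at h
      obtain ⟨h1, h2⟩ := ih₁ _ _ _ h
      obtain ⟨h3, h4⟩ := ih₂ _ _ _ h2
      exact ⟨by rw [h1, h3], h4⟩
    | _ => simp [encFormula] at h
  | or φ₁ φ₂ ih₁ ih₂ =>
    intro ψ u v h
    cases ψ with
    | atom c Q => cases c <;> simp [encFormula, Comparison.symbol] at h
    | or ψ₁ ψ₂ =>
      simp only [encFormula, List.cons_append, List.append_assoc, List.cons.injEq,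
        true_and] at h
      obtain ⟨h1, h2⟩ := ih₁ _ _ _ h
      obtain ⟨h3, h4⟩ := ih₂ _ _ _ h2
      exact ⟨by rw [h1, h3], h4⟩
    | _ => simp [encFormula] at h

theorem Sentence.encode_injective : Function.Injective Sentence.encode := by
  rintro ⟨n, φ⟩ ⟨m, ψ⟩ h
  obtain ⟨h1, h2⟩ := encVars_selfDelimiting _ _ _ _ h
  dsimp only at h1
  subst h1
  obtain rfl : φ = ψ := encFormula_selfDelimiting.injective h2
  rfl

theorem VSCInstance.encode_injective : Function.Injective VSCInstance.encode := by
  rintro ⟨d, f, θ, hθ⟩ ⟨d', f', θ', hθ'⟩ h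
  obtain ⟨h1, h2⟩ := encVars_selfDelimiting _ _ _ _ h
  dsimp only at h1
  subst h1
  obtain ⟨h3, h4⟩ := encPoly_selfDelimiting _ _ _ _ h2
  dsimp only at h3 h4
  subst h3
  obtain rfl := encPosRat_inj hθ hθ' h4
  rfl

/-! ### The problems and the class -/

/-- The existential theory of the reals: is a given existential sentence true over `ℝ`? -/
def ETR : DecisionProblem where
  Instance := Sentence
  Alphabet := Symbol
  alphabet_finite := inferInstance
  encode := Sentence.encode
  encode_injective := Sentence.encode_injective
  Yes := {S | S.IsTrue}

/-- Valley-Separated Clusters. -/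
def VSC : DecisionProblem where
  Instance := VSCInstance
  Alphabet := Symbol
  alphabet_finite := inferInstance
  encode := VSCInstance.encode
  encode_injective := VSCInstance.encode_injective
  Yes := {I | I.HasValley}

/-- The complexity class `∃ℝ`: the decision problems that are polynomial-time many-one reducible
to the existential theory of the reals. -/
def ExistsR : Set DecisionProblem := {P | PolyTimeReducible P ETR}

/-- `Q` is `∃ℝ`-hard: every problem in `∃ℝ` reduces to `Q`. -/
def ExistsRHard (Q : DecisionProblem) : Prop := ∀ P ∈ ExistsR, PolyTimeReducible P Q

/-- `Q` is `∃ℝ`-complete: it belongs to `∃ℝ` and is `∃ℝ`-hard. -/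
def ExistsRComplete (Q : DecisionProblem) : Prop := Q ∈ ExistsR ∧ ExistsRHard Q

end ExistsReals

/-! ### Turing machines: polynomial-time maps are closed under composition. -/

namespace ExistsReals

open Turing StateTransition

/-! ### Iterated steps -/

/-! Membership. The condition on `f` and `θ` becomes an existential sentence in one variable `t` for
the threshold, the interleaved coordinates of `p`, `q` and a third point `m`, and two spare
variables. It says `θ.den * t = θ.num`, `p i + q i = 2 * m i` for every `i`, `f(p) - t ≥ 0`, `f(q) -
t ≥ 0` and not `f(m) - t ≥ 0`. Since `m` and `t` are variables, nothing has to be expanded: `f` is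
copied three times with its exponent vectors spread out and shifted. Correctness is
`Membership.toETR_correct`, by way of `holds_core` and `holds_chain`.

Hardness. By `PolyTimeReducible.trans` it is enough to reduce ETR to VSC. A formula in prefix
notation, read from right to left, is a straight-line program: monomials are built by repeated
squaring, coefficients by doubling, and truth values are kept on a stack. Every operation gets two
new real variables, tied to earlier ones by equations of degree at most three. Comparisons become
equations as well: `y² - w² = p`, `y * w = 0` splits `p` into positive and negative part, and `r * a
= 0`, `r * b + a = 1` forces `a` to be the truth value of `r = 0`. The whole stack is a single real
number whose ternary digits are `0` and `2`.

The polynomial of the instance is `1` minus the sum of the squares of all equations, with `θ = 1`;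
hence it reaches the threshold exactly where every equation holds. The last equations say that the
formula came out true and that `s² = 1` for a coordinate `s` occurring nowhere else. A true sentence
yields solutions with `s = 1` and with `s = -1`; their midpoint has `s = 0` and lies below the
threshold. Conversely, any point at the threshold contains a point satisfying the formula. This is
`Hardness.toVSC_correct`; it rests on `sum_progTerms`, `leads_of_satAll`, `exists_satAll` and
`leads_formula`.

Polynomial time. Both reductions are computed by a `Sweeper`, which turns its input into a list of
instructions and a row of cells, then sweeps over the row once per instruction. Both lists are
linear in the input, so the time is quadratic (`Sweeper.polyTime`). What remains is to check that
the output string is the encoding of the intended instance (the two `run_machine` theorems). -/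

/-- `f` leads from `a` to `b` in exactly `n` steps. -/
def StepN {σ : Type*} (f : σ → Option σ) (n : ℕ) (a b : σ) : Prop :=
  (flip bind f)^[n] (some a) = some b

theorem StepN.refl {σ : Type*} (f : σ → Option σ) (a : σ) : StepN f 0 a a := rfl

theorem StepN.trans {σ : Type*} {f : σ → Option σ} {n m : ℕ} {a b c : σ}
    (h₁ : StepN f n a b) (h₂ : StepN f m b c) : StepN f (n + m) a c := by
  unfold StepN at *
  rw [Nat.add_comm, Function.iterate_add_apply, h₁, h₂]

theorem StepN.single {σ : Type*} {f : σ → Option σ} {a b : σ} (h : f a = some b) :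
    StepN f 1 a b := h

theorem StepN.head {σ : Type*} {f : σ → Option σ} {n : ℕ} {a b c : σ}
    (h₁ : f a = some b) (h₂ : StepN f n b c) : StepN f (n + 1) a c := by
  rw [Nat.add_comm]
  exact (StepN.single h₁).trans h₂

theorem StepN.of_eq {σ : Type*} {f : σ → Option σ} {n m : ℕ} {a b : σ}
    (h : StepN f n a b) (e : n = m) : StepN f m a b := e ▸ h

theorem iterate_bind_none {σ : Type*} (f : σ → Option σ) (n : ℕ) :
    (flip bind f)^[n] none = none := by
  induction n with
  | zero => rfl
  | succ n ih => rw [Function.iterate_succ_apply]; exact ih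

theorem StepN.succ_iff {σ : Type*} {f : σ → Option σ} {n : ℕ} {a c : σ} :
    StepN f (n + 1) a c ↔ ∃ b, f a = some b ∧ StepN f n b c := by
  unfold StepN
  rw [Function.iterate_succ_apply]
  change (flip bind f)^[n] (f a) = some c ↔ _
  cases h : f a with
  | none => rw [iterate_bind_none]; simp
  | some b => simp

/-! ### Stack lengths along a run -/

section Length

variable {K : Type*} [DecidableEq K] {Γ : K → Type*} {Λ σ : Type*}

/-- The largest number of symbols pushed by a statement. -/
def pushCount : TM2.Stmt Γ Λ σ → ℕ
  | .push _ _ q => pushCount q + 1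
  | .peek _ _ q => pushCount q
  | .pop _ _ q => pushCount q
  | .load _ q => pushCount q
  | .branch _ q₁ q₂ => max (pushCount q₁) (pushCount q₂)
  | .goto _ => 0
  | .halt => 0

theorem length_stepAux_le (k : K) (q : TM2.Stmt Γ Λ σ) (v : σ) (S : ∀ k, List (Γ k)) :
    ((TM2.stepAux q v S).stk k).length ≤ (S k).length + pushCount q := by
  induction q generalizing v S with
  | push k' f q ih =>
    refine (ih _ _).trans ?_
    by_cases h : k = k'
    · subst h; simp [pushCount]; omega
    · simp [pushCount, Function.update_of_ne h]
  | peek k' f q ih => exact ih _ _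
  | pop k' f q ih =>
    refine (ih _ _).trans ?_
    by_cases h : k = k'
    · subst h; simp [pushCount]
    · simp [pushCount, Function.update_of_ne h]
  | load f q ih => exact ih _ _
  | branch f q₁ q₂ ih₁ ih₂ =>
    simp only [TM2.stepAux, pushCount]
    cases f v
    · exact (ih₂ v S).trans (by simp)
    · exact (ih₁ v S).trans (by simp)
  | goto f => simp
  | halt => simp

/-- Bounds the output of the first machine, which is the input of the second: a step pushes at most
`C` symbols. -/
theorem length_stepN_le (M : Λ → TM2.Stmt Γ Λ σ) (C : ℕ) (hC : ∀ l, pushCount (M l) ≤ C) (k : K)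
    (n : ℕ) (c c' : TM2.Cfg Γ Λ σ) (h : StepN (TM2.step M) n c c') :
    (c'.stk k).length ≤ (c.stk k).length + n * C := by
  induction n generalizing c with
  | zero =>
    obtain rfl : c = c' := by simpa [StepN] using h
    simp
  | succ n ih =>
    obtain ⟨b, hb, hn⟩ := StepN.succ_iff.1 h
    refine (ih b hn).trans ?_
    obtain ⟨l, v, S⟩ := c
    cases l with
    | none => simp at hb
    | some l =>
      simp only [TM2.step, Option.some.injEq] at hb
      subst hb
      have := length_stepAux_le k (M l) v S
      have := hC l
      simp only [Nat.succ_mul]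
      omega

end Length

theorem initList_eq (tm : FinTM2) (s : List (tm.Γ tm.k₀)) :
    initList tm s = ⟨some tm.main, tm.initialState,
      Function.update (fun _ => []) tm.k₀ s⟩ := by
  unfold initList
  congr 1
  funext k
  by_cases h : k = tm.k₀
  · subst h; simp
  · simp [h]

theorem haltList_eq (tm : FinTM2) (s : List (tm.Γ tm.k₁)) :
    haltList tm s = ⟨none, tm.initialState,
      Function.update (fun _ => []) tm.k₁ s⟩ := by
  unfold haltList
  congr 1
  funext k
  by_cases h : k = tm.k₁
  · subst h; simp
  · simp [h]

theorem polynomial_eval_mono (p : Polynomial ℕ) {a b : ℕ} (h : a ≤ b) : p.eval a ≤ p.eval b := by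
  simp only [Polynomial.eval_eq_sum_range]
  gcongr

/-! ### Composition of machines -/

section Comp

variable (tm₁ tm₂ : FinTM2) (e : tm₁.Γ tm₁.k₁ ≃ tm₂.Γ tm₂.k₀)

/-- Labels of the composed machine: those of the two machines, and those of the two loops that
move the output of the first machine to an auxiliary stack and from there to the input stack of
the second. -/
inductive CompLabel (Λ₁ Λ₂ G : Type)
  | first (l : Λ₁)
  | second (l : Λ₂)
  | unload
  | unloadPut (g : G)
  | reload
  | reloadPut (g : G)
  deriving Fintype

/-- Stack alphabets of the composed machine. -/
abbrev CompΓ : tm₁.K ⊕ tm₂.K ⊕ Unit → Type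
  | .inl k => tm₁.Γ k
  | .inr (.inl k) => tm₂.Γ k
  | .inr (.inr _) => tm₂.Γ tm₂.k₀

abbrev CompΛ := CompLabel tm₁.Λ tm₂.Λ (tm₂.Γ tm₂.k₀)

abbrev Compσ := tm₁.σ × tm₂.σ × Option (tm₂.Γ tm₂.k₀)

/-- Statements of the first machine, which hand over instead of halting. -/
def liftFirst : TM2.Stmt tm₁.Γ tm₁.Λ tm₁.σ → TM2.Stmt (CompΓ tm₁ tm₂) (CompΛ tm₁ tm₂) (Compσ tm₁ tm₂)
  | .push k f q => .push (.inl k) (fun v => f v.1) (liftFirst q)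
  | .peek k f q => .peek (.inl k) (fun v o => (f v.1 o, v.2)) (liftFirst q)
  | .pop k f q => .pop (.inl k) (fun v o => (f v.1 o, v.2)) (liftFirst q)
  | .load f q => .load (fun v => (f v.1, v.2)) (liftFirst q)
  | .branch f q₁ q₂ => .branch (fun v => f v.1) (liftFirst q₁) (liftFirst q₂)
  | .goto f => .goto fun v => .first (f v.1)
  | .halt => .goto fun _ => .unload

/-- Statements of the second machine. -/
def liftSecond : TM2.Stmt tm₂.Γ tm₂.Λ tm₂.σ → TM2.Stmt (CompΓ tm₁ tm₂) (CompΛ tm₁ tm₂) (Compσ tm₁ tm₂)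
  | .push k f q => .push (.inr (.inl k)) (fun v => f v.2.1) (liftSecond q)
  | .peek k f q => .peek (.inr (.inl k)) (fun v o => (v.1, f v.2.1 o, v.2.2)) (liftSecond q)
  | .pop k f q => .pop (.inr (.inl k)) (fun v o => (v.1, f v.2.1 o, v.2.2)) (liftSecond q)
  | .load f q => .load (fun v => (v.1, f v.2.1, v.2.2)) (liftSecond q)
  | .branch f q₁ q₂ => .branch (fun v => f v.2.1) (liftSecond q₁) (liftSecond q₂)
  | .goto f => .goto fun v => .second (f v.2.1)
  | .halt => .halt

/-- The program of the composed machine. -/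
def compProg : CompΛ tm₁ tm₂ → TM2.Stmt (CompΓ tm₁ tm₂) (CompΛ tm₁ tm₂) (Compσ tm₁ tm₂)
  | .first l => liftFirst tm₁ tm₂ (tm₁.m l)
  | .second l => liftSecond tm₁ tm₂ (tm₂.m l)
  | .unload => .pop (.inl tm₁.k₁) (fun v o => (v.1, v.2.1, o.map e)) <|
      .goto fun v => match v.2.2 with
        | some g => .unloadPut g
        | none => .reload
  | .unloadPut g => .push (.inr (.inr ())) (fun _ => g) <| .goto fun _ => .unload
  | .reload => .pop (.inr (.inr ())) (fun v o => (v.1, v.2.1, o)) <|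
      .goto fun v => match v.2.2 with
        | some g => .reloadPut g
        | none => .second tm₂.main
  | .reloadPut g => .push (.inr (.inl tm₂.k₀)) (fun _ => g) <| .goto fun _ => .reload

/-- The composed machine. -/
def compTM : FinTM2 where
  K := tm₁.K ⊕ tm₂.K ⊕ Unit
  kDecidableEq := inferInstance
  kFin := by haveI := tm₁.kFin; haveI := tm₂.kFin; infer_instance
  k₀ := .inl tm₁.k₀
  k₁ := .inr (.inl tm₂.k₁)
  Γ := CompΓ tm₁ tm₂
  Λ := CompΛ tm₁ tm₂
  main := .first tm₁.main
  ΛFin := by haveI := tm₁.ΛFin; haveI := tm₂.ΛFin; haveI := tm₂.Γk₀Fin; infer_instance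
  σ := Compσ tm₁ tm₂
  initialState := (tm₁.initialState, tm₂.initialState, none)
  σFin := by haveI := tm₁.σFin; haveI := tm₂.σFin; haveI := tm₂.Γk₀Fin; infer_instance
  Γk₀Fin := tm₁.Γk₀Fin
  m := compProg tm₁ tm₂ e

/-- The stacks of the composed machine. -/
def compStk (S₁ : ∀ k, List (tm₁.Γ k)) (S₂ : ∀ k, List (tm₂.Γ k)) (T : List (tm₂.Γ tm₂.k₀)) :
    ∀ k, List (CompΓ tm₁ tm₂ k)
  | .inl k => S₁ k
  | .inr (.inl k) => S₂ k
  | .inr (.inr _) => T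

variable {tm₁ tm₂}

theorem update_compStk_first (S₁ : ∀ k, List (tm₁.Γ k)) (S₂ : ∀ k, List (tm₂.Γ k))
    (T : List (tm₂.Γ tm₂.k₀)) (k : tm₁.K) (x : List (tm₁.Γ k)) :
    Function.update (compStk tm₁ tm₂ S₁ S₂ T) (.inl k) x
      = compStk tm₁ tm₂ (Function.update S₁ k x) S₂ T := by
  funext k'
  rcases k' with k' | k' | k'
  · by_cases h : k' = k
    · subst h; simp [compStk]
    · simp [compStk, h]
  · simp [compStk]
  · simp [compStk]

theorem update_compStk_second (S₁ : ∀ k, List (tm₁.Γ k)) (S₂ : ∀ k, List (tm₂.Γ k))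
    (T : List (tm₂.Γ tm₂.k₀)) (k : tm₂.K) (x : List (tm₂.Γ k)) :
    Function.update (compStk tm₁ tm₂ S₁ S₂ T) (.inr (.inl k)) x
      = compStk tm₁ tm₂ S₁ (Function.update S₂ k x) T := by
  funext k'
  rcases k' with k' | k' | k'
  · simp [compStk]
  · by_cases h : k' = k
    · subst h; simp [compStk]
    · simp [compStk, h]
  · simp [compStk]

theorem update_compStk_aux (S₁ : ∀ k, List (tm₁.Γ k)) (S₂ : ∀ k, List (tm₂.Γ k))
    (T x : List (tm₂.Γ tm₂.k₀)) :
    Function.update (compStk tm₁ tm₂ S₁ S₂ T) (.inr (.inr ())) x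
      = compStk tm₁ tm₂ S₁ S₂ x := by
  funext k'
  rcases k' with k' | k' | k' <;> simp [compStk]

/-- A configuration of the first machine, seen in the composed machine. -/
def embedFirst (w : tm₂.σ × Option (tm₂.Γ tm₂.k₀)) (S₂ : ∀ k, List (tm₂.Γ k))
    (T : List (tm₂.Γ tm₂.k₀)) (c : TM2.Cfg tm₁.Γ tm₁.Λ tm₁.σ) :
    TM2.Cfg (CompΓ tm₁ tm₂) (CompΛ tm₁ tm₂) (Compσ tm₁ tm₂) :=
  ⟨some (match c.l with | some l => .first l | none => .unload), (c.var, w),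
    compStk tm₁ tm₂ c.stk S₂ T⟩

/-- A configuration of the second machine, seen in the composed machine. -/
def embedSecond (u : tm₁.σ) (o : Option (tm₂.Γ tm₂.k₀)) (S₁ : ∀ k, List (tm₁.Γ k))
    (T : List (tm₂.Γ tm₂.k₀)) (c : TM2.Cfg tm₂.Γ tm₂.Λ tm₂.σ) :
    TM2.Cfg (CompΓ tm₁ tm₂) (CompΛ tm₁ tm₂) (Compσ tm₁ tm₂) :=
  ⟨c.l.map .second, (u, c.var, o), compStk tm₁ tm₂ S₁ c.stk T⟩

theorem stepAux_liftFirst (w : tm₂.σ × Option (tm₂.Γ tm₂.k₀)) (S₂ : ∀ k, List (tm₂.Γ k))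
    (T : List (tm₂.Γ tm₂.k₀)) (q : TM2.Stmt tm₁.Γ tm₁.Λ tm₁.σ) (v : tm₁.σ)
    (S₁ : ∀ k, List (tm₁.Γ k)) :
    TM2.stepAux (liftFirst tm₁ tm₂ q) (v, w) (compStk tm₁ tm₂ S₁ S₂ T)
      = embedFirst w S₂ T (TM2.stepAux q v S₁) := by
  induction q generalizing v S₁ with
  | push k f q ih =>
    simp only [liftFirst, TM2.stepAux, update_compStk_first]
    exact ih _ _
  | peek k f q ih =>
    simp only [liftFirst, TM2.stepAux]
    exact ih _ _
  | pop k f q ih =>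
    simp only [liftFirst, TM2.stepAux, update_compStk_first]
    exact ih _ _
  | load f q ih =>
    simp only [liftFirst, TM2.stepAux]
    exact ih _ _
  | branch f q₁ q₂ ih₁ ih₂ =>
    simp only [liftFirst, TM2.stepAux]
    cases f v
    · exact ih₂ _ _
    · exact ih₁ _ _
  | goto f => rfl
  | halt => rfl

theorem stepAux_liftSecond (u : tm₁.σ) (o : Option (tm₂.Γ tm₂.k₀)) (S₁ : ∀ k, List (tm₁.Γ k))
    (T : List (tm₂.Γ tm₂.k₀)) (q : TM2.Stmt tm₂.Γ tm₂.Λ tm₂.σ) (v : tm₂.σ)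
    (S₂ : ∀ k, List (tm₂.Γ k)) :
    TM2.stepAux (liftSecond tm₁ tm₂ q) (u, v, o) (compStk tm₁ tm₂ S₁ S₂ T)
      = embedSecond u o S₁ T (TM2.stepAux q v S₂) := by
  induction q generalizing v S₂ with
  | push k f q ih =>
    simp only [liftSecond, TM2.stepAux, update_compStk_second]
    exact ih _ _
  | peek k f q ih =>
    simp only [liftSecond, TM2.stepAux]
    exact ih _ _
  | pop k f q ih =>
    simp only [liftSecond, TM2.stepAux, update_compStk_second]
    exact ih _ _
  | load f q ih =>
    simp only [liftSecond, TM2.stepAux]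
    exact ih _ _
  | branch f q₁ q₂ ih₁ ih₂ =>
    simp only [liftSecond, TM2.stepAux]
    cases f v
    · exact ih₂ _ _
    · exact ih₁ _ _
  | goto f => rfl
  | halt => rfl

/-- The simulation is step by step, also at the end: halting of the first machine is represented by
the label `unload`, so no extra step is needed. -/
theorem stepN_embedFirst (w : tm₂.σ × Option (tm₂.Γ tm₂.k₀)) (S₂ : ∀ k, List (tm₂.Γ k))
    (T : List (tm₂.Γ tm₂.k₀)) (n : ℕ) (c c' : TM2.Cfg tm₁.Γ tm₁.Λ tm₁.σ)
    (h : StepN (TM2.step tm₁.m) n c c') :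
    StepN (TM2.step (compProg tm₁ tm₂ e)) n (embedFirst w S₂ T c) (embedFirst w S₂ T c') := by
  induction n generalizing c with
  | zero =>
    obtain rfl : c = c' := by simpa [StepN] using h
    exact StepN.refl _ _
  | succ n ih =>
    obtain ⟨b, hb, hn⟩ := StepN.succ_iff.1 h
    refine StepN.head ?_ (ih b hn)
    obtain ⟨l, v, S⟩ := c
    cases l with
    | none => simp at hb
    | some l =>
      simp only [TM2.step, Option.some.injEq] at hb
      subst hb
      exact congrArg some (stepAux_liftFirst w S₂ T _ _ _)

theorem stepN_embedSecond (u : tm₁.σ) (o : Option (tm₂.Γ tm₂.k₀)) (S₁ : ∀ k, List (tm₁.Γ k))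
    (T : List (tm₂.Γ tm₂.k₀)) (n : ℕ) (c c' : TM2.Cfg tm₂.Γ tm₂.Λ tm₂.σ)
    (h : StepN (TM2.step tm₂.m) n c c') :
    StepN (TM2.step (compProg tm₁ tm₂ e)) n (embedSecond u o S₁ T c)
      (embedSecond u o S₁ T c') := by
  induction n generalizing c with
  | zero =>
    obtain rfl : c = c' := by simpa [StepN] using h
    exact StepN.refl _ _
  | succ n ih =>
    obtain ⟨b, hb, hn⟩ := StepN.succ_iff.1 h
    refine StepN.head ?_ (ih b hn)
    obtain ⟨l, v, S⟩ := c
    cases l with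
    | none => simp at hb
    | some l =>
      simp only [TM2.step, Option.some.injEq] at hb
      subst hb
      exact congrArg some (stepAux_liftSecond u o S₁ T _ _ _)

/-- Moving a stack symbol by symbol reverses it. The transfer therefore passes through the auxiliary
stack, and `stepN_reload` reverses a second time. -/
theorem stepN_unload (u : tm₁.σ) (v : tm₂.σ) (S₁ : ∀ k, List (tm₁.Γ k))
    (S₂ : ∀ k, List (tm₂.Γ k)) (s : List (tm₁.Γ tm₁.k₁)) (o : Option (tm₂.Γ tm₂.k₀))
    (T : List (tm₂.Γ tm₂.k₀)) :
    StepN (TM2.step (compProg tm₁ tm₂ e)) (2 * s.length + 1)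
      ⟨some .unload, (u, v, o), compStk tm₁ tm₂ (Function.update S₁ tm₁.k₁ s) S₂ T⟩
      ⟨some .reload, (u, v, none), compStk tm₁ tm₂ (Function.update S₁ tm₁.k₁ []) S₂
        ((s.map e).reverse ++ T)⟩ := by
  induction s generalizing o T with
  | nil =>
    refine StepN.single ?_
    simp [compProg, compStk, update_compStk_first]
  | cons g s ih =>
    rw [List.map_cons, List.reverse_cons, List.append_assoc]
    refine StepN.of_eq (StepN.head (b := ⟨some (.unloadPut (e g)), (u, v, some (e g)),
      compStk tm₁ tm₂ (Function.update S₁ tm₁.k₁ s) S₂ T⟩) ?_ (StepN.head ?_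
        (ih (some (e g)) (e g :: T)))) ?_
    · simp [compProg, compStk, update_compStk_first]
    · simp [compProg, compStk, update_compStk_aux]
    · simp; omega

theorem stepN_reload (u : tm₁.σ) (v : tm₂.σ) (S₁ : ∀ k, List (tm₁.Γ k))
    (S₂ : ∀ k, List (tm₂.Γ k)) (s T : List (tm₂.Γ tm₂.k₀)) (o : Option (tm₂.Γ tm₂.k₀)) :
    StepN (TM2.step (compProg tm₁ tm₂ e)) (2 * s.length + 1)
      ⟨some .reload, (u, v, o), compStk tm₁ tm₂ S₁ (Function.update S₂ tm₂.k₀ T) s⟩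
      ⟨some (.second tm₂.main), (u, v, none), compStk tm₁ tm₂ S₁
        (Function.update S₂ tm₂.k₀ (s.reverse ++ T)) []⟩ := by
  induction s generalizing o T with
  | nil =>
    refine StepN.single ?_
    simp [compProg, compStk, update_compStk_aux]
  | cons g s ih =>
    rw [List.reverse_cons, List.append_assoc]
    refine StepN.of_eq (StepN.head (b := ⟨some (.reloadPut g), (u, v, some g),
      compStk tm₁ tm₂ S₁ (Function.update S₂ tm₂.k₀ T) s⟩) ?_ (StepN.head ?_
        (ih (g :: T) (some g)))) ?_
    · simp [compProg, compStk, update_compStk_aux]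
    · simp [compProg, compStk, update_compStk_second]
    · simp; omega

/-- A halting configuration has its memory reset and all stacks but the output empty. So after the
transfer nothing of the first computation is left over, and the second machine starts from a genuine
initial configuration. -/
theorem stepN_compProg {n₁ n₂ : ℕ} (s : List (tm₁.Γ tm₁.k₀)) (t : List (tm₁.Γ tm₁.k₁))
    (r : List (tm₂.Γ tm₂.k₁)) (h₁ : StepN tm₁.step n₁ (initList tm₁ s) (haltList tm₁ t))
    (h₂ : StepN tm₂.step n₂ (initList tm₂ (t.map e)) (haltList tm₂ r)) :
    StepN (TM2.step (compProg tm₁ tm₂ e)) (n₁ + (2 * t.length + 1) + (2 * t.length + 1) + n₂)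
      ⟨some (.first tm₁.main), (tm₁.initialState, tm₂.initialState, none),
        compStk tm₁ tm₂ (Function.update (fun _ => []) tm₁.k₀ s) (fun _ => []) []⟩
      ⟨none, (tm₁.initialState, tm₂.initialState, none),
        compStk tm₁ tm₂ (fun _ => []) (Function.update (fun _ => []) tm₂.k₁ r) []⟩ := by
  rw [initList_eq, haltList_eq] at h₁ h₂
  have H₁ := stepN_embedFirst e (tm₂.initialState, none) (fun _ => []) [] n₁ _ _ h₁
  have H₂ := stepN_unload e tm₁.initialState tm₂.initialState (fun _ => []) (fun _ => []) t none []
  have H₃ := stepN_reload (tm₁ := tm₁) e tm₁.initialState tm₂.initialState (fun _ => [])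
    (fun _ => []) (t.map e).reverse [] none
  have H₄ := stepN_embedSecond e tm₁.initialState none (fun _ => []) [] n₂ _ _ h₂
  have E₁ : Function.update (fun k : tm₁.K => ([] : List (tm₁.Γ k))) tm₁.k₁ [] = fun _ => [] :=
    Function.update_eq_self tm₁.k₁ (fun _ => [])
  have E₂ : Function.update (fun k : tm₂.K => ([] : List (tm₂.Γ k))) tm₂.k₀ [] = fun _ => [] :=
    Function.update_eq_self tm₂.k₀ (fun _ => [])
  simp only [List.reverse_reverse, List.length_reverse, List.length_map, List.append_nil,
    E₁, E₂] at H₂ H₃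
  exact ((H₁.trans H₂).trans H₃).trans H₄

theorem stepN_compTM {n₁ n₂ : ℕ} (s : List (tm₁.Γ tm₁.k₀)) (t : List (tm₁.Γ tm₁.k₁))
    (r : List (tm₂.Γ tm₂.k₁)) (h₁ : StepN tm₁.step n₁ (initList tm₁ s) (haltList tm₁ t))
    (h₂ : StepN tm₂.step n₂ (initList tm₂ (t.map e)) (haltList tm₂ r)) :
    StepN (compTM tm₁ tm₂ e).step (n₁ + (2 * t.length + 1) + (2 * t.length + 1) + n₂)
      (initList (compTM tm₁ tm₂ e) s) (haltList (compTM tm₁ tm₂ e) r) := by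
  have H := stepN_compProg e s t r h₁ h₂
  have E₁ : compStk tm₁ tm₂ (fun _ => []) (fun _ => []) [] = fun _ => [] := by
    funext k
    rcases k with k | k | k <;> rfl
  rw [← update_compStk_first, ← update_compStk_second, E₁] at H
  have I₁ := initList_eq (compTM tm₁ tm₂ e) s
  have I₂ := haltList_eq (compTM tm₁ tm₂ e) r
  exact I₁.symm ▸ I₂.symm ▸ H

end Comp

/-- Maps computable in polynomial time are closed under composition. -/
theorem polyTime_comp {α β γ αΓ βΓ γΓ : Type} {eα : α → List αΓ} {eβ : β → List βΓ}
    {eγ : γ → List γΓ} {f : α → β} {g : β → γ} (h₁ : TM2ComputableInPolyTime eα eβ f)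
    (h₂ : TM2ComputableInPolyTime eβ eγ g) :
    Nonempty (TM2ComputableInPolyTime eα eγ (g ∘ f)) := by
  classical
  set e := h₁.outputAlphabet.trans h₂.inputAlphabet.symm with he
  obtain ⟨C, hC⟩ : ∃ C, ∀ l, pushCount (h₁.tm.m l) ≤ C := by
    have := h₁.tm.ΛFin
    exact ⟨Finset.univ.sup fun l => pushCount (h₁.tm.m l),
      fun l => Finset.le_sup (f := fun l => pushCount (h₁.tm.m l)) (Finset.mem_univ l)⟩
  have hstep : ∀ a, ∃ n₁ n₂, n₁ ≤ h₁.time.eval (eα a).length ∧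
      n₂ ≤ h₂.time.eval (eβ (f a)).length ∧
      (eβ (f a)).length ≤ (eα a).length + n₁ * C ∧
      StepN (compTM h₁.tm h₂.tm e).step
        (n₁ + (2 * (eβ (f a)).length + 1) + (2 * (eβ (f a)).length + 1) + n₂)
        (initList (compTM h₁.tm h₂.tm e) ((eα a).map h₁.inputAlphabet.invFun))
        (haltList (compTM h₁.tm h₂.tm e) ((eγ (g (f a))).map h₂.outputAlphabet.invFun)) := by
    intro a
    obtain ⟨⟨n₁, H₁⟩, hn₁⟩ := h₁.outputsFun a
    obtain ⟨⟨n₂, H₂⟩, hn₂⟩ := h₂.outputsFun (f a)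
    refine ⟨n₁, n₂, hn₁, hn₂, ?_, ?_⟩
    · have H₁' : StepN (TM2.step h₁.tm.m) n₁ (initList h₁.tm _) (haltList h₁.tm _) := H₁
      have := length_stepN_le h₁.tm.m C hC h₁.tm.k₁ n₁ _ _ H₁'
      rw [initList_eq, haltList_eq] at this
      simp only [Function.update_self, List.length_map] at this
      refine this.trans ?_
      gcongr
      -- At the start the output stack is empty, unless it is the input stack itself.
      by_cases h : h₁.tm.k₁ = h₁.tm.k₀
      · rw [h]; simp
      · simp [h]
    · have := stepN_compTM e _ ((eβ (f a)).map h₁.outputAlphabet.invFun)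
        ((eγ (g (f a))).map h₂.outputAlphabet.invFun) H₁ (n₂ := n₂) (by
          have : (List.map h₁.outputAlphabet.invFun (eβ (f a))).map e
              = List.map h₂.inputAlphabet.invFun (eβ (f a)) := by
            simp [he]
          rw [this]
          exact H₂)
      rw [List.length_map] at this
      exact this
  choose n₁ n₂ b₁ b₂ b₃ H using hstep
  refine ⟨⟨⟨compTM h₁.tm h₂.tm e, h₁.inputAlphabet, h₂.outputAlphabet⟩,
    -- `X + h₁.time * C` bounds the intermediate string; each of the two transfer loops takes two
    -- steps per symbol and one more.
    h₁.time + (4 * (Polynomial.X + h₁.time * Polynomial.C C) + 2) +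
      h₂.time.comp (Polynomial.X + h₁.time * Polynomial.C C),
    fun a => ⟨⟨_, H a⟩, ?_⟩⟩⟩
  have hle : (eβ (f a)).length ≤ (eα a).length + h₁.time.eval (eα a).length * C :=
    (b₃ a).trans (by gcongr; exact b₁ a)
  have h2 := (b₂ a).trans (polynomial_eval_mono h₂.time hle)
  have h1 := b₁ a
  simp only [Polynomial.eval_add, Polynomial.eval_mul, Polynomial.eval_comp, Polynomial.eval_X,
    Polynomial.eval_C, Polynomial.eval_ofNat]
  omega

theorem PolyTimeReducible.trans {A B C : DecisionProblem} (h₁ : PolyTimeReducible A B)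
    (h₂ : PolyTimeReducible B C) : PolyTimeReducible A C := by
  obtain ⟨f, ⟨hf⟩, hfy⟩ := h₁
  obtain ⟨g, ⟨hg⟩, hgy⟩ := h₂
  exact ⟨g ∘ f, polyTime_comp hf hg, fun a => (hfy a).trans (hgy _)⟩

end ExistsReals

/-! ### A machine model for string reductions that runs in quadratic time. -/

namespace ExistsReals

open Turing StateTransition

/-! ### Sweeping machines -/

/-- A sweeping machine first reads its input from left to right with a finite control `P`,
prepending instructions to an instruction stack and cells to a row. It then executes the
instructions one after the other; an instruction sweeps over the row with a finite control `Q`,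
rewriting the cells in place and prepending symbols to the output. -/
structure Sweeper (Γ A B O P Q : Type) where
  start : P
  base : List A
  feed : P → Γ → P × List A × List B
  last : List A × List B
  init : A → Q
  move : Q → B → Q × B × List O
  fin : Q → List O

namespace Sweeper

variable {Γ A B O P Q : Type} (M : Sweeper Γ A B O P Q)

/-- The instructions and the row after the input has been read. -/
def load : P → List Γ → List A → List B → List A × List B
  | _, [], I, R => (M.last.1 ++ I, M.last.2 ++ R)
  | p, x :: xs, I, R => load (M.feed p x).1 xs ((M.feed p x).2.1 ++ I) ((M.feed p x).2.2 ++ R)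

/-- The row after a sweep. -/
def rewrite : Q → List B → List B
  | _, [] => []
  | q, b :: r => (M.move q b).2.1 :: rewrite (M.move q b).1 r

/-- The string that a sweep prepends to the output. -/
def emit : Q → List B → List O
  | q, [] => M.fin q
  | q, b :: r => emit (M.move q b).1 r ++ (M.move q b).2.2

/-- The output after the given instructions have been executed. -/
def exec : List A → List B → List O → List O
  | [], _, out => out
  | a :: I, r, out => exec I (M.rewrite (M.init a) r) (M.emit (M.init a) r ++ out)

/-- The output of the machine. -/
def run (x : List Γ) : List O :=
  M.exec (M.load M.start x M.base []).1 (M.load M.start x M.base []).2 []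

@[simp] theorem length_rewrite (q : Q) (r : List B) : (M.rewrite q r).length = r.length := by
  induction r generalizing q with
  | nil => rfl
  | cons b r ih => simp [rewrite, ih]

/-- The stacks. -/
inductive Stack
  | input
  | instr
  | row
  | aux
  | output
  deriving DecidableEq

instance : Fintype Stack :=
  ⟨{.input, .instr, .row, .aux, .output}, fun k => by cases k <;> simp⟩

/-- The labels. -/
inductive Label (Γ A B P Q : Type)
  | start
  | read (p : P)
  | feed (p : P) (x : Γ)
  | last
  | next
  | pass (q : Q)
  | move (q : Q) (b : B)
  | fin (q : Q)
  | restore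
  | put (b : B)
  | clear
  | done
  deriving Fintype

/-- The stack alphabets. -/
abbrev StackΓ (Γ A B O : Type) : Stack → Type
  | .input => Γ
  | .instr => A
  | .row => B
  | .aux => B
  | .output => O

/-- The internal memory holds the symbol popped last. -/
abbrev Mem (Γ A B : Type) := Option (Γ ⊕ A ⊕ B)

/-- Push the symbols of a list, the first one ending up on top. -/
def pushAll {K : Type} {G : K → Type} {Λ σ : Type} (k : K) :
    List (G k) → TM2.Stmt G Λ σ → TM2.Stmt G Λ σ
  | [], q => q
  | a :: l, q => pushAll k l (.push k (fun _ => a) q)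

theorem stepAux_pushAll {K : Type} [DecidableEq K] {G : K → Type} {Λ σ : Type} (k : K)
    (l : List (G k)) (q : TM2.Stmt G Λ σ) (v : σ) (S : ∀ k, List (G k)) :
    TM2.stepAux (pushAll k l q) v S = TM2.stepAux q v (Function.update S k (l ++ S k)) := by
  induction l generalizing q with
  | nil => simp [pushAll]
  | cons a l ih => simp [pushAll, ih]

/-- The program. -/
def prog : Label Γ A B P Q → TM2.Stmt (StackΓ Γ A B O) (Label Γ A B P Q) (Mem Γ A B)
  | .start => pushAll .instr M.base <| .goto fun _ => .read M.start
  | .read p => .pop .input (fun _ o => o.map .inl) <| .goto fun v => match v with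
      | some (.inl x) => .feed p x
      | _ => .last
  | .feed p x => pushAll .instr (M.feed p x).2.1 <| pushAll .row (M.feed p x).2.2 <|
      .goto fun _ => .read (M.feed p x).1
  | .last => pushAll .instr M.last.1 <| pushAll .row M.last.2 <| .goto fun _ => .next
  | .next => .pop .instr (fun _ o => o.map (.inr ∘ .inl)) <| .goto fun v => match v with
      | some (.inr (.inl a)) => .pass (M.init a)
      | _ => .clear
  | .pass q => .pop .row (fun _ o => o.map (.inr ∘ .inr)) <| .goto fun v => match v with
      | some (.inr (.inr b)) => .move q b
      | _ => .fin q
  | .move q b => .push .aux (fun _ => (M.move q b).2.1) <|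
      pushAll .output (M.move q b).2.2 <| .goto fun _ => .pass (M.move q b).1
  | .fin q => pushAll .output (M.fin q) <| .goto fun _ => .restore
  | .restore => .pop .aux (fun _ o => o.map (.inr ∘ .inr)) <| .goto fun v => match v with
      | some (.inr (.inr b)) => .put b
      | _ => .next
  | .put b => .push .row (fun _ => b) <| .goto fun _ => .restore
  | .clear => .pop .row (fun _ o => o.map (.inr ∘ .inr)) <| .goto fun v => match v with
      | some (.inr (.inr _)) => .clear
      | _ => .done
  | .done => .halt

/-- The contents of the stacks. -/
def stk (x : List Γ) (I : List A) (R T : List B) (out : List O) : ∀ k, List (StackΓ Γ A B O k)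
  | .input => x
  | .instr => I
  | .row => R
  | .aux => T
  | .output => out

section Update

variable (x x' : List Γ) (I I' : List A) (R R' T T' : List B) (out out' : List O)

@[simp] theorem update_input : Function.update (stk x I R T out) .input x' = stk x' I R T out := by
  funext k; cases k <;> rfl
@[simp] theorem update_instr : Function.update (stk x I R T out) .instr I' = stk x I' R T out := by
  funext k; cases k <;> rfl
@[simp] theorem update_row : Function.update (stk x I R T out) .row R' = stk x I R' T out := by
  funext k; cases k <;> rfl
@[simp] theorem update_aux : Function.update (stk x I R T out) .aux T' = stk x I R T' out := by
  funext k; cases k <;> rfl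
@[simp] theorem update_output :
    Function.update (stk x I R T out) .output out' = stk x I R T out' := by
  funext k; cases k <;> rfl
@[simp] theorem stk_input : stk x I R T out .input = x := rfl
@[simp] theorem stk_instr : stk x I R T out .instr = I := rfl
@[simp] theorem stk_row : stk x I R T out .row = R := rfl
@[simp] theorem stk_aux : stk x I R T out .aux = T := rfl
@[simp] theorem stk_output : stk x I R T out .output = out := rfl

end Update

theorem stepN_read (x : List Γ) (p : P) (v : Mem Γ A B) (I : List A) (R : List B) :
    StepN (TM2.step M.prog) (2 * x.length + 2) ⟨some (.read p), v, stk x I R [] []⟩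
      ⟨some .next, none, stk [] (M.load p x I R).1 (M.load p x I R).2 [] []⟩ := by
  induction x generalizing p v I R with
  | nil =>
    refine StepN.head (b := ⟨some .last, none, stk [] I R [] []⟩) ?_ (StepN.single ?_)
    · simp [prog]
    · simp [prog, stepAux_pushAll, load]
  | cons a x ih =>
    refine StepN.of_eq (StepN.head (b := ⟨some (.feed p a), some (.inl a), stk x I R [] []⟩) ?_
      (StepN.head ?_ (ih (M.feed p a).1 (some (.inl a)) ((M.feed p a).2.1 ++ I)
        ((M.feed p a).2.2 ++ R)))) ?_
    · simp [prog]
    · simp [prog, stepAux_pushAll]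
    · simp; omega

/-- A sweep consumes the row and stacks the rewritten cells upside down on `aux`; `stepN_restore`
turns them back before the next instruction. -/
theorem stepN_pass (q : Q) (R T : List B) (v : Mem Γ A B) (I : List A) (out : List O) :
    StepN (TM2.step M.prog) (2 * R.length + 2) ⟨some (.pass q), v, stk [] I R T out⟩
      ⟨some .restore, none, stk [] I [] ((M.rewrite q R).reverse ++ T) (M.emit q R ++ out)⟩ := by
  induction R generalizing q T v out with
  | nil =>
    refine StepN.head (b := ⟨some (.fin q), none, stk [] I [] T out⟩) ?_ (StepN.single ?_)
    · simp [prog]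
    · simp [prog, stepAux_pushAll, rewrite, emit]
  | cons b R ih =>
    have := ih (M.move q b).1 ((M.move q b).2.1 :: T) (some (.inr (.inr b)))
      ((M.move q b).2.2 ++ out)
    simp only [rewrite, emit, List.reverse_cons, List.append_assoc, List.singleton_append]
    refine StepN.of_eq (StepN.head (b := ⟨some (.move q b), some (.inr (.inr b)),
      stk [] I R T out⟩) ?_ (StepN.head ?_ this)) ?_
    · simp [prog]
    · simp [prog, stepAux_pushAll]
    · simp; omega

theorem stepN_restore (R T : List B) (v : Mem Γ A B) (I : List A) (out : List O) :
    StepN (TM2.step M.prog) (2 * T.length + 1) ⟨some .restore, v, stk [] I R T out⟩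
      ⟨some .next, none, stk [] I (T.reverse ++ R) [] out⟩ := by
  induction T generalizing R v with
  | nil =>
    refine StepN.single ?_
    simp [prog]
  | cons b T ih =>
    rw [List.reverse_cons, List.append_assoc, List.singleton_append]
    refine StepN.of_eq (StepN.head (b := ⟨some (.put b), some (.inr (.inr b)),
      stk [] I R T out⟩) ?_ (StepN.head ?_ (ih (b :: R) (some (.inr (.inr b)))))) ?_
    · simp [prog]
    · simp [prog]
    · simp; omega

/-- Emptying the row is needed because a halting configuration may keep only the output stack
nonempty. -/
theorem stepN_clear (R : List B) (v : Mem Γ A B) (out : List O) :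
    StepN (TM2.step M.prog) (R.length + 2) ⟨some .clear, v, stk [] [] R [] out⟩
      ⟨none, none, stk [] [] [] [] out⟩ := by
  induction R generalizing v with
  | nil =>
    refine StepN.head (b := ⟨some .done, none, stk [] [] [] [] out⟩) ?_ (StepN.single ?_)
    · simp [prog]
    · simp [prog]
  | cons b R ih =>
    refine StepN.of_eq (StepN.head ?_ (ih (some (.inr (.inr b))))) ?_
    · simp [prog]
    · simp

/-- An instruction costs two steps per cell for the pass and two for the restoration; rewriting
keeps the length of the row, so the cost is the same for all instructions. -/
theorem stepN_exec (I : List A) (R : List B) (out : List O) :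
    StepN (TM2.step M.prog) (I.length * (4 * R.length + 4) + (R.length + 3))
      ⟨some .next, none, stk [] I R [] out⟩
      ⟨none, none, stk [] [] [] [] (M.exec I R out)⟩ := by
  induction I generalizing R out with
  | nil =>
    refine StepN.of_eq (StepN.head ?_ (M.stepN_clear R none out)) (by simp)
    simp [prog]
  | cons a I ih =>
    have h₁ := M.stepN_pass (M.init a) R [] (some (.inr (.inl a))) I out
    have h₂ := M.stepN_restore [] ((M.rewrite (M.init a) R).reverse) none I
      (M.emit (M.init a) R ++ out)
    have h₃ := ih (M.rewrite (M.init a) R) (M.emit (M.init a) R ++ out)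
    simp only [List.append_nil, List.reverse_reverse] at h₁ h₂
    refine StepN.of_eq (StepN.head ?_ ((h₁.trans h₂).trans h₃)) ?_
    · simp [prog]
    · simp only [List.length_reverse, length_rewrite, List.length_cons]
      ring

theorem exists_length_bound [Fintype Γ] [Fintype P] :
    ∃ c, ∀ p x, (M.feed p x).2.1.length ≤ c ∧ (M.feed p x).2.2.length ≤ c := by
  refine ⟨Finset.univ.sup fun z : P × Γ =>
    (M.feed z.1 z.2).2.1.length + (M.feed z.1 z.2).2.2.length, fun p x => ?_⟩
  have := Finset.le_sup (f := fun z : P × Γ =>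
    (M.feed z.1 z.2).2.1.length + (M.feed z.1 z.2).2.2.length) (Finset.mem_univ (p, x))
  simp only at this
  omega

theorem length_load_le {c : ℕ}
    (hc : ∀ p x, (M.feed p x).2.1.length ≤ c ∧ (M.feed p x).2.2.length ≤ c)
    (p : P) (x : List Γ) (I : List A) (R : List B) :
    (M.load p x I R).1.length ≤ I.length + M.last.1.length + c * x.length ∧
      (M.load p x I R).2.length ≤ R.length + M.last.2.length + c * x.length := by
  induction x generalizing p I R with
  | nil => simp [load]; omega
  | cons a x ih =>
    have h := ih (M.feed p a).1 ((M.feed p a).2.1 ++ I) ((M.feed p a).2.2 ++ R)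
    have h' := hc p a
    simp only [load, List.length_append, List.length_cons, Nat.mul_succ] at h ⊢
    omega

section Machine

variable [Fintype Γ] [Fintype A] [Fintype B] [Fintype P] [Fintype Q]

/-- The Turing machine. -/
def tm : FinTM2 where
  K := Stack
  k₀ := .input
  k₁ := .output
  Γ := StackΓ Γ A B O
  Λ := Label Γ A B P Q
  main := .start
  σ := Mem Γ A B
  initialState := none
  Γk₀Fin := inferInstanceAs (Fintype Γ)
  m := M.prog

theorem stepN_tm (x : List Γ) :
    StepN M.tm.step (1 + (2 * x.length + 2) + ((M.load M.start x M.base []).1.length *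
        (4 * (M.load M.start x M.base []).2.length + 4) +
        ((M.load M.start x M.base []).2.length + 3)))
      (initList M.tm x) (haltList M.tm (M.run x)) := by
  have h₀ : StepN (TM2.step M.prog) 1 ⟨some .start, none, stk x [] [] [] []⟩
      ⟨some (.read M.start), none, stk x M.base [] [] []⟩ := by
    refine StepN.single ?_
    simp [prog, stepAux_pushAll]
  have h := (h₀.trans (M.stepN_read x M.start none M.base [])).trans (M.stepN_exec _ _ [])
  have E : stk [] [] [] [] [] = fun k => ([] : List (StackΓ Γ A B O k)) := by
    funext k; cases k <;> rfl
  rw [← update_output [] [] [] [] [], ← update_input [] x, E] at h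
  have I₁ := initList_eq M.tm x
  have I₂ := haltList_eq M.tm (M.run x)
  exact I₁.symm ▸ I₂.symm ▸ h

/-- A map that a sweeping machine computes on the encodings is computable in polynomial time. -/
theorem polyTime {α β : Type} {ea : α → List Γ} {eb : β → List O} {f : α → β}
    (h : ∀ a, M.run (ea a) = eb (f a)) : Nonempty (TM2ComputableInPolyTime ea eb f) := by
  obtain ⟨c, hc⟩ := M.exists_length_bound
  -- `i` bounds the number of instructions and `r` the number of cells; both are linear because a
  -- symbol feeds at most `c` of each.
  let i : Polynomial ℕ := Polynomial.C (M.base.length + M.last.1.length) +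
    Polynomial.C c * Polynomial.X
  let r : Polynomial ℕ := Polynomial.C M.last.2.length + Polynomial.C c * Polynomial.X
  refine ⟨⟨⟨M.tm, Equiv.refl _, Equiv.refl _⟩,
    1 + (2 * Polynomial.X + 2) + (i * (4 * r + 4) + (r + 3)), fun a => ⟨⟨1 + (2 * (ea a).length + 2) +
      ((M.load M.start (ea a) M.base []).1.length *
        (4 * (M.load M.start (ea a) M.base []).2.length + 4) +
        ((M.load M.start (ea a) M.base []).2.length + 3)), ?_⟩, ?_⟩⟩⟩
  · have := M.stepN_tm (ea a)
    rw [h] at this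
    have e₁ : List.map (Equiv.refl Γ).invFun (ea a) = ea a := List.map_id _
    have e₂ : List.map (Equiv.refl O).invFun (eb (f a)) = eb (f a) := List.map_id _
    exact e₁.symm ▸ e₂.symm ▸ this
  · obtain ⟨h₁, h₂⟩ := M.length_load_le hc M.start (ea a) M.base []
    simp only [List.length_nil, Nat.zero_add] at h₂
    simp only [i, r, Polynomial.eval_add, Polynomial.eval_mul, Polynomial.eval_X,
      Polynomial.eval_C, Polynomial.eval_ofNat, Polynomial.eval_one]
    gcongr

end Machine

end Sweeper

end ExistsReals

/-! ### Hardness: the straight-line program of a sentence and the machine that writes it as a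
polynomial. -/

namespace ExistsReals

/-! ### Values of explicit sums of monomials -/

theorem SumOfMonomials.eval_eq {n : ℕ} (P : SumOfMonomials n) (x : Fin n → ℝ) :
    P.eval x = (P.map fun t => (t.1 : ℝ) * ∏ i, x i ^ t.2 i).sum := by
  unfold SumOfMonomials.eval SumOfMonomials.toPoly
  rw [map_list_sum, List.map_map]
  congr 1
  refine List.map_congr_left fun t _ => ?_
  simp only [Function.comp, MvPolynomial.aeval_monomial]
  rw [Finsupp.prod_fintype _ _ (by simp)]
  simp

theorem SumOfMonomials.eval_append {n : ℕ} (P Q : SumOfMonomials n) (x : Fin n → ℝ) :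
    SumOfMonomials.eval (P ++ Q) x = P.eval x + Q.eval x := by
  simp [SumOfMonomials.eval_eq]

theorem foldr_bit_bits (n : ℕ) : n.bits.foldr Nat.bit 0 = n := by
  induction n using Nat.binaryRec' with
  | zero => simp
  | bit b n hn ih => simp [Nat.bits_append_bit n b hn, ih]

/-- The term whose exponents are listed. -/
def listTerm (n : ℕ) (t : ℤ × List ℕ) : ℤ × (Fin n → ℕ) := (t.1, fun j => t.2.getD j 0)

theorem ofFn_getD {α : Type} {n : ℕ} {l : List α} (h : l.length = n) (a : α) :
    List.ofFn (fun j : Fin n => l.getD j a) = l := by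
  subst h
  refine List.ext_getElem (by simp) fun i h₁ h₂ => ?_
  simp

theorem encTerm_listTerm {n : ℕ} {t : ℤ × List ℕ} (h : t.2.length = n) :
    encTerm (listTerm n t) = encInt t.1 ++ t.2.flatMap encNat := by
  simp only [encTerm, listTerm, ofFn_getD h]

theorem prod_getD_eq {n : ℕ} {l : List ℕ} (h : l.length = n) (x : Fin n → ℝ) :
    ∏ j, x j ^ l.getD j 0 = (List.zipWith (· ^ ·) (List.ofFn x) l).prod := by
  subst h
  rw [← List.prod_ofFn]
  congr 1
  refine List.ext_getElem (by simp) fun i h₁ h₂ => ?_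
  simp

namespace Hardness

/-! ### Straight-line programs over the reals -/

/-- The role of a real variable at some moment of the straight-line program: a coordinate
of the point (`xTodo`, `xCur`, `xDone`, relative to a cursor), the separating coordinate `sgn`,
one of the two variables `new₁`, `new₂` that the current operation determines, a variable not used
yet, a register, or a variable that is not needed any more. -/
inductive Tag
  | dead
  | xTodo
  | xCur
  | xDone
  | sgn
  | new₁
  | new₂
  | fresh
  | reg (i : Fin 8)
  deriving DecidableEq, Fintype

namespace Tag

/-- Value of the polynomial read so far. -/
abbrev P : Tag := reg 0
/-- Value of the monomial read so far. -/
abbrev M : Tag := reg 1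
/-- Value of the power, or of the coefficient, read so far. -/
abbrev Z : Tag := reg 2
/-- The stack of truth values. -/
abbrev S : Tag := reg 3
/-- A truth value. -/
abbrev B : Tag := reg 4
/-- A truth value. -/
abbrev C : Tag := reg 5
/-- Root of the positive part. -/
abbrev Y : Tag := reg 6
/-- Root of the negative part. -/
abbrev W : Tag := reg 7

end Tag

open Tag

/-- How an operation moves the cursor on the coordinates. -/
inductive Cursor
  | keep
  | advance
  | clear
  | reset
  deriving DecidableEq

/-- The operations. -/
inductive Micro
  | start
  | expEnd
  | expBit (b : Bool)
  | coefEnd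
  | coefBit (b : Bool)
  | sign (neg : Bool)
  | testP
  | testY
  | testW
  | split
  | notB
  | move
  | conj
  | push
  | half
  | pop
  | check
  deriving DecidableEq, Fintype

/-- A polynomial in the tagged variables. -/
abbrev Gate := List (ℤ × List Tag)

/-- The equations that test whether a register vanishes. -/
def testGates (r : Tag) : List Gate :=
  [[(1, [r, new₁])], [(1, [r, new₂]), (1, [new₁]), (-1, [])]]

namespace Micro

/-- The equations imposed by an operation. -/
def gates : Micro → List Gate
  | start => [[(1, [new₁])], [(1, [new₂])]]
  | expEnd => [[(1, [new₁]), (-1, [M, Z])]]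
  | expBit b => [[(1, [new₁]), (-1, if b then [Z, Z, xCur] else [Z, Z])]]
  | coefEnd => [[(1, [new₁]), (-1, [M, Z])], [(1, [new₂])]]
  | coefBit b => [[(1, [new₁]), (-2, [Z]), (if b then -1 else 0, [])]]
  | sign neg => [[(1, [new₁]), (-1, [P]), (if neg then 1 else -1, [Z, M])]]
  | testP => testGates P
  | testY => testGates Y
  | testW => testGates W
  | split => [[(1, [new₁, new₁]), (-1, [new₂, new₂]), (-1, [P])], [(1, [new₁, new₂])]]
  | notB => [[(1, [new₁]), (1, [B]), (-1, [])]]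
  | move => [[(1, [new₁]), (-1, [B])]]
  | conj => [[(1, [new₁]), (-1, [B, C])]]
  | push => [[(3, [new₁]), (-1, [S]), (-2, [B])], [(1, [new₂])]]
  | half => [[(1, [new₁]), (-2, [S]), (1, [])]]
  | pop => [[(1, [new₁]), (-3, [S]), (2, [B])]]
  | check => [[(3, [S]), (-2, [])], [(1, [sgn, sgn]), (-1, [])]]

/-- The registers that an operation overwrites or discards. -/
def kill : Micro → List Tag
  | start => [P, S]
  | expEnd => [M, Z]
  | expBit _ => [Z]
  | coefEnd => [M, Z]
  | coefBit _ => [Z]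
  | sign _ => [P, Z, M]
  | testP => [P, Y, W, B]
  | testY => [P, Y, W, B]
  | testW => [P, Y, W, B]
  | split => [P, Y, W]
  | notB => [B]
  | move => [B, C]
  | conj => [B, C]
  | push => [S, B, P]
  | half => [P]
  | pop => [S]
  | check => []

/-- The register into which the first new variable goes. -/
def dest₁ : Micro → Tag
  | start => P
  | expEnd => M
  | expBit _ => Z
  | coefEnd => M
  | coefBit _ => Z
  | sign _ => P
  | testP => B
  | testY => B
  | testW => B
  | split => Y
  | notB => B
  | move => C
  | conj => B
  | push => S
  | half => P
  | pop => S
  | check => dead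

/-- The register into which the second new variable goes. -/
def dest₂ : Micro → Tag
  | start => S
  | coefEnd => Z
  | split => W
  | push => P
  | _ => dead

/-- The cursor movement of an operation. -/
def cursor : Micro → Cursor
  | expEnd => .advance
  | sign _ => .reset
  | push => .clear
  | _ => .keep

/-- The terms of minus the sum of squares of the equations; `check` adds the constant `1`. -/
def terms (m : Micro) : List (ℤ × List Tag) :=
  (m.gates.flatMap fun g => g.flatMap fun s => g.map fun t => (-(s.1 * t.1), s.2 ++ t.2)) ++
    if m = check then [(1, [])] else []

end Micro

/-- The effect of a cursor movement on a coordinate. The Boolean tells whether the place of the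
cursor is still to come. -/
def Cursor.act : Cursor → Bool → Tag → Bool × Tag
  | .keep, s, t => (s, t)
  | .advance, true, xTodo => (false, xCur)
  | .advance, true, _ => (true, xDone)
  | .advance, false, t => (false, t)
  | .clear, s, _ => (s, xTodo)
  | .reset, true, _ => (false, xCur)
  | .reset, false, _ => (false, xTodo)

/-- The control of the sweep that updates the tags: how many new variables have to be found, and
whether the place of the cursor is still to come. -/
abbrev UpdCtl := Fin 3 × Bool

/-- The new tag of a variable. -/
def retag (m : Micro) : UpdCtl → Tag → UpdCtl × Tag
  | (_, s), new₁ => ((2, s), m.dest₁)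
  | (c, s), new₂ => ((c, s), m.dest₂)
  | (2, s), fresh => ((1, s), new₁)
  | (1, s), fresh => ((0, s), new₂)
  | (0, s), fresh => ((0, s), fresh)
  | (c, s), reg i => ((c, s), if reg i ∈ m.kill then dead else reg i)
  | (c, s), dead => ((c, s), dead)
  | (c, s), sgn => ((c, s), sgn)
  | (c, s), xTodo => ((c, (m.cursor.act s xTodo).1), (m.cursor.act s xTodo).2)
  | (c, s), xCur => ((c, (m.cursor.act s xCur).1), (m.cursor.act s xCur).2)
  | (c, s), xDone => ((c, (m.cursor.act s xDone).1), (m.cursor.act s xDone).2)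

/-- The update of the tags of a row, whose cells carry some further data. -/
def updCells {α : Type} (m : Micro) : UpdCtl → List (Tag × α) → List (Tag × α)
  | _, [] => []
  | c, (t, a) :: v => ((retag m c t).2, a) :: updCells m (retag m c t).1 v

/-- The update of the tags of a row. -/
def updTags (m : Micro) : UpdCtl → List Tag → List Tag
  | _, [] => []
  | c, t :: r => (retag m c t).2 :: updTags m (retag m c t).1 r

theorem map_fst_updCells {α : Type} (m : Micro) (c : UpdCtl) (v : List (Tag × α)) :
    (updCells m c v).map Prod.fst = updTags m c (v.map Prod.fst) := by
  induction v generalizing c with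
  | nil => rfl
  | cons p v ih => simp [updCells, updTags, ih]

theorem map_snd_updCells {α : Type} (m : Micro) (c : UpdCtl) (v : List (Tag × α)) :
    (updCells m c v).map Prod.snd = v.map Prod.snd := by
  induction v generalizing c with
  | nil => rfl
  | cons p v ih => simp [updCells, ih]

@[simp] theorem length_updTags (m : Micro) (c : UpdCtl) (r : List Tag) :
    (updTags m c r).length = r.length := by
  induction r generalizing c with
  | nil => rfl
  | cons t r ih => simp [updTags, ih]

/-! ### The operations for a formula -/

/-- The part of the input that is being read. -/
inductive Mode
  | vars
  | body
  | coef
  deriving DecidableEq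

instance : Fintype Mode := ⟨{.vars, .body, .coef}, fun p => by cases p <;> simp⟩

/-- The mode after a symbol. -/
def nextMode : Mode → Symbol → Mode
  | .vars, .semi => .body
  | .vars, _ => .vars
  | .body, .plus => .coef
  | .body, .minus => .coef
  | .body, _ => .body
  | .coef, .semi => .body
  | .coef, _ => .coef

/-- Take a truth value off the stack. -/
def popMicros : List Micro := [.half, .split, .testW, .pop]

/-- The operations for a symbol. -/
def symMicros : Mode → Symbol → List Micro
  | .vars, _ => []
  | .coef, .bit b => [.coefBit b]
  | .coef, .semi => [.coefEnd]
  | .coef, _ => []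
  | .body, .bit b => [.expBit b]
  | .body, .semi => [.expEnd]
  | .body, .var => []
  | .body, .plus => [.sign false]
  | .body, .minus => [.sign true]
  | .body, .eq => [.testP, .push]
  | .body, .ge => [.split, .testW, .push]
  | .body, .gt => [.split, .testY, .notB, .push]
  | .body, .not => popMicros ++ [.notB, .push]
  | .body, .and => popMicros ++ (.move :: popMicros ++ [.conj, .push])
  | .body, .or => popMicros ++ (.notB :: .move :: popMicros ++ [.notB, .conj, .notB, .push])

/-- The operations for a string, which is processed from right to left. -/
def strMicros : Mode → List Symbol → List Micro
  | _, [] => []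
  | p, x :: w => strMicros (nextMode p x) w ++ symMicros p x

/-- The mode after a string. -/
def modeAfter : Mode → List Symbol → Mode
  | p, [] => p
  | p, x :: w => modeAfter (nextMode p x) w

theorem modeAfter_append (p : Mode) (u v : List Symbol) :
    modeAfter p (u ++ v) = modeAfter (modeAfter p u) v := by
  induction u generalizing p with
  | nil => rfl
  | cons x u ih => simp [modeAfter, ih]

theorem strMicros_append (p : Mode) (u v : List Symbol) :
    strMicros p (u ++ v) = strMicros (modeAfter p u) v ++ strMicros p u := by
  induction u generalizing p with
  | nil => simp [strMicros, modeAfter]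
  | cons x u ih => simp [strMicros, modeAfter, ih]

/-! ### The instance of VSC -/

/-- The terms that an operation contributes, for the given tags; the variables are numbered from
the end of the row. -/
def rowTerms (m : Micro) (r : List Tag) : List (ℤ × List ℕ) :=
  m.terms.map fun t => (t.1, (r.map fun s => t.2.count s).reverse)

/-- The terms that a sequence of operations contributes, the last ones first. -/
def progTerms : List Micro → List Tag → List (ℤ × List ℕ)
  | [], _ => []
  | m :: ms, r => progTerms ms (updTags m (0, true) r) ++ (rowTerms m r).reverse

/-- The operations for a sentence. -/
def sentenceMicros (S : Sentence) : List Micro :=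
  .start :: strMicros .body (encFormula S.Φ)

/-- The initial tags. -/
def initRow (S : Sentence) : List Tag :=
  [new₁, new₂, fresh, fresh] ++
    (List.replicate (2 * (strMicros .body (encFormula S.Φ)).length) fresh ++
      (sgn :: List.replicate (S.n + 1) xTodo))

/-- The reduction. -/
def toVSC (S : Sentence) : VSCInstance where
  d := (initRow S).length
  f := (progTerms (sentenceMicros S ++ [.check]) (initRow S)).map (listTerm _)
  θ := 1
  θ_pos := one_pos

/-! ### The machine -/

/-- The instructions of the machine: write a term, update the tags, write the end of the output,
a separator, the variables. -/
inductive Instr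
  | term (z : Σ m : Micro, Fin m.terms.length)
  | update (m : Micro)
  | tail
  | semi
  | vars
  deriving Fintype

/-- The instructions for an operation. -/
def microInstrs (m : Micro) : List Instr :=
  (List.finRange m.terms.length).map (fun k => .term ⟨m, k⟩) ++ [.update m]

/-- The machine computing the reduction. -/
def machine : Sweeper Symbol Instr Tag Symbol Mode (Instr × UpdCtl) where
  start := .vars
  base := microInstrs .check ++ [.semi, .vars]
  feed p x := (nextMode p x, (symMicros p x).flatMap microInstrs,
    match p, x with
    | .vars, .semi => [sgn, xTodo]
    | .vars, _ => [xTodo]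
    | p, x => List.replicate (2 * (symMicros p x).length) fresh)
  last := (.tail :: microInstrs .start, [new₁, new₂, fresh, fresh])
  init a := (a, (0, true))
  move q t := match q with
    | (.term z, c) => ((.term z, c), t, encNat ((z.1.terms.get z.2).2.count t))
    | (.update m, c) => ((.update m, (retag m c t).1), (retag m c t).2, [])
    | (.vars, c) => ((.vars, c), t, [.var])
    | q => (q, t, [])
  fin q := match q.1 with
    | .term z => encInt (z.1.terms.get z.2).1
    | .tail => .semi :: encPosRat 1
    | .semi => [.semi]
    | _ => []

/-- For sweeps with constant control. The cells appear reversed in the output because each one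
prepends its string; this is why variables are numbered from the end of the row. -/
theorem rewrite_of_move {Γ A B O P Q : Type} (M : Sweeper Γ A B O P Q) {q : Q} {e : B → List O}
    (h : ∀ b, M.move q b = (q, b, e b)) (r : List B) :
    M.rewrite q r = r ∧ M.emit q r = M.fin q ++ r.reverse.flatMap e := by
  induction r with
  | nil => simp [Sweeper.rewrite, Sweeper.emit]
  | cons b r ih => simp [Sweeper.rewrite, Sweeper.emit, h, ih]

theorem rewrite_update (m : Micro) (c : UpdCtl) (r : List Tag) :
    machine.rewrite (.update m, c) r = updTags m c r ∧ machine.emit (.update m, c) r = [] := by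
  induction r generalizing c with
  | nil => simp [Sweeper.rewrite, Sweeper.emit, machine, updTags]
  | cons t r ih =>
    have := ih (retag m c t).1
    simp only [Sweeper.rewrite, Sweeper.emit, updTags]
    exact ⟨congrArg _ this.1, (List.append_nil _).trans this.2⟩

theorem exec_term (z : Σ m : Micro, Fin m.terms.length) (I : List Instr) (r : List Tag)
    (out : List Symbol) :
    machine.exec (.term z :: I) r out = machine.exec I r
      ((encInt (z.1.terms.get z.2).1 ++
        (r.map fun s => (z.1.terms.get z.2).2.count s).reverse.flatMap encNat) ++ out) := by
  have h := rewrite_of_move machine (q := (.term z, (0, true)))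
    (e := fun t => encNat ((z.1.terms.get z.2).2.count t)) (fun t => rfl) r
  have h2 : machine.init (.term z) = (.term z, (0, true)) := rfl
  rw [Sweeper.exec, h2, h.1, h.2, ← List.map_reverse, List.flatMap_map]
  rfl

theorem exec_micro (m : Micro) (I : List Instr) (r : List Tag) (out : List Symbol) :
    machine.exec (microInstrs m ++ I) r out = machine.exec I (updTags m (0, true) r)
      ((rowTerms m r).reverse.flatMap (fun t => encInt t.1 ++ t.2.flatMap encNat) ++ out) := by
  -- Term instructions leave the row unchanged, so they can be executed one by one over an arbitrary
  -- list of term indices; later ones land further left.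
  have key : ∀ (l : List (Fin m.terms.length)) (J : List Instr) (out : List Symbol),
      machine.exec (l.map (fun k => .term ⟨m, k⟩) ++ J) r out = machine.exec J r
        (((l.map m.terms.get).map fun t => (t.1, (r.map fun s => t.2.count s).reverse)).reverse.flatMap
          (fun t => encInt t.1 ++ t.2.flatMap encNat) ++ out) := by
    intro l
    induction l with
    | nil => intro J out; simp
    | cons k l ih =>
      intro J out
      rw [List.map_cons, List.cons_append, exec_term, ih]
      simp
  rw [microInstrs, List.append_assoc, key, List.map_get_finRange, List.singleton_append,
    Sweeper.exec]
  have h2 : machine.init (.update m) = (.update m, (0, true)) := rfl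
  rw [h2, (rewrite_update m _ r).1, (rewrite_update m _ r).2]
  rfl

theorem exec_micros (ms : List Micro) (I : List Instr) (r : List Tag) (out : List Symbol) :
    ∃ r', r'.length = r.length ∧ machine.exec (ms.flatMap microInstrs ++ I) r out =
      machine.exec I r'
        ((progTerms ms r).flatMap (fun t => encInt t.1 ++ t.2.flatMap encNat) ++ out) := by
  induction ms generalizing r out with
  | nil => exact ⟨r, rfl, by simp [progTerms]⟩
  | cons m ms ih =>
    obtain ⟨r', hr', h⟩ := ih (updTags m (0, true) r)
      ((rowTerms m r).reverse.flatMap (fun t => encInt t.1 ++ t.2.flatMap encNat) ++ out)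
    refine ⟨r', by simpa using hr', ?_⟩
    rw [List.flatMap_cons, List.append_assoc, exec_micro, h]
    simp [progTerms]

/-- Instructions are prepended while reading, so the last input symbol is executed first, in
agreement with `strMicros`. Each operation brings along the two fresh variables that its successor
will use. -/
theorem load_body (p : Mode) (hp : p ≠ .vars) (w : List Symbol) (I : List Instr) (R : List Tag) :
    machine.load p w I R = (.tail :: microInstrs .start ++ (strMicros p w).flatMap microInstrs ++ I,
      [new₁, new₂, fresh, fresh] ++
        (List.replicate (2 * (strMicros p w).length) fresh ++ R)) := by
  induction w generalizing p I R with
  | nil => simp [Sweeper.load, strMicros, machine]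
  | cons x w ih =>
    have hp' : nextMode p x ≠ .vars := by
      cases p <;> cases x <;> simp_all [nextMode]
    have hf : machine.feed p x = (nextMode p x, (symMicros p x).flatMap microInstrs,
        List.replicate (2 * (symMicros p x).length) fresh) := by
      cases p <;> simp_all [machine]
    rw [Sweeper.load, hf, ih _ hp', strMicros]
    simp only [List.flatMap_append, List.append_assoc, List.length_append, Nat.mul_add,
      List.replicate_add]

/-- The separator supplies `sgn` and one dummy coordinate next to the `n` declared ones. -/
theorem load_vars (n : ℕ) (w : List Symbol) (I : List Instr) (R : List Tag) :
    machine.load .vars (encVars n ++ w) I R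
      = machine.load .body w I (sgn :: List.replicate (n + 1) xTodo ++ R) := by
  induction n generalizing R with
  | zero => simp [encVars, Sweeper.load, machine, nextMode, symMicros]
  | succ n ih =>
    have : encVars (n + 1) ++ w = .var :: (encVars n ++ w) := by
      simp [encVars, List.replicate_succ]
    have hf : machine.feed .vars .var = (.vars, [], [xTodo]) := rfl
    rw [this, Sweeper.load, hf]
    simp only [List.nil_append]
    rw [ih]
    congr 1
    rw [List.replicate_succ' (n := n + 1)]
    simp

theorem length_of_mem_progTerms (ms : List Micro) (r : List Tag) (t : ℤ × List ℕ)
    (h : t ∈ progTerms ms r) : t.2.length = r.length := by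
  induction ms generalizing r with
  | nil => simp [progTerms] at h
  | cons m ms ih =>
    simp only [progTerms, List.mem_append, List.mem_reverse, rowTerms, List.mem_map] at h
    rcases h with h | ⟨s, _, rfl⟩
    · simpa using ih _ h
    · simp

/-- The output is written from right to left: the threshold first, then the terms operation by
operation, the separator, and finally one variable symbol per cell of the row. -/
theorem run_machine (S : Sentence) : machine.run S.encode = (toVSC S).encode := by
  have hl : machine.load machine.start S.encode machine.base [] =
      (.tail :: ((sentenceMicros S ++ [Micro.check]).flatMap microInstrs ++ [.semi, .vars]),
        initRow S) := by
    have h0 : machine.start = .vars := rfl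
    have h1 : machine.base = microInstrs .check ++ [.semi, .vars] := rfl
    rw [h0, h1, Sentence.encode, load_vars, load_body _ (by simp)]
    simp [sentenceMicros, initRow]
  have ht : machine.rewrite (machine.init .tail) (initRow S) = initRow S ∧
      machine.emit (machine.init .tail) (initRow S) = .semi :: encPosRat 1 := by
    have := rewrite_of_move machine (q := (.tail, (0, true))) (e := fun _ => []) (fun t => rfl)
      (initRow S)
    refine ⟨this.1, this.2.trans ?_⟩
    simp [machine]
  obtain ⟨r', hr', h⟩ := exec_micros (sentenceMicros S ++ [.check]) [.semi, .vars] (initRow S)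
    (.semi :: encPosRat 1)
  have hs := rewrite_of_move machine (q := (.semi, (0, true))) (e := fun _ => []) (fun t => rfl) r'
  have hv := rewrite_of_move machine (q := (.vars, (0, true))) (e := fun _ => [.var])
    (fun t => rfl) r'
  have is : machine.init .semi = (.semi, (0, true)) := rfl
  have iv : machine.init .vars = (.vars, (0, true)) := rfl
  rw [Sweeper.run, hl, Sweeper.exec, ht.1, ht.2, List.append_nil, h, Sweeper.exec, is, hs.1, hs.2,
    Sweeper.exec, iv, hv.1, hv.2, Sweeper.exec]
  have hvars : r'.reverse.flatMap (fun _ => [Symbol.var]) = List.replicate (initRow S).length .var := by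
    rw [← hr', ← List.length_reverse]
    generalize r'.reverse = l
    induction l with
    | nil => rfl
    | cons a l ih => simp [List.replicate_succ, ih]
  have hpoly : (progTerms (sentenceMicros S ++ [.check]) (initRow S)).flatMap
      (fun t => encInt t.1 ++ t.2.flatMap encNat) = (toVSC S).f.flatMap encTerm := by
    simp only [toVSC, List.flatMap_map]
    refine List.flatMap_congr fun t ht => ?_
    rw [encTerm_listTerm (length_of_mem_progTerms _ _ _ ht)]
  rw [hvars, hpoly]
  simp [machine, VSCInstance.encode, encVars, encPoly, toVSC]

theorem polyTime_toVSC :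
    Nonempty (Turing.TM2ComputableInPolyTime Sentence.encode VSCInstance.encode toVSC) :=
  machine.polyTime run_machine

end Hardness

end ExistsReals

/-! ### Hardness: from zeros of the sum of squares to runs of the straight-line program, and back.
-/

namespace ExistsReals

namespace Hardness

open Tag

/-! ### Values of rows -/

/-- The product of the values of the variables with a given tag. -/
noncomputable def val (v : List (Tag × ℝ)) (t : Tag) : ℝ :=
  (v.map fun p => if p.1 = t then p.2 else 1).prod

theorem val_append (v w : List (Tag × ℝ)) (t : Tag) : val (v ++ w) t = val v t * val w t := by
  simp [val]

theorem val_cons (p : Tag × ℝ) (w : List (Tag × ℝ)) (t : Tag) :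
    val (p :: w) t = (if p.1 = t then p.2 else 1) * val w t := by
  simp [val]

theorem val_nil (t : Tag) : val [] t = 1 := rfl

theorem val_eq_one {v : List (Tag × ℝ)} {t : Tag} (h : ∀ p ∈ v, p.1 ≠ t) : val v t = 1 := by
  induction v with
  | nil => rfl
  | cons p v ih =>
    rw [val_cons, if_neg (h p (by simp)), ih fun q hq => h q (by simp [hq]), one_mul]

/-- Exchange of two products, over variables and over tags. It makes the exponent vector written by
a sweep, which counts tags, denote the intended monomial in the registers. A tag carried by no
variable contributes the empty product `1`. -/
theorem prod_pow_count (v : List (Tag × ℝ)) (l : List Tag) :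
    (v.map fun p => p.2 ^ l.count p.1).prod = (l.map (val v)).prod := by
  induction l with
  | nil => simp
  | cons t l ih =>
    rw [List.map_cons, List.prod_cons, ← ih, val, ← List.prod_map_mul]
    congr 1
    refine List.map_congr_left fun p _ => ?_
    rw [List.count_cons]
    by_cases h : p.1 = t
    · simp [h, pow_succ']
    · simp [h, Ne.symm h]

/-- The value of a gate when the tags have the given values. -/
noncomputable def gval (g : Gate) (ρ : Tag → ℝ) : ℝ :=
  (g.map fun t => (t.1 : ℝ) * (t.2.map ρ).prod).sum

/-- The equations of an operation hold. -/
def Sat (m : Micro) (ρ : Tag → ℝ) : Prop := ∀ g ∈ m.gates, gval g ρ = 0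

/-- The equations of a sequence of operations hold. -/
def SatAll : List Micro → List (Tag × ℝ) → Prop
  | [], _ => True
  | m :: ms, v => Sat m (val v) ∧ SatAll ms (updCells m (0, true) v)

/-- The sum of the squares of the equations of a sequence of operations. -/
noncomputable def sqSum : List Micro → List (Tag × ℝ) → ℝ
  | [], _ => 0
  | m :: ms, v => (m.gates.map fun g => gval g (val v) ^ 2).sum +
      sqSum ms (updCells m (0, true) v)

theorem list_sum_sq_nonneg (l : List Gate) (ρ : Tag → ℝ) :
    0 ≤ (l.map fun g => gval g ρ ^ 2).sum :=
  List.sum_nonneg fun x hx => by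
    obtain ⟨g, _, rfl⟩ := List.mem_map.1 hx
    positivity

theorem list_sum_sq_nonpos_iff (l : List Gate) (ρ : Tag → ℝ) :
    (l.map fun g => gval g ρ ^ 2).sum ≤ 0 ↔ ∀ g ∈ l, gval g ρ = 0 := by
  induction l with
  | nil => simp
  | cons g l ih =>
    have h1 := list_sum_sq_nonneg l ρ
    simp only [List.map_cons, List.sum_cons, List.forall_mem_cons]
    rw [← ih]
    constructor
    · intro h
      have := sq_nonneg (gval g ρ)
      exact ⟨by nlinarith, by nlinarith⟩
    · rintro ⟨h, h'⟩
      rw [h]; simpa using h'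

theorem sqSum_nonneg (ms : List Micro) (v : List (Tag × ℝ)) : 0 ≤ sqSum ms v := by
  induction ms generalizing v with
  | nil => simp [sqSum]
  | cons m ms ih => exact add_nonneg (list_sum_sq_nonneg _ _) (ih _)

theorem sqSum_nonpos_iff (ms : List Micro) (v : List (Tag × ℝ)) :
    sqSum ms v ≤ 0 ↔ SatAll ms v := by
  induction ms generalizing v with
  | nil => simp [sqSum, SatAll]
  | cons m ms ih =>
    have h1 := list_sum_sq_nonneg m.gates (val v)
    have h2 := sqSum_nonneg ms (updCells m (0, true) v)
    rw [SatAll, Sat, ← ih, ← list_sum_sq_nonpos_iff, sqSum]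
    constructor
    · intro h; constructor <;> linarith
    · rintro ⟨h, h'⟩; linarith

/-- The row after a sequence of operations. -/
def cellsAfter : List Micro → List (Tag × ℝ) → List (Tag × ℝ)
  | [], v => v
  | m :: ms, v => cellsAfter ms (updCells m (0, true) v)

theorem satAll_append (ms ms' : List Micro) (v : List (Tag × ℝ)) :
    SatAll (ms ++ ms') v ↔ SatAll ms v ∧ SatAll ms' (cellsAfter ms v) := by
  induction ms generalizing v with
  | nil => simp [SatAll, cellsAfter]
  | cons m ms ih => simp [SatAll, cellsAfter, ih, and_assoc]

/-! ### The polynomial is one minus a sum of squares -/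

/-- The value of a tagged term. -/
noncomputable def termVal (v : List (Tag × ℝ)) (t : ℤ × List Tag) : ℝ :=
  (t.1 : ℝ) * (t.2.map (val v)).prod

/-- Each gate is squared by distributing it over itself; the inductions separate the two factors. -/
theorem sum_terms (m : Micro) (v : List (Tag × ℝ)) :
    (m.terms.map (termVal v)).sum = (if m = .check then 1 else 0) -
      (m.gates.map fun g => gval g (val v) ^ 2).sum := by
  have hg : ∀ g : Gate, ((g.flatMap fun s => g.map fun t =>
      ((-(s.1 * t.1), s.2 ++ t.2) : ℤ × List Tag)).map (termVal v)).sum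
        = - gval g (val v) ^ 2 := by
    intro g
    have h1 : ∀ (s : ℤ × List Tag) (g : Gate), ((g.map fun t =>
        ((-(s.1 * t.1), s.2 ++ t.2) : ℤ × List Tag)).map (termVal v)).sum
          = - (termVal v s * gval g (val v)) := by
      intro s g
      induction g with
      | nil => simp [gval]
      | cons t g ih =>
        rw [List.map_cons, List.map_cons, List.sum_cons, ih]
        simp only [gval, termVal, List.map_cons, List.sum_cons, List.map_append,
          List.prod_append]
        push_cast
        ring
    have h2 : ∀ g' : Gate, ((g'.flatMap fun s => g.map fun t =>
        ((-(s.1 * t.1), s.2 ++ t.2) : ℤ × List Tag)).map (termVal v)).sum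
          = - (gval g' (val v) * gval g (val v)) := by
      intro g'
      induction g' with
      | nil => simp [gval]
      | cons s g' ih =>
        rw [List.flatMap_cons, List.map_append, List.sum_append, ih, h1]
        simp only [gval, termVal, List.map_cons, List.sum_cons]
        ring
    rw [h2]; ring
  have hl : ∀ l : List Gate, ((l.flatMap fun g => g.flatMap fun s => g.map fun t =>
      ((-(s.1 * t.1), s.2 ++ t.2) : ℤ × List Tag)).map (termVal v)).sum
        = - (l.map fun g => gval g (val v) ^ 2).sum := by
    intro l
    induction l with
    | nil => simp
    | cons g l ih =>
      rw [List.flatMap_cons, List.map_append, List.sum_append, ih, hg]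
      simp only [List.map_cons, List.sum_cons]
      ring
  rw [Micro.terms, List.map_append, List.sum_append, hl]
  split_ifs <;> simp [termVal]; ring

/-- The value of a term with listed exponents. -/
noncomputable def listVal (y : List ℝ) (t : ℤ × List ℕ) : ℝ :=
  (t.1 : ℝ) * (List.zipWith (· ^ ·) y t.2).prod

theorem eval_listTerm {n : ℕ} (x : Fin n → ℝ) (l : List (ℤ × List ℕ))
    (h : ∀ t ∈ l, t.2.length = n) :
    SumOfMonomials.eval (l.map (listTerm n)) x = (l.map (listVal (List.ofFn x))).sum := by
  rw [SumOfMonomials.eval_eq, List.map_map]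
  congr 1
  refine List.map_congr_left fun t ht => ?_
  simp only [Function.comp, listTerm, listVal, prod_getD_eq (h t ht)]

theorem listVal_rowTerm (v : List (Tag × ℝ)) (c : ℤ) (l : List Tag) :
    listVal (v.map Prod.snd).reverse (c, ((v.map Prod.fst).map fun s => l.count s).reverse)
      = termVal v (c, l) := by
  simp only [listVal, termVal, ← prod_pow_count]
  congr 1
  rw [← List.reverse_zipWith (by simp), List.prod_reverse, List.map_map, List.zipWith_map,
    List.zipWith_self]
  rfl

/-- Only tags change during the program, never the values of the variables, so all operations
contribute terms in the same point. Each `check` adds the constant `1`. -/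
theorem sum_progTerms (ms : List Micro) (v : List (Tag × ℝ)) :
    ((progTerms ms (v.map Prod.fst)).map (listVal (v.map Prod.snd).reverse)).sum
      = ms.count .check - sqSum ms v := by
  induction ms generalizing v with
  | nil => simp [progTerms, sqSum]
  | cons m ms ih =>
    have h1 := ih (updCells m (0, true) v)
    rw [map_fst_updCells, map_snd_updCells] at h1
    have h2 : ((rowTerms m (v.map Prod.fst)).map (listVal (v.map Prod.snd).reverse)).sum
        = (m.terms.map (termVal v)).sum := by
      rw [rowTerms, List.map_map]
      congr 1
      exact List.map_congr_left fun t _ => listVal_rowTerm v t.1 t.2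
    rw [progTerms, List.map_append, List.sum_append, h1, List.map_reverse, List.sum_reverse, h2,
      sum_terms, sqSum, List.count_cons]
    by_cases h : m = .check
    · simp [h]; ring
    · simp [h]; ring

/-! ### The shape of the rows -/

/-- The coordinate cells, with the cursor at the given place (counted from one). -/
def cells : ℕ → List ℝ → List (Tag × ℝ)
  | _, [] => []
  | 0, x :: l => (xTodo, x) :: cells 0 l
  | 1, x :: l => (xCur, x) :: cells 0 l
  | k + 2, x :: l => (xDone, x) :: cells (k + 1) l

/-- The coordinate under the cursor. -/
def curVal (xs : List ℝ) : ℕ → ℝ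
  | 0 => 1
  | k + 1 => xs.getD k 1

/-- The place of the cursor after a movement. -/
def Cursor.next : Cursor → ℕ → ℕ
  | .keep, k => k
  | .advance, k => k + 1
  | .clear, _ => 0
  | .reset, _ => 1

/-- A row in which the registers occupy `U`, and `a`, `b` are the values of the new variables. -/
def mkRow (U : List (Tag × ℝ)) (a b : ℝ) (F : List ℝ) (s : ℝ) (k : ℕ) (xs : List ℝ) :
    List (Tag × ℝ) :=
  U ++ ((new₁, a) :: (new₂, b) :: (F.map (Prod.mk fresh) ++ (sgn, s) :: cells k xs))

/-- All tags are registers or dead. -/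
def IsRegs (U : List (Tag × ℝ)) : Prop := ∀ p ∈ U, p.1 = dead ∨ ∃ i, p.1 = reg i

theorem updCells_regs (m : Micro) (c : UpdCtl) (U w : List (Tag × ℝ)) (hU : IsRegs U) :
    updCells m c (U ++ w) =
      U.map (fun p => (if p.1 ∈ m.kill then dead else p.1, p.2)) ++ updCells m c w := by
  induction U with
  | nil => rfl
  | cons p U ih =>
    obtain ⟨t, a⟩ := p
    have h := hU (t, a) (by simp)
    have ih' := ih fun q hq => hU q (by simp [hq])
    rcases h with h | ⟨i, h⟩ <;> simp only at h <;> subst h <;>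
      simp [updCells, retag, ih']

theorem updCells_fresh (m : Micro) (s : Bool) (F : List ℝ) (w : List (Tag × ℝ)) :
    updCells m (0, s) (F.map (Prod.mk fresh) ++ w) =
      F.map (Prod.mk fresh) ++ updCells m (0, s) w := by
  induction F with
  | nil => rfl
  | cons a F ih => simp [updCells, retag, ih]

theorem updCells_cells_keep (m : Micro) (h : m.cursor = .keep) (c : Fin 3) (s : Bool) (k : ℕ)
    (xs : List ℝ) : updCells m (c, s) (cells k xs) = cells k xs := by
  induction xs generalizing k with
  | nil => simp [cells, updCells]
  | cons x xs ih =>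
    rcases k with _ | _ | k <;> simp [cells, updCells, retag, h, Cursor.act, ih]

theorem updCells_cells_clear (m : Micro) (h : m.cursor = .clear) (c : Fin 3) (s : Bool) (k : ℕ)
    (xs : List ℝ) : updCells m (c, s) (cells k xs) = cells 0 xs := by
  induction xs generalizing k with
  | nil => simp [cells, updCells]
  | cons x xs ih =>
    rcases k with _ | _ | k <;> simp [cells, updCells, retag, h, Cursor.act, ih]

theorem updCells_cells_reset (m : Micro) (h : m.cursor = .reset) (c : Fin 3) (s : Bool) (k : ℕ)
    (xs : List ℝ) :
    updCells m (c, s) (cells k xs) = if s then cells 1 xs else cells 0 xs := by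
  induction xs generalizing k s with
  | nil => simp [cells, updCells]
  | cons x xs ih =>
    rcases k with _ | _ | k <;> cases s <;> simp [cells, updCells, retag, h, Cursor.act, ih]

/-- The sweep turns everything before the first untouched coordinate into `xDone`, puts the cursor
on that coordinate, and then switches its control so that the rest stays as it is. -/
theorem updCells_cells_advance (m : Micro) (h : m.cursor = .advance) (c : Fin 3) (k : ℕ)
    (xs : List ℝ) :
    updCells m (c, true) (cells k xs) = cells (k + 1) xs := by
  have h0 : ∀ xs : List ℝ, updCells m (c, false) (cells 0 xs) = cells 0 xs := by
    intro xs
    induction xs with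
    | nil => simp [cells, updCells]
    | cons x xs ih => simp [cells, updCells, retag, h, Cursor.act, ih]
  induction xs generalizing k with
  | nil => simp [cells, updCells]
  | cons x xs ih =>
    rcases k with _ | _ | k <;> simp [cells, updCells, retag, h, Cursor.act, ih, h0]

theorem updCells_cells (m : Micro) (c : Fin 3) (k : ℕ) (xs : List ℝ) :
    updCells m (c, true) (cells k xs) = cells (m.cursor.next k) xs := by
  cases h : m.cursor with
  | keep => exact updCells_cells_keep m h c true k xs
  | advance => exact updCells_cells_advance m h c k xs
  | clear => exact updCells_cells_clear m h c true k xs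
  | reset => exact updCells_cells_reset m h c true k xs

/-- The registers after an operation. -/
def nextRegs (m : Micro) (U : List (Tag × ℝ)) (a b : ℝ) : List (Tag × ℝ) :=
  U.map (fun p => (if p.1 ∈ m.kill then dead else p.1, p.2)) ++ [(m.dest₁, a), (m.dest₂, b)]

/-- The standard shape persists: the used pair joins the registers, and the next two fresh variables
take its place. Hence every operation consumes exactly two fresh variables. -/
theorem updCells_mkRow (m : Micro) (U : List (Tag × ℝ)) (hU : IsRegs U) (a b a' b' : ℝ)
    (F : List ℝ) (s : ℝ) (k : ℕ) (xs : List ℝ) :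
    updCells m (0, true) (mkRow U a b (a' :: b' :: F) s k xs) =
      mkRow (nextRegs m U a b) a' b' F s (m.cursor.next k) xs := by
  rw [mkRow, updCells_regs m _ U _ hU]
  simp [updCells, retag, updCells_fresh, updCells_cells, mkRow, nextRegs]

theorem dest_reg (m : Micro) : (m.dest₁ = dead ∨ ∃ i, m.dest₁ = reg i) ∧
    (m.dest₂ = dead ∨ ∃ i, m.dest₂ = reg i) := by
  cases m <;> simp [Micro.dest₁, Micro.dest₂]

theorem isRegs_nextRegs (m : Micro) (U : List (Tag × ℝ)) (hU : IsRegs U) (a b : ℝ) :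
    IsRegs (nextRegs m U a b) := by
  intro p hp
  simp only [nextRegs, List.mem_append, List.mem_map, List.mem_cons, List.not_mem_nil,
    or_false] at hp
  rcases hp with ⟨q, hq, rfl⟩ | rfl | rfl
  · dsimp only
    split_ifs
    · exact Or.inl rfl
    · exact hU q hq
  · exact (dest_reg m).1
  · exact (dest_reg m).2

/-! ### Abstract register states -/

/-- The values of the registers. -/
noncomputable def regVal (U : List (Tag × ℝ)) (i : Fin 8) : ℝ := val U (reg i)

/-- The values of the tags in terms of those of the registers. -/
def env (ρ : Fin 8 → ℝ) (a b s x : ℝ) : Tag → ℝ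
  | reg i => ρ i
  | new₁ => a
  | new₂ => b
  | sgn => s
  | xCur => x
  | _ => 1

/-- The values of the registers after an operation. -/
def stepRegs (m : Micro) (ρ : Fin 8 → ℝ) (a b : ℝ) (i : Fin 8) : ℝ :=
  if reg i = m.dest₁ then a else if reg i = m.dest₂ then b else
    if reg i ∈ m.kill then 1 else ρ i

/-- The operations can lead from the first state to the second one, a state consisting of the
place of the cursor and the values of the registers. -/
def Leads (s : ℝ) (xs : List ℝ) :
    List Micro → ℕ → (Fin 8 → ℝ) → ℕ → (Fin 8 → ℝ) → Prop
  | [], k, ρ, k', ρ' => k' = k ∧ ρ' = ρ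
  | m :: ms, k, ρ, k', ρ' => ∃ a b, Sat m (env ρ a b s (curVal xs k)) ∧
      Leads s xs ms (m.cursor.next k) (stepRegs m ρ a b) k' ρ'

theorem leads_append (s : ℝ) (xs : List ℝ) (ms ms' : List Micro) (k : ℕ) (ρ : Fin 8 → ℝ)
    (k' : ℕ) (ρ' : Fin 8 → ℝ) : Leads s xs (ms ++ ms') k ρ k' ρ' ↔
      ∃ k₁ ρ₁, Leads s xs ms k ρ k₁ ρ₁ ∧ Leads s xs ms' k₁ ρ₁ k' ρ' := by
  induction ms generalizing k ρ with
  | nil => simp [Leads]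
  | cons m ms ih =>
    simp only [List.cons_append, Leads, ih]
    constructor
    · rintro ⟨a, b, h, k₁, ρ₁, h₁, h₂⟩
      exact ⟨k₁, ρ₁, ⟨a, b, h, h₁⟩, h₂⟩
    · rintro ⟨k₁, ρ₁, ⟨a, b, h, h₁⟩, h₂⟩
      exact ⟨a, b, h, k₁, ρ₁, h₁, h₂⟩

/-- Values are products over all cells with a tag. A register that is written must therefore lose
its old cell, and the two new variables must not go to the same register. -/
theorem dest_mem_kill (m : Micro) : (m.dest₁ = dead ∨ m.dest₁ ∈ m.kill) ∧
    (m.dest₂ = dead ∨ m.dest₂ ∈ m.kill) ∧ (m.dest₁ = m.dest₂ → m.dest₁ = dead) := by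
  cases m <;> simp [Micro.dest₁, Micro.dest₂, Micro.kill]

/-- A register that is killed and not rewritten reads as `1`, the empty product; the operations use
this to reset `M` and `Z`. -/
theorem regVal_nextRegs (m : Micro) (U : List (Tag × ℝ)) (a b : ℝ) :
    regVal (nextRegs m U a b) = stepRegs m (regVal U) a b := by
  funext i
  obtain ⟨h₁, h₂, h₃⟩ := dest_mem_kill m
  have hmap : val (U.map fun p => (if p.1 ∈ m.kill then dead else p.1, p.2)) (reg i)
      = if reg i ∈ m.kill then 1 else val U (reg i) := by
    split_ifs with h
    · refine val_eq_one fun p hp => ?_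
      obtain ⟨q, _, rfl⟩ := List.mem_map.1 hp
      dsimp only
      split_ifs with hq
      · simp
      · intro h'; exact hq (h' ▸ h)
    · simp only [val, List.map_map]
      congr 1
      refine List.map_congr_left fun p _ => ?_
      simp only [Function.comp]
      by_cases hp : p.1 = reg i
      · simp [hp, h]
      · by_cases hk : p.1 ∈ m.kill <;> simp [hp, hk]
  rw [regVal, nextRegs, val_append, hmap, val_cons, val_cons, val_nil, stepRegs]
  by_cases e₁ : reg i = m.dest₁
  · have hk : reg i ∈ m.kill := by
      rcases h₁ with h | h
      · rw [h] at e₁; simp at e₁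
      · rwa [e₁]
    have e₂ : m.dest₂ ≠ reg i := by
      intro h
      have := h₃ (by rw [h, e₁])
      rw [this] at e₁; simp at e₁
    simp [e₁.symm, hk, e₂]
  · by_cases e₂ : reg i = m.dest₂
    · have hk : reg i ∈ m.kill := by
        rcases h₂ with h | h
        · rw [h] at e₂; simp at e₂
        · rwa [e₂]
      simp [e₂.symm, hk, e₁, Ne.symm e₁]
    · simp [e₁, e₂, Ne.symm e₁, Ne.symm e₂, regVal]

theorem val_cells_cur (k : ℕ) (xs : List ℝ) : val (cells k xs) xCur = curVal xs k := by
  have h0 : ∀ xs : List ℝ, val (cells 0 xs) xCur = 1 := by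
    intro xs
    induction xs with
    | nil => rfl
    | cons x xs ih => simp [cells, val_cons, ih]
  induction xs generalizing k with
  | nil => cases k <;> simp [cells, val_nil, curVal]
  | cons x xs ih =>
    rcases k with _ | _ | k
    · exact h0 _
    · simp [cells, val_cons, h0, curVal]
    · simp [cells, val_cons, ih, curVal]

theorem val_cells_of_ne (k : ℕ) (xs : List ℝ) (t : Tag) (h₁ : t ≠ xTodo) (h₂ : t ≠ xCur)
    (h₃ : t ≠ xDone) : val (cells k xs) t = 1 := by
  induction xs generalizing k with
  | nil => simp [cells, val_nil]
  | cons x xs ih =>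
    rcases k with _ | _ | k <;> simp [cells, val_cons, ih, h₁.symm, h₂.symm, h₃.symm]

/-- For the excluded tags, which several cells may share, the product is not controlled; `gate_tags`
shows that no equation mentions them. -/
theorem val_mkRow (U : List (Tag × ℝ)) (hU : IsRegs U) (a b : ℝ) (F : List ℝ) (s : ℝ) (k : ℕ)
    (xs : List ℝ) (t : Tag) (h₁ : t ≠ xTodo) (h₂ : t ≠ xDone) (h₃ : t ≠ dead) (h₄ : t ≠ fresh) :
    val (mkRow U a b F s k xs) t = env (regVal U) a b s (curVal xs k) t := by
  have hF : val (F.map (Prod.mk fresh)) t = 1 := by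
    refine val_eq_one fun p hp => ?_
    obtain ⟨q, _, rfl⟩ := List.mem_map.1 hp
    exact h₄.symm
  have hU' : (∀ i, t ≠ reg i) → val U t = 1 := fun hi => by
    refine val_eq_one fun p hp => ?_
    rcases hU p hp with h | ⟨i, h⟩ <;> rw [h]
    · exact h₃.symm
    · exact (hi i).symm
  rw [mkRow, val_append, val_cons, val_cons, val_append, val_cons, hF]
  cases t with
  | reg i => simp [val_cells_of_ne, env, regVal]
  | new₁ => simp [val_cells_of_ne, env, hU']
  | new₂ => simp [val_cells_of_ne, env, hU']
  | sgn => simp [val_cells_of_ne, env, hU']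
  | xCur => simp [val_cells_cur, env, hU']
  | _ => simp_all

theorem gate_tags (m : Micro) : ∀ g ∈ m.gates, ∀ p ∈ g, ∀ t ∈ p.2,
    t ≠ xTodo ∧ t ≠ xDone ∧ t ≠ dead ∧ t ≠ fresh := by
  cases m with
  | expBit b => cases b <;> simp [Micro.gates, -Prod.forall]
  | _ => simp [Micro.gates, testGates, -Prod.forall]

theorem sat_congr (m : Micro) {ρ ρ' : Tag → ℝ}
    (h : ∀ t, t ≠ xTodo → t ≠ xDone → t ≠ dead → t ≠ fresh → ρ t = ρ' t) :
    Sat m ρ ↔ Sat m ρ' := by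
  have : ∀ g ∈ m.gates, gval g ρ = gval g ρ' := by
    intro g hg
    unfold gval
    congr 1
    refine List.map_congr_left fun p hp => ?_
    congr 2
    refine List.map_congr_left fun t ht => ?_
    obtain ⟨h₁, h₂, h₃, h₄⟩ := gate_tags m g hg p hp t ht
    exact h t h₁ h₂ h₃ h₄
  exact forall₂_congr fun g hg => by rw [this g hg]

theorem sat_mkRow (m : Micro) (U : List (Tag × ℝ)) (hU : IsRegs U) (a b : ℝ) (F : List ℝ) (s : ℝ)
    (k : ℕ) (xs : List ℝ) :
    Sat m (val (mkRow U a b F s k xs)) ↔ Sat m (env (regVal U) a b s (curVal xs k)) :=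
  sat_congr m fun t h₁ h₂ h₃ h₄ => val_mkRow U hU a b F s k xs t h₁ h₂ h₃ h₄

/-- Satisfied equations trace out a path of register states. -/
theorem leads_of_satAll (ms : List Micro) (U : List (Tag × ℝ)) (hU : IsRegs U) (a b : ℝ)
    (F : List ℝ) (s : ℝ) (k : ℕ) (xs : List ℝ) (hF : 2 * ms.length ≤ F.length)
    (h : SatAll ms (mkRow U a b F s k xs)) :
    ∃ U' a' b' F' k', IsRegs U' ∧ Leads s xs ms k (regVal U) k' (regVal U') ∧
      cellsAfter ms (mkRow U a b F s k xs) = mkRow U' a' b' F' s k' xs := by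
  induction ms generalizing U a b F k with
  | nil => exact ⟨U, a, b, F, k, hU, ⟨rfl, rfl⟩, rfl⟩
  | cons m ms ih =>
    match F, hF with
    | [], hF => simp at hF
    | [_], hF => simp at hF; omega
    | a₁ :: b₁ :: F₁, hF =>
      rw [SatAll, updCells_mkRow m U hU, sat_mkRow m U hU] at h
      obtain ⟨U', a', b', F', k', h₁, h₂, h₃⟩ := ih _ (isRegs_nextRegs m U hU a b) a₁ b₁ F₁ _
        (by simp at hF; omega) h.2
      rw [regVal_nextRegs] at h₂
      refine ⟨U', a', b', F', k', h₁, ⟨a, b, h.1, h₂⟩, ?_⟩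
      rw [cellsAfter, updCells_mkRow m U hU, h₃]

/-- Every operation but `check` can be carried out. -/
theorem exists_sat (m : Micro) (hm : m ≠ .check) (ρ : Fin 8 → ℝ) (s x : ℝ) :
    ∃ a b, Sat m (env ρ a b s x) := by
  have htest : ∀ i, ∃ a b, ∀ g ∈ testGates (reg i), gval g (env ρ a b s x) = 0 := by
    intro i
    -- The second variable serves as an inverse of the register when it is nonzero; otherwise the
    -- first one has to be `1`.
    by_cases h : ρ i = 0
    · exact ⟨1, 0, by simp [testGates, gval, env, h]⟩
    · exact ⟨0, (ρ i)⁻¹, by simp [testGates, gval, env, h]⟩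
  cases m with
  | start => exact ⟨0, 0, by simp [Sat, Micro.gates, gval, env]⟩
  | expEnd => exact ⟨ρ 1 * ρ 2, 0, by simp [Sat, Micro.gates, gval, env]⟩
  | expBit b =>
    cases b
    · exact ⟨ρ 2 * ρ 2, 0, by simp [Sat, Micro.gates, gval, env]⟩
    · exact ⟨ρ 2 * (ρ 2 * x), 0, by simp [Sat, Micro.gates, gval, env]⟩
  | coefEnd => exact ⟨ρ 1 * ρ 2, 0, by simp [Sat, Micro.gates, gval, env]⟩
  | coefBit b => exact ⟨2 * ρ 2 + (if b then 1 else 0), 0, by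
      cases b <;> simp [Sat, Micro.gates, gval, env] <;> ring⟩
  | sign neg => exact ⟨ρ 0 + (if neg then -1 else 1) * (ρ 2 * ρ 1), 0, by
      cases neg <;> simp [Sat, Micro.gates, gval, env] <;> ring⟩
  | testP => exact htest 0
  | testY => exact htest 6
  | testW => exact htest 7
  | split =>
    -- One of the two roots is zero, according to the sign of `P`.
    rcases le_total 0 (ρ 0) with h | h
    · exact ⟨√(ρ 0), 0, by simp [Sat, Micro.gates, gval, env, Real.mul_self_sqrt h]⟩
    · exact ⟨0, √(-ρ 0), by
        simp [Sat, Micro.gates, gval, env, Real.mul_self_sqrt (neg_nonneg.2 h)]⟩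
  | notB => exact ⟨1 - ρ 4, 0, by simp [Sat, Micro.gates, gval, env]; ring⟩
  | move => exact ⟨ρ 4, 0, by simp [Sat, Micro.gates, gval, env]⟩
  | conj => exact ⟨ρ 4 * ρ 5, 0, by simp [Sat, Micro.gates, gval, env]⟩
  | push => exact ⟨(ρ 3 + 2 * ρ 4) / 3, 0, by
      simp [Sat, Micro.gates, gval, env]; ring⟩
  | half => exact ⟨2 * ρ 3 - 1, 0, by simp [Sat, Micro.gates, gval, env]⟩
  | pop => exact ⟨3 * ρ 3 - 2 * ρ 4, 0, by simp [Sat, Micro.gates, gval, env]⟩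
  | check => exact absurd rfl hm

/-- The unused variables can be given values that satisfy all equations. -/
theorem exists_satAll (ms : List Micro) (hms : Micro.check ∉ ms) (U : List (Tag × ℝ))
    (hU : IsRegs U) (n : ℕ) (hn : 2 * ms.length ≤ n) (s : ℝ) (k : ℕ) (xs : List ℝ) :
    ∃ a b F, F.length = n ∧ SatAll ms (mkRow U a b F s k xs) := by
  induction ms generalizing U k n with
  | nil => exact ⟨0, 0, List.replicate n 0, by simp, trivial⟩
  | cons m ms ih =>
    simp only [List.mem_cons, not_or] at hms
    obtain ⟨a, b, hab⟩ := exists_sat m (Ne.symm hms.1) (regVal U) s (curVal xs k)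
    -- The first two of the `n` unused variables become the new pair of the following operation.
    obtain ⟨a', b', F, hF, h⟩ := ih hms.2 (nextRegs m U a b) (isRegs_nextRegs m U hU a b) (n - 2)
      (by simp at hn; omega) (m.cursor.next k)
    refine ⟨a, b, a' :: b' :: F, by simp at hn; simp; omega, ?_, ?_⟩
    · rwa [sat_mkRow m U hU]
    · rwa [updCells_mkRow m U hU]

end Hardness

end ExistsReals

/-! ### Hardness: the program evaluates the formula, and correctness of the reduction. -/

namespace ExistsReals

namespace Hardness

open Tag

/-! ### Evaluation of polynomials by the operations -/

section Simulation

variable {s : ℝ} {xs : List ℝ} {k k' : ℕ} {ρ ρ' : Fin 8 → ℝ} {p m z S : ℝ}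

theorem leads_singleton (o : Micro) : Leads s xs [o] k ρ k' ρ' ↔
    ∃ a b, Sat o (env ρ a b s (curVal xs k)) ∧ k' = o.cursor.next k ∧
      ρ' = stepRegs o ρ a b := by
  simp [Leads]

/-- The contents of the registers `P`, `M`, `Z`, `S`. -/
structure Holds4 (ρ : Fin 8 → ℝ) (p m z S : ℝ) : Prop where
  poly : ρ 0 = p
  mono : ρ 1 = m
  pow : ρ 2 = z
  stack : ρ 3 = S

theorem leads_expBit (b : Bool) (h : Leads s xs [.expBit b] k ρ k' ρ') (H : Holds4 ρ p m z S) :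
    k' = k ∧ Holds4 ρ' p m (z * z * if b then curVal xs k else 1) S := by
  obtain ⟨a, c, h₁, rfl, rfl⟩ := (leads_singleton _).1 h
  obtain ⟨rfl, rfl, rfl, rfl⟩ := H
  cases b <;> simp [Sat, Micro.gates, gval, env] at h₁ <;>
    refine ⟨rfl, ?_, ?_, ?_, ?_⟩ <;>
    simp [stepRegs, Micro.dest₁, Micro.dest₂, Micro.kill] <;> linear_combination h₁

/-- The end of a number is met before its digits. It is thus the moment to multiply the previous
power into `M`, to reset `Z` to `1` by killing it, and to move to the next coordinate. -/
theorem leads_expEnd (h : Leads s xs [.expEnd] k ρ k' ρ') (H : Holds4 ρ p m z S) :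
    k' = k + 1 ∧ Holds4 ρ' p (m * z) 1 S := by
  obtain ⟨a, c, h₁, rfl, rfl⟩ := (leads_singleton _).1 h
  obtain ⟨rfl, rfl, rfl, rfl⟩ := H
  simp [Sat, Micro.gates, gval, env] at h₁
  refine ⟨rfl, ?_, ?_, ?_, ?_⟩ <;> simp [stepRegs, Micro.dest₁, Micro.dest₂, Micro.kill]
  linear_combination h₁

theorem leads_coefBit (b : Bool) (h : Leads s xs [.coefBit b] k ρ k' ρ') (H : Holds4 ρ p m z S) :
    k' = k ∧ Holds4 ρ' p m (2 * z + if b then 1 else 0) S := by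
  obtain ⟨a, c, h₁, rfl, rfl⟩ := (leads_singleton _).1 h
  obtain ⟨rfl, rfl, rfl, rfl⟩ := H
  cases b <;> simp [Sat, Micro.gates, gval, env] at h₁ <;>
    refine ⟨rfl, ?_, ?_, ?_, ?_⟩ <;>
    simp [stepRegs, Micro.dest₁, Micro.dest₂, Micro.kill] <;> linear_combination h₁

/-- Here `Z` must restart at `0`, since a coefficient is accumulated by doubling and adding; the
second new variable provides that zero. -/
theorem leads_coefEnd (h : Leads s xs [.coefEnd] k ρ k' ρ') (H : Holds4 ρ p m z S) :
    k' = k ∧ Holds4 ρ' p (m * z) 0 S := by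
  obtain ⟨a, c, h₁, rfl, rfl⟩ := (leads_singleton _).1 h
  obtain ⟨rfl, rfl, rfl, rfl⟩ := H
  simp [Sat, Micro.gates, gval, env] at h₁
  refine ⟨rfl, ?_, ?_, ?_, ?_⟩ <;> simp [stepRegs, Micro.dest₁, Micro.dest₂, Micro.kill]
  · linear_combination h₁.1
  · exact h₁.2

theorem leads_sign (b : Bool) (h : Leads s xs [.sign b] k ρ k' ρ') (H : Holds4 ρ p m z S) :
    k' = 1 ∧ Holds4 ρ' (p + (if b then -1 else 1) * (z * m)) 1 1 S := by
  obtain ⟨a, c, h₁, rfl, rfl⟩ := (leads_singleton _).1 h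
  obtain ⟨rfl, rfl, rfl, rfl⟩ := H
  cases b <;> simp [Sat, Micro.gates, gval, env] at h₁ <;>
    refine ⟨rfl, ?_, ?_, ?_, ?_⟩ <;>
    simp [stepRegs, Micro.dest₁, Micro.dest₂, Micro.kill] <;> linear_combination h₁

theorem modeAfter_bits (q : Mode) (hq : q ≠ .vars) (l : List Bool) :
    modeAfter q (l.map .bit) = q := by
  induction l with
  | nil => rfl
  | cons b l ih => cases q <;> simp_all [modeAfter, nextMode]

theorem modeAfter_encNat (q : Mode) (hq : q ≠ .vars) (e : ℕ) :
    modeAfter q (encNat e) = .body := by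
  rw [encNat, modeAfter_append, modeAfter_bits q hq]
  cases q <;> simp_all [modeAfter, nextMode]

theorem modeAfter_tuple (es : List ℕ) : modeAfter .body (es.flatMap encNat) = .body := by
  induction es with
  | nil => rfl
  | cons e es ih => rw [List.flatMap_cons, modeAfter_append, modeAfter_encNat _ (by simp), ih]

/-- Square-and-multiply: the least significant bit is written first, so reading from the right gives
the leading bit first, as Horner's scheme requires. -/
theorem leads_expBits (l : List Bool) (h : Leads s xs (strMicros .body (l.map .bit)) k ρ k' ρ')
    (H : Holds4 ρ p m 1 S) : k' = k ∧ Holds4 ρ' p m (curVal xs k ^ l.foldr Nat.bit 0) S := by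
  induction l generalizing k' ρ' with
  | nil =>
    obtain ⟨rfl, rfl⟩ := h
    simpa using H
  | cons b l ih =>
    obtain ⟨k₁, ρ₁, h₁, h₂⟩ := (leads_append ..).1
      (show Leads s xs (strMicros .body (l.map .bit) ++ [.expBit b]) k ρ k' ρ' from h)
    obtain ⟨rfl, H₁⟩ := ih h₁
    obtain ⟨rfl, H₂⟩ := leads_expBit b h₂ H₁
    refine ⟨rfl, ?_⟩
    convert H₂ using 1
    rw [List.foldr_cons, Nat.bit_val]
    cases b <;> simp [pow_add, two_mul]

theorem leads_coefBits (l : List Bool) (h : Leads s xs (strMicros .coef (l.map .bit)) k ρ k' ρ')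
    (H : Holds4 ρ p m 0 S) : k' = k ∧ Holds4 ρ' p m (l.foldr Nat.bit 0 : ℕ) S := by
  induction l generalizing k' ρ' with
  | nil =>
    obtain ⟨rfl, rfl⟩ := h
    simpa using H
  | cons b l ih =>
    obtain ⟨k₁, ρ₁, h₁, h₂⟩ := (leads_append ..).1
      (show Leads s xs (strMicros .coef (l.map .bit) ++ [.coefBit b]) k ρ k' ρ' from h)
    obtain ⟨rfl, H₁⟩ := ih h₁
    obtain ⟨rfl, H₂⟩ := leads_coefBit b h₂ H₁
    refine ⟨rfl, ?_⟩
    convert H₂ using 1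
    rw [List.foldr_cons, Nat.bit_val]
    cases b <;> simp

theorem leads_exponent (e : ℕ) (h : Leads s xs (strMicros .body (encNat e)) k ρ k' ρ')
    (H : Holds4 ρ p m z S) : k' = k + 1 ∧ Holds4 ρ' p (m * z) (curVal xs (k + 1) ^ e) S := by
  rw [encNat, strMicros_append, modeAfter_bits _ (by simp)] at h
  obtain ⟨k₁, ρ₁, h₁, h₂⟩ := (leads_append ..).1 h
  obtain ⟨rfl, H₁⟩ := leads_expEnd h₁ H
  have := leads_expBits _ h₂ H₁
  rwa [foldr_bit_bits] at this

theorem leads_coefficient (c : ℕ) (h : Leads s xs (strMicros .coef (encNat c)) k ρ k' ρ')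
    (H : Holds4 ρ p m z S) : k' = k ∧ Holds4 ρ' p (m * z) c S := by
  rw [encNat, strMicros_append, modeAfter_bits _ (by simp)] at h
  obtain ⟨k₁, ρ₁, h₁, h₂⟩ := (leads_append ..).1 h
  obtain ⟨rfl, H₁⟩ := leads_coefEnd h₁ H
  have := leads_coefBits _ h₂ H₁
  rwa [foldr_bit_bits] at this

/-- Only the product of `M` and `Z` is tracked, because the power read last is still waiting in `Z`.
Exponents are read from the last to the first, which matches the reversed coordinates of the row;
`rest` holds the coordinates not reached yet. -/
theorem leads_tuple (es : List ℕ) (ys rest : List ℝ) (x₀ : ℝ) (hl : es.length = ys.length)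
    (hxs : xs = x₀ :: (ys.reverse ++ rest))
    (h : Leads s xs (strMicros .body (es.flatMap encNat)) 1 ρ k' ρ') (H : Holds4 ρ p m z S) :
    k' = es.length + 1 ∧ ∃ m' z', Holds4 ρ' p m' z' S ∧
      m' * z' = m * z * (List.zipWith (· ^ ·) ys es).prod := by
  induction es generalizing ys rest k' ρ' with
  | nil =>
    obtain ⟨rfl, rfl⟩ := h
    exact ⟨rfl, m, z, H, by simp⟩
  | cons e es ih =>
    match ys, hl with
    | [], hl => simp at hl
    | y :: ys, hl =>
      simp only [List.length_cons, add_left_inj] at hl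
      rw [List.flatMap_cons, strMicros_append, modeAfter_encNat _ (by simp)] at h
      obtain ⟨k₁, ρ₁, h₁, h₂⟩ := (leads_append ..).1 h
      obtain ⟨rfl, m₁, z₁, H₁, e₁⟩ := ih ys (y :: rest) hl (by simp [hxs]) h₁
      obtain ⟨rfl, H₂⟩ := leads_exponent e h₂ H₁
      refine ⟨by simp, _, _, H₂, ?_⟩
      -- Places are counted from one and the first belongs to the dummy `x₀`, which accounts for the
      -- two units.
      have hc : curVal xs (es.length + 1 + 1) = y := by
        simp [hxs, curVal, hl]
      rw [hc, e₁]
      simp only [List.zipWith_cons_cons, List.prod_cons]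
      ring

end Simulation

section Formula

variable {s x₀ : ℝ} {n : ℕ} {x : Fin n → ℝ} {k k' : ℕ} {ρ ρ' : Fin 8 → ℝ} {p S : ℝ}

theorem encInt_coe (c : ℤ) :
    encInt c = (if decide (c < 0) then Symbol.minus else Symbol.plus) :: encNat c.natAbs := by
  simp [encInt]

theorem sign_mul_natAbs (c : ℤ) :
    (if decide (c < 0) then (-1 : ℝ) else 1) * (c.natAbs : ℝ) = c := by
  rw [Nat.cast_natAbs, Int.cast_abs]
  by_cases h : c < 0
  · have : (c : ℝ) < 0 := by exact_mod_cast h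
    simp [h, abs_of_neg this]
  · have : (0 : ℝ) ≤ c := by exact_mod_cast not_lt.1 h
    simp [h, abs_of_nonneg this]

theorem modeAfter_encTerm (t : ℤ × (Fin n → ℕ)) : modeAfter .body (encTerm t) = .body := by
  rw [encTerm, encInt_coe, List.cons_append, modeAfter]
  have : ∀ b : Bool, nextMode .body (if b then Symbol.minus else Symbol.plus) = .coef := by
    intro b; cases b <;> rfl
  rw [this, modeAfter_append, modeAfter_encNat _ (by simp), modeAfter_tuple]

theorem leads_term (t : ℤ × (Fin n → ℕ))
    (h : Leads s (x₀ :: (List.ofFn x).reverse) (strMicros .body (encTerm t)) 1 ρ k' ρ')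
    (H : Holds4 ρ p 1 1 S) :
    k' = 1 ∧ Holds4 ρ' (p + (t.1 : ℝ) * ∏ i, x i ^ t.2 i) 1 1 S := by
  rw [encTerm, encInt_coe, List.cons_append, strMicros] at h
  have hm : ∀ b : Bool, nextMode .body (if b then Symbol.minus else Symbol.plus) = .coef := by
    intro b; cases b <;> rfl
  have hs : ∀ b : Bool, symMicros .body (if b then Symbol.minus else Symbol.plus) = [.sign b] := by
    intro b; cases b <;> rfl
  rw [hm, hs, strMicros_append, modeAfter_encNat _ (by simp)] at h
  obtain ⟨k₂, ρ₂, h', h₃⟩ := (leads_append ..).1 h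
  obtain ⟨k₁, ρ₁, h₁, h₂⟩ := (leads_append ..).1 h'
  obtain ⟨rfl, m', z', H₁, e⟩ := leads_tuple (List.ofFn t.2) (List.ofFn x) [] x₀ (by simp)
    (by simp) h₁ H
  obtain ⟨rfl, H₂⟩ := leads_coefficient _ h₂ H₁
  obtain ⟨rfl, H₃⟩ := leads_sign _ h₃ H₂
  refine ⟨rfl, ?_⟩
  convert H₃ using 2
  have hp : ∏ i, x i ^ t.2 i = (List.zipWith (· ^ ·) (List.ofFn x) (List.ofFn t.2)).prod := by
    rw [← List.prod_ofFn]
    congr 1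
    refine List.ext_getElem (by simp) fun i h₁ h₂ => ?_
    simp
  rw [hp, e, ← sign_mul_natAbs t.1]
  ring

theorem modeAfter_terms (P : SumOfMonomials n) : modeAfter .body (P.flatMap encTerm) = .body := by
  induction P with
  | nil => rfl
  | cons t P ih => rw [List.flatMap_cons, modeAfter_append, modeAfter_encTerm, ih]

theorem leads_terms (P : SumOfMonomials n)
    (h : Leads s (x₀ :: (List.ofFn x).reverse) (strMicros .body (P.flatMap encTerm)) 1 ρ k' ρ')
    (H : Holds4 ρ p 1 1 S) : k' = 1 ∧ Holds4 ρ' (p + P.eval x) 1 1 S := by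
  induction P generalizing k' ρ' with
  | nil =>
    obtain ⟨rfl, rfl⟩ := h
    exact ⟨rfl, by simpa [SumOfMonomials.eval_eq] using H⟩
  | cons t P ih =>
    rw [List.flatMap_cons, strMicros_append, modeAfter_encTerm] at h
    obtain ⟨k₁, ρ₁, h₁, h₂⟩ := (leads_append ..).1 h
    obtain ⟨rfl, H₁⟩ := ih h₁
    obtain ⟨rfl, H₂⟩ := leads_term t h₂ H₁
    refine ⟨rfl, ?_⟩
    convert H₂ using 1
    simp only [SumOfMonomials.eval_eq, List.map_cons, List.sum_cons]
    ring

/-- The terminator of the polynomial is read as one more `expEnd` and moves the cursor from nowhere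
to place `1`. The dummy coordinate `x₀` absorbs this step, and `sign` returns the cursor there after
every term. -/
theorem leads_poly (P : SumOfMonomials n)
    (h : Leads s (x₀ :: (List.ofFn x).reverse) (strMicros .body (encPoly P)) 0 ρ k' ρ')
    (H : Holds4 ρ 0 1 1 S) : Holds4 ρ' (P.eval x) 1 1 S := by
  rw [encPoly, strMicros_append, modeAfter_terms] at h
  obtain ⟨k₁, ρ₁, h₁, h₂⟩ := (leads_append ..).1 h
  obtain ⟨rfl, H₁⟩ := leads_expEnd h₁ H
  rw [mul_one] at H₁
  have := (leads_terms P h₂ H₁).2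
  rwa [zero_add] at this

theorem modeAfter_encPoly (P : SumOfMonomials n) : modeAfter .body (encPoly P) = .body := by
  rw [encPoly, modeAfter_append, modeAfter_terms]
  rfl

/-! ### Evaluation of formulas by the operations -/

open Classical in
/-- The truth value of a proposition as a real number. -/
noncomputable def ind (q : Prop) : ℝ := if q then 1 else 0

/-- A stack of truth values as a real number. -/
noncomputable def stackVal : List Prop → ℝ
  | [] => 0
  | q :: st => (stackVal st + 2 * ind q) / 3

theorem ind_mem (q : Prop) : ind q = 0 ∨ ind q = 1 := by
  unfold ind; split_ifs <;> simp

theorem ind_congr {q r : Prop} (h : q ↔ r) : ind q = ind r := by rw [propext h]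

theorem stackVal_mem (st : List Prop) : 0 ≤ stackVal st ∧ stackVal st < 1 := by
  induction st with
  | nil => simp [stackVal]
  | cons q st ih =>
    rw [stackVal]
    rcases ind_mem q with h | h <;> rw [h] <;> constructor <;> linarith

/-- The leading ternary digit is `0` or `2` and the remainder is less than `1 / 3`, so the number
avoids the middle third and comparison with `1 / 2` reads off the top. -/
theorem stackVal_top (q : Prop) (st : List Prop) : 0 ≤ 2 * stackVal (q :: st) - 1 ↔ q := by
  have := stackVal_mem st
  by_cases h : q
  · simp only [stackVal, ind, h, if_true, iff_true]; linarith
  · simp only [stackVal, ind, h, if_false, iff_false, not_le]; linarith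

theorem ind_not (q : Prop) : 1 - ind q = ind (¬ q) := by
  by_cases h : q <;> simp [ind, h]

theorem ind_mul (q r : Prop) : ind q * ind r = ind (q ∧ r) := by
  by_cases h : q <;> by_cases h' : r <;> simp [ind, h, h']

/-- If `r = 0`, the second equation says `a = 1`; otherwise the first says `a = 0`. The auxiliary
`b` only makes the second equation solvable. -/
theorem ind_of_test {r a b : ℝ} (h₁ : r * a = 0) (h₂ : r * b + a - 1 = 0) : a = ind (r = 0) := by
  by_cases h : r = 0
  · subst h
    simp only [ind, if_true]
    linarith
  · simp only [ind, h, if_false]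
    simpa [h] using h₁

/-- One of `y`, `w` vanishes, so `p` is either `y * y` or `-(w * w)`. The roots are determined only
up to sign, but their vanishing is all that is tested. -/
theorem split_iff {y w p : ℝ} (h₁ : y * y - w * w - p = 0) (h₂ : y * w = 0) :
    (w = 0 ↔ 0 ≤ p) ∧ (y = 0 ↔ ¬ 0 < p) := by
  obtain rfl : p = y * y - w * w := by linarith
  rcases mul_eq_zero.1 h₂ with rfl | rfl
  · refine ⟨⟨by rintro rfl; simp, fun h => ?_⟩, by simp [mul_self_nonneg]⟩
    have := mul_self_nonneg w
    have : w * w = 0 := by linarith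
    simpa using this
  · refine ⟨by simp [mul_self_nonneg], ⟨by rintro rfl; simp, fun h => ?_⟩⟩
    by_contra hy
    exact h (by simpa using mul_self_pos.2 hy)

/-- `half` puts `2 * S - 1` into `P`, whose sign is the top truth value; `split` and `testW` convert
that sign into a number, and `pop` removes the digit. Register `C` survives, so a first operand can
wait there. -/
theorem leads_pop {xs : List ℝ} {q : Prop} {st : List Prop} {c : ℝ}
    (h : Leads s xs popMicros k ρ k' ρ') (hM : ρ 1 = 1) (hZ : ρ 2 = 1)
    (hS : ρ 3 = stackVal (q :: st)) (hC : ρ 5 = c) :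
    ρ' 1 = 1 ∧ ρ' 2 = 1 ∧ ρ' 3 = stackVal st ∧ ρ' 4 = ind q ∧ ρ' 5 = c := by
  obtain ⟨a₁, b₁, h₁, a₂, b₂, h₂, a₃, b₃, h₃, a₄, b₄, h₄, rfl, rfl⟩ := h
  simp [Sat, Micro.gates, testGates, gval, env, stepRegs, Micro.dest₁, Micro.dest₂,
    Micro.kill] at h₁ h₂ h₃ h₄
  have hs := (split_iff (y := a₂) (w := b₂) (p := a₁) (by linear_combination h₂.1)
    (by simpa using h₂.2)).1
  have ht : a₃ = ind q := by
    rw [ind_of_test (r := b₂) (a := a₃) (b := b₃) (by simpa using h₃.1)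
      (by linear_combination h₃.2)]
    refine ind_congr (hs.trans ?_)
    rw [← stackVal_top q st, ← hS]
    have : a₁ = 2 * ρ 3 - 1 := by linear_combination h₁
    rw [this]
  refine ⟨?_, ?_, ?_, ?_, ?_⟩ <;>
    simp [stepRegs, Micro.dest₁, Micro.dest₂, Micro.kill, hM, hZ, hC, ht]
  have : a₄ = 3 * ρ 3 - 2 * a₃ := by linear_combination h₄
  rw [this, ht, hS, stackVal]
  ring

theorem leads_push {xs : List ℝ} {q : Prop} {st : List Prop}
    (h : Leads s xs [.push] k ρ k' ρ') (hM : ρ 1 = 1) (hZ : ρ 2 = 1)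
    (hS : ρ 3 = stackVal st) (hB : ρ 4 = ind q) :
    k' = 0 ∧ Holds4 ρ' 0 1 1 (stackVal (q :: st)) := by
  obtain ⟨a, b, h₁, rfl, rfl⟩ := h
  simp [Sat, Micro.gates, gval, env] at h₁
  refine ⟨rfl, ?_, ?_, ?_, ?_⟩ <;>
    simp [stepRegs, Micro.dest₁, Micro.dest₂, Micro.kill, hM, hZ, h₁.2]
  rw [stackVal, ← hS, ← hB]
  linear_combination h₁.1 / 3

theorem leads_not {xs : List ℝ} {q : Prop} (h : Leads s xs [.notB] k ρ k' ρ')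
    (hB : ρ 4 = ind q) : ρ' 4 = ind (¬ q) ∧ ρ' 1 = ρ 1 ∧ ρ' 2 = ρ 2 ∧ ρ' 3 = ρ 3 ∧
      ρ' 5 = ρ 5 := by
  obtain ⟨a, b, h₁, rfl, rfl⟩ := h
  simp [Sat, Micro.gates, gval, env] at h₁
  refine ⟨?_, ?_, ?_, ?_, ?_⟩ <;>
    simp [stepRegs, Micro.dest₁, Micro.dest₂, Micro.kill]
  rw [← ind_not, ← hB]
  linear_combination h₁

theorem leads_move {xs : List ℝ} (h : Leads s xs [.move] k ρ k' ρ') :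
    ρ' 5 = ρ 4 ∧ ρ' 1 = ρ 1 ∧ ρ' 2 = ρ 2 ∧ ρ' 3 = ρ 3 := by
  obtain ⟨a, b, h₁, rfl, rfl⟩ := h
  simp [Sat, Micro.gates, gval, env] at h₁
  refine ⟨?_, ?_, ?_, ?_⟩ <;>
    simp [stepRegs, Micro.dest₁, Micro.dest₂, Micro.kill]
  linear_combination h₁

theorem leads_conj {xs : List ℝ} (h : Leads s xs [.conj] k ρ k' ρ') :
    ρ' 4 = ρ 4 * ρ 5 ∧ ρ' 1 = ρ 1 ∧ ρ' 2 = ρ 2 ∧ ρ' 3 = ρ 3 := by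
  obtain ⟨a, b, h₁, rfl, rfl⟩ := h
  simp [Sat, Micro.gates, gval, env] at h₁
  refine ⟨?_, ?_, ?_, ?_⟩ <;>
    simp [stepRegs, Micro.dest₁, Micro.dest₂, Micro.kill]
  linear_combination h₁

theorem leads_comparison {xs : List ℝ} (c : Comparison) {st : List Prop}
    (h : Leads s xs (symMicros .body c.symbol) k ρ k' ρ')
    (H : Holds4 ρ p 1 1 (stackVal st)) :
    k' = 0 ∧ Holds4 ρ' 0 1 1 (stackVal (c.Holds p :: st)) := by
  obtain ⟨hP, hM, hZ, hS⟩ := H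
  cases c with
  | eq =>
    obtain ⟨a₁, b₁, h₁, h₂⟩ := h
    simp [Sat, Micro.gates, testGates, gval, env] at h₁
    refine leads_push h₂ (by simpa [stepRegs, Micro.dest₁, Micro.dest₂, Micro.kill])
      (by simpa [stepRegs, Micro.dest₁, Micro.dest₂, Micro.kill])
      (by simpa [stepRegs, Micro.dest₁, Micro.dest₂, Micro.kill]) ?_
    simp only [stepRegs, Micro.dest₁, if_true, Comparison.Holds]
    rw [← hP]
    exact ind_of_test (b := b₁) (by simpa using h₁.1) (by linear_combination h₁.2)
  | ge =>
    obtain ⟨a₀, b₀, h₀, a₁, b₁, h₁, h₂⟩ := h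
    simp [Sat, Micro.gates, testGates, gval, env, stepRegs, Micro.dest₁, Micro.dest₂] at h₀ h₁
    refine leads_push h₂ (by simpa [stepRegs, Micro.dest₁, Micro.dest₂, Micro.kill])
      (by simpa [stepRegs, Micro.dest₁, Micro.dest₂, Micro.kill])
      (by simpa [stepRegs, Micro.dest₁, Micro.dest₂, Micro.kill]) ?_
    simp only [stepRegs, Micro.dest₁, if_true, Comparison.Holds]
    rw [← hP, ind_of_test (r := b₀) (a := a₁) (b := b₁) (by simpa using h₁.1) (by linear_combination h₁.2)]
    exact ind_congr (split_iff (y := a₀) (w := b₀) (by linear_combination h₀.1) (by simpa using h₀.2)).1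
  | gt =>
    obtain ⟨a₀, b₀, h₀, a₁, b₁, h₁, h₂⟩ := h
    simp [Sat, Micro.gates, testGates, gval, env, stepRegs, Micro.dest₁] at h₀ h₁
    obtain ⟨k₂, ρ₂, h₃, h₄⟩ := (leads_append s xs [.notB] [.push] ..).1 h₂
    obtain ⟨g₁, g₂, g₃, g₄, -⟩ := leads_not (q := ¬ 0 < ρ 0) h₃ (by
      simp only [stepRegs, Micro.dest₁, if_true]
      rw [ind_of_test (r := a₀) (a := a₁) (b := b₁) (by simpa using h₁.1) (by linear_combination h₁.2)]
      exact ind_congr (split_iff (y := a₀) (w := b₀) (by linear_combination h₀.1) (by simpa using h₀.2)).2)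
    refine leads_push h₄ (g₂.trans (by simpa [stepRegs, Micro.dest₁, Micro.dest₂, Micro.kill]))
      (g₃.trans (by simpa [stepRegs, Micro.dest₁, Micro.dest₂, Micro.kill]))
      (g₄.trans (by simpa [stepRegs, Micro.dest₁, Micro.dest₂, Micro.kill])) ?_
    rw [g₁, Comparison.Holds, ← hP]
    exact ind_congr not_not

theorem modeAfter_encFormula (φ : QFFormula n) : modeAfter .body (encFormula φ) = .body := by
  induction φ with
  | atom c P =>
    rw [encFormula, modeAfter]
    have : nextMode .body c.symbol = .body := by cases c <;> rfl
    rw [this, modeAfter_encPoly]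
  | not φ ih => exact ih
  | and φ ψ ih₁ ih₂ =>
    change modeAfter .body (encFormula φ ++ encFormula ψ) = _
    rw [modeAfter_append, ih₁, ih₂]
  | or φ ψ ih₁ ih₂ =>
    change modeAfter .body (encFormula φ ++ encFormula ψ) = _
    rw [modeAfter_append, ih₁, ih₂]

/-- Read backwards, prefix notation is postfix: both operands are on the stack when the connective
is met. The initial state is restored above the untouched stack `st`, so the induction hypotheses
chain. -/
theorem leads_formula (φ : QFFormula n) {st : List Prop}
    (h : Leads s (x₀ :: (List.ofFn x).reverse) (strMicros .body (encFormula φ)) 0 ρ k' ρ')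
    (H : Holds4 ρ 0 1 1 (stackVal st)) :
    k' = 0 ∧ Holds4 ρ' 0 1 1 (stackVal (φ.Holds x :: st)) := by
  induction φ generalizing k' ρ ρ' st with
  | atom c P =>
    have hm : nextMode .body c.symbol = .body := by cases c <;> rfl
    rw [encFormula, strMicros, hm] at h
    obtain ⟨k₁, ρ₁, h₁, h₂⟩ := (leads_append ..).1 h
    exact leads_comparison c h₂ (leads_poly P h₁ H)
  | not φ ih =>
    obtain ⟨k₁, ρ₁, h₁, h₂⟩ := (leads_append ..).1 h
    obtain ⟨k₂, ρ₂, h₃, h₄⟩ := (leads_append s _ popMicros [.notB, .push] ..).1 h₂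
    obtain ⟨k₃, ρ₃, h₅, h₆⟩ := (leads_append s _ [.notB] [.push] ..).1 h₄
    obtain ⟨rfl, H₁⟩ := ih h₁ H
    obtain ⟨e₁, e₂, e₃, e₄, -⟩ := leads_pop h₃ H₁.mono H₁.pow H₁.stack rfl
    obtain ⟨g₄, g₁, g₂, g₃, -⟩ := leads_not h₅ e₄
    exact leads_push h₆ (g₁.trans e₁) (g₂.trans e₂) (g₃.trans e₃) g₄
  | and φ ψ ih₁ ih₂ =>
    obtain ⟨k₁, ρ₁, h₁, h₂⟩ := (leads_append s _ (strMicros .body (encFormula φ ++ encFormula ψ))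
      (symMicros .body .and) ..).1 h
    rw [strMicros_append, modeAfter_encFormula] at h₁
    obtain ⟨k₂, ρ₂, h₃, h₄⟩ := (leads_append ..).1 h₁
    obtain ⟨rfl, H₁⟩ := ih₂ h₃ H
    obtain ⟨rfl, H₂⟩ := ih₁ h₄ H₁
    obtain ⟨k₃, ρ₃, h₅, h₆⟩ := (leads_append s _ popMicros (.move :: popMicros ++ [.conj, .push])
      ..).1 h₂
    obtain ⟨k₄, ρ₄, h₇, h₈⟩ := (leads_append s _ [.move] (popMicros ++ [.conj, .push]) ..).1 h₆
    obtain ⟨k₅, ρ₅, h₉, h₁₀⟩ := (leads_append s _ popMicros [.conj, .push] ..).1 h₈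
    obtain ⟨k₆, ρ₆, h₁₁, h₁₂⟩ := (leads_append s _ [.conj] [.push] ..).1 h₁₀
    obtain ⟨e₁, e₂, e₃, e₄, -⟩ := leads_pop h₅ H₂.mono H₂.pow H₂.stack rfl
    obtain ⟨f₅, f₁, f₂, f₃⟩ := leads_move h₇
    obtain ⟨g₁, g₂, g₃, g₄, g₅⟩ := leads_pop h₉ (f₁.trans e₁) (f₂.trans e₂) (f₃.trans e₃)
      (f₅.trans e₄)
    obtain ⟨i₄, i₁, i₂, i₃⟩ := leads_conj h₁₁
    refine leads_push h₁₂ (i₁.trans g₁) (i₂.trans g₂) (i₃.trans g₃) ?_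
    rw [i₄, g₄, g₅, ind_mul]
    -- The right operand is evaluated first and hence popped last, so the factors appear in the
    -- opposite order.
    exact ind_congr and_comm
  | or φ ψ ih₁ ih₂ =>
    obtain ⟨k₁, ρ₁, h₁, h₂⟩ := (leads_append s _ (strMicros .body (encFormula φ ++ encFormula ψ))
      (symMicros .body .or) ..).1 h
    rw [strMicros_append, modeAfter_encFormula] at h₁
    obtain ⟨k₂, ρ₂, h₃, h₄⟩ := (leads_append ..).1 h₁
    obtain ⟨rfl, H₁⟩ := ih₂ h₃ H
    obtain ⟨rfl, H₂⟩ := ih₁ h₄ H₁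
    obtain ⟨k₃, ρ₃, h₅, h₆⟩ := (leads_append s _ popMicros
      (.notB :: .move :: popMicros ++ [.notB, .conj, .notB, .push]) ..).1 h₂
    obtain ⟨k₄, ρ₄, h₇, h₈⟩ := (leads_append s _ [.notB]
      (.move :: popMicros ++ [.notB, .conj, .notB, .push]) ..).1 h₆
    obtain ⟨k₅, ρ₅, h₉, h₁₀⟩ := (leads_append s _ [.move]
      (popMicros ++ [.notB, .conj, .notB, .push]) ..).1 h₈
    obtain ⟨k₆, ρ₆, h₁₁, h₁₂⟩ := (leads_append s _ popMicros
      [.notB, .conj, .notB, .push] ..).1 h₁₀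
    obtain ⟨k₇, ρ₇, h₁₃, h₁₄⟩ := (leads_append s _ [.notB] [.conj, .notB, .push] ..).1 h₁₂
    obtain ⟨k₈, ρ₈, h₁₅, h₁₆⟩ := (leads_append s _ [.conj] [.notB, .push] ..).1 h₁₄
    obtain ⟨k₉, ρ₉, h₁₇, h₁₈⟩ := (leads_append s _ [.notB] [.push] ..).1 h₁₆
    obtain ⟨e₁, e₂, e₃, e₄, -⟩ := leads_pop h₅ H₂.mono H₂.pow H₂.stack rfl
    obtain ⟨a₄, a₁, a₂, a₃, -⟩ := leads_not h₇ e₄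
    obtain ⟨f₅, f₁, f₂, f₃⟩ := leads_move h₉
    obtain ⟨g₁, g₂, g₃, g₄, g₅⟩ := leads_pop h₁₁ (f₁.trans (a₁.trans e₁))
      (f₂.trans (a₂.trans e₂)) (f₃.trans (a₃.trans e₃)) (f₅.trans a₄)
    obtain ⟨b₄, b₁, b₂, b₃, b₅⟩ := leads_not h₁₃ g₄
    obtain ⟨i₄, i₁, i₂, i₃⟩ := leads_conj h₁₅
    rw [b₄, b₅, g₅, ind_mul] at i₄
    obtain ⟨j₄, j₁, j₂, j₃, -⟩ := leads_not h₁₇ i₄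
    refine leads_push h₁₈ (j₁.trans (i₁.trans (b₁.trans g₁))) (j₂.trans (i₂.trans (b₂.trans g₂)))
      (j₃.trans (i₃.trans (b₃.trans g₃))) ?_
    rw [j₄]
    -- De Morgan: the value computed is the negation of the conjunction of both negations.
    refine ind_congr ?_
    simp only [QFFormula.Holds]
    tauto

/-- Initially there are no register cells, so all registers read `1`; this suits `M` and `Z`, while
`start` sets `P` and `S` to `0`. -/
theorem leads_sentence (S : Sentence) (x : Fin S.n → ℝ)
    (h : Leads s (x₀ :: (List.ofFn x).reverse) (sentenceMicros S) 0 (fun _ => 1) k' ρ') :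
    ρ' 3 = stackVal [S.Φ.Holds x] := by
  obtain ⟨a, b, h₁, h₂⟩ := h
  simp [Sat, Micro.gates, gval, env] at h₁
  refine (leads_formula S.Φ h₂ ⟨?_, ?_, ?_, ?_⟩).2.stack <;>
    simp [stepRegs, Micro.dest₁, Micro.dest₂, Micro.kill, h₁, stackVal]

end Formula

/-! ### Correctness of the reduction -/

theorem check_not_mem (p : Mode) (w : List Symbol) : Micro.check ∉ strMicros p w := by
  induction w generalizing p with
  | nil => simp [strMicros]
  | cons x w ih =>
    rw [strMicros, List.mem_append, not_or]
    refine ⟨ih _, ?_⟩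
    cases p <;> cases x <;> simp [symMicros, popMicros]

theorem check_not_mem_sentence (S : Sentence) : Micro.check ∉ sentenceMicros S := by
  simp [sentenceMicros, check_not_mem]

theorem sat_check {ρ : Tag → ℝ} : Sat .check ρ ↔ 3 * ρ Tag.S - 2 = 0 ∧ ρ sgn ^ 2 - 1 = 0 := by
  simp [Sat, Micro.gates, gval, sq, sub_eq_add_neg]

theorem eval_toVSC (S : Sentence) (y : Fin (toVSC S).d → ℝ) (v : List (Tag × ℝ))
    (h₁ : v.map Prod.fst = initRow S) (h₂ : (v.map Prod.snd).reverse = List.ofFn y) :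
    (toVSC S).f.eval y = 1 - sqSum (sentenceMicros S ++ [.check]) v := by
  have := eval_listTerm y (progTerms (sentenceMicros S ++ [.check]) (initRow S))
    (fun t ht => length_of_mem_progTerms _ _ t ht)
  refine this.trans ?_
  rw [← h₁, ← h₂, sum_progTerms]
  simp [List.count_eq_zero.2 (check_not_mem_sentence S)]

/-- The row of a point. -/
theorem exists_row (S : Sentence) (y : Fin (toVSC S).d → ℝ) :
    ∃ v : List (Tag × ℝ), v.map Prod.fst = initRow S ∧
      (v.map Prod.snd).reverse = List.ofFn y := by
  have hl : (initRow S).length = (List.ofFn y).reverse.length := by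
    rw [List.length_reverse, List.length_ofFn]; rfl
  refine ⟨(initRow S).zip (List.ofFn y).reverse, ?_, ?_⟩
  · rw [List.map_fst_zip hl.le]
  · rw [List.map_snd_zip hl.ge, List.reverse_reverse]

theorem map_fst_cells (xs : List ℝ) :
    (cells 0 xs).map Prod.fst = List.replicate xs.length xTodo := by
  induction xs with
  | nil => rfl
  | cons x xs ih => simp [cells, ih, List.replicate_succ]

theorem map_fst_eq_replicate {t : Tag} {n : ℕ} {w : List (Tag × ℝ)}
    (h : w.map Prod.fst = List.replicate n t) : ∃ F : List ℝ, F.length = n ∧ w = F.map (Prod.mk t) := by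
  refine ⟨w.map Prod.snd, by simpa using congrArg List.length h, ?_⟩
  rw [List.map_map]
  conv_lhs => rw [← List.map_id w]
  refine List.map_congr_left fun p hp => ?_
  have : p.1 ∈ List.replicate n t := h ▸ List.mem_map_of_mem hp
  exact Prod.ext (List.eq_of_mem_replicate this) rfl

theorem cells_zero (xs : List ℝ) : cells 0 xs = xs.map (Prod.mk xTodo) := by
  induction xs with
  | nil => rfl
  | cons x xs ih => simp [cells, ih]

/-- A row with the initial tags has the standard shape. -/
theorem exists_mkRow (S : Sentence) (v : List (Tag × ℝ)) (h : v.map Prod.fst = initRow S) :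
    ∃ a b F s x₀, ∃ x : Fin S.n → ℝ, 2 * (sentenceMicros S).length ≤ F.length ∧
      v = mkRow [] a b F s 0 (x₀ :: (List.ofFn x).reverse) := by
  have h' : v.map Prod.fst = new₁ :: new₂ :: (List.replicate (2 * (sentenceMicros S).length) fresh ++
      sgn :: List.replicate (S.n + 1) xTodo) := by
    rw [h]
    simp [initRow, sentenceMicros, Nat.mul_add, List.replicate_succ]
  match v, h' with
  | (_, a) :: (_, b) :: w, h' =>
    simp only [List.map_cons, List.cons.injEq] at h'
    obtain ⟨rfl, rfl, hw⟩ := h'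
    obtain ⟨w₁, w₂, rfl, hw₁, hw₂⟩ := List.map_eq_append_iff.1 hw
    obtain ⟨F, hF, rfl⟩ := map_fst_eq_replicate hw₁
    match w₂, hw₂ with
    | (_, s) :: w₃, hw₂ =>
      simp only [List.map_cons, List.cons.injEq] at hw₂
      obtain ⟨rfl, hw₃⟩ := hw₂
      obtain ⟨X, hX, rfl⟩ := map_fst_eq_replicate hw₃
      match X, hX with
      | x₀ :: X, hX =>
        have hX' : X.reverse.length = S.n := by simpa using hX
        refine ⟨a, b, F, s, x₀, fun j => X.reverse.getD j 0, by omega, ?_⟩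
        rw [ofFn_getD hX', List.reverse_reverse, mkRow, cells_zero]
        rfl

theorem regVal_nil : regVal [] = fun _ => 1 := rfl

theorem isRegs_nil : IsRegs [] := by simp [IsRegs]

/-- Satisfied equations mean that the value of the sentence at the point is on the stack. -/
theorem stack_of_satAll (S : Sentence) (a b : ℝ) (F : List ℝ) (s x₀ : ℝ) (x : Fin S.n → ℝ)
    (hF : 2 * (sentenceMicros S).length ≤ F.length)
    (h : SatAll (sentenceMicros S) (mkRow [] a b F s 0 (x₀ :: (List.ofFn x).reverse))) :
    let v := cellsAfter (sentenceMicros S) (mkRow [] a b F s 0 (x₀ :: (List.ofFn x).reverse))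
    val v Tag.S = stackVal [S.Φ.Holds x] ∧ val v sgn = s := by
  obtain ⟨U', a', b', F', k', hU', hL, hv⟩ := leads_of_satAll _ [] isRegs_nil a b F s 0 _ hF h
  rw [regVal_nil] at hL
  have := leads_sentence S x hL
  intro v
  have hv' : v = mkRow U' a' b' F' s k' (x₀ :: (List.ofFn x).reverse) := hv
  rw [hv', val_mkRow _ hU' _ _ _ _ _ _ _ (by simp) (by simp) (by simp) (by simp),
    val_mkRow _ hU' _ _ _ _ _ _ _ (by simp) (by simp) (by simp) (by simp)]
  exact ⟨this, rfl⟩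

/-- The stack with the single entry true is `2 / 3`; this is the equation that `check` imposes. -/
theorem three_stackVal (q : Prop) : 3 * stackVal [q] - 2 = 0 ↔ q := by
  by_cases h : q <;> simp [stackVal, ind, h]
  all_goals norm_num

/-- The separating coordinate. -/
def sgnIdx (S : Sentence) : Fin (toVSC S).d :=
  ⟨S.n + 1, by simp only [toVSC, initRow, List.length_append, List.length_cons,
    List.length_replicate]; omega⟩

theorem apply_sgnIdx (S : Sentence) (y : Fin (toVSC S).d → ℝ) (a b : ℝ) (F : List ℝ) (s x₀ : ℝ)
    (x : Fin S.n → ℝ)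
    (h : ((mkRow [] a b F s 0 (x₀ :: (List.ofFn x).reverse)).map Prod.snd).reverse = List.ofFn y) :
    y (sgnIdx S) = s := by
  have h₁ : (List.ofFn y)[S.n + 1]? = some (y (sgnIdx S)) := by
    rw [List.getElem?_eq_getElem (by rw [List.length_ofFn]; exact (sgnIdx S).2), List.getElem_ofFn]
    rfl
  have h₂ : (List.ofFn y)[S.n + 1]? = some s := by
    rw [← h, mkRow, cells_zero]
    simp
  exact Option.some_injective _ (h₁.symm.trans h₂)

/-- A point of the cluster with prescribed separating coordinate. -/
theorem exists_cluster_point (S : Sentence) (x : Fin S.n → ℝ) (hx : S.Φ.Holds x) (s : ℝ)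
    (hs : s ^ 2 = 1) :
    ∃ y : Fin (toVSC S).d → ℝ, 1 ≤ (toVSC S).f.eval y ∧ y (sgnIdx S) = s := by
  -- Exactly as many fresh variables as the program consumes; the dummy coordinate is set to `0`.
  obtain ⟨a, b, F, hF, h⟩ := exists_satAll (sentenceMicros S) (check_not_mem_sentence S) []
    isRegs_nil _ le_rfl s 0 (0 :: (List.ofFn x).reverse)
  set v := mkRow [] a b F s 0 (0 :: (List.ofFn x).reverse) with hv
  have h₁ : v.map Prod.fst = initRow S := by
    have hf : ∀ G : List ℝ, (G.map (Prod.mk fresh)).map Prod.fst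
        = List.replicate G.length fresh := by
      intro G
      induction G with
      | nil => rfl
      | cons g G ih => simp [List.replicate_succ]
    simp only [hv, mkRow, List.nil_append, List.map_cons, List.map_append, hf, map_fst_cells, hF]
    simp [initRow, sentenceMicros, Nat.mul_add, List.replicate_succ]
  have hlen : (v.map Prod.snd).reverse.length = (toVSC S).d := by
    simp only [List.length_reverse, List.length_map, toVSC, ← h₁]
  have hy : List.ofFn (fun j : Fin (toVSC S).d => (v.map Prod.snd).reverse.getD j 0)
      = (v.map Prod.snd).reverse := ofFn_getD hlen 0
  refine ⟨fun j => (v.map Prod.snd).reverse.getD j 0, ?_,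
    apply_sgnIdx S _ a b F s 0 x hy.symm⟩
  · rw [eval_toVSC S _ v h₁ hy.symm]
    have hc := stack_of_satAll S a b F s 0 x hF.ge h
    have : SatAll (sentenceMicros S ++ [.check]) v := by
      refine (satAll_append _ _ _).2 ⟨h, ?_, trivial⟩
      rw [sat_check, hc.1, hc.2, three_stackVal, hs]
      exact ⟨hx, by ring⟩
    have := (sqSum_nonpos_iff _ _).2 this
    linarith

/-- The equation `s² = 1` is what creates the valley: its solutions fall into the two hyperplanes `s
= 1` and `s = -1`, and the midpoint of points from different ones satisfies `s = 0`. -/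
theorem toVSC_correct (S : Sentence) : S.IsTrue ↔ (toVSC S).HasValley := by
  have hθ : (((toVSC S).θ : ℚ) : ℝ) = 1 := by simp [toVSC]
  unfold VSCInstance.HasValley
  rw [hθ]
  constructor
  · rintro ⟨x, hx⟩
    obtain ⟨p, hp, hps⟩ := exists_cluster_point S x hx 1 (by norm_num)
    obtain ⟨q, hq, hqs⟩ := exists_cluster_point S x hx (-1) (by norm_num)
    refine ⟨p, q, hp, hq, ?_⟩
    obtain ⟨v, h₁, h₂⟩ := exists_row S ((1 / 2 : ℝ) • (p + q))
    rw [eval_toVSC S _ v h₁ h₂]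
    -- At the threshold all equations hold at the midpoint, in particular `s² = 1`, contrary to `s =
    -- 0`.
    by_contra hle
    have hsat := (sqSum_nonpos_iff _ v).1 (by linarith)
    obtain ⟨a, b, F, s, x₀, x', hF, rfl⟩ := exists_mkRow S v h₁
    have hs := apply_sgnIdx S _ a b F s x₀ x' h₂
    rw [satAll_append] at hsat
    have hc := stack_of_satAll S a b F s x₀ x' hF hsat.1
    have := (sat_check.1 hsat.2.1).2
    rw [hc.2, ← hs] at this
    simp [hps, hqs] at this
  · rintro ⟨p, -, hp, -, -⟩
    obtain ⟨v, h₁, h₂⟩ := exists_row S p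
    rw [eval_toVSC S p v h₁ h₂] at hp
    obtain ⟨a, b, F, s, x₀, x, hF, rfl⟩ := exists_mkRow S v h₁
    have hsat := (satAll_append _ _ _).1 ((sqSum_nonpos_iff _ _).1 (by linarith))
    have hc := stack_of_satAll S a b F s x₀ x hF hsat.1
    have := sat_check.1 hsat.2.1
    rw [hc.1, three_stackVal] at this
    exact ⟨x, this.1⟩

end Hardness

end ExistsReals

/-! ### Membership: the sentence of a VSC instance and the machine that writes it. -/

namespace ExistsReals

/-! ### Sweeps over a row that is given from its end -/

namespace Sweeper

variable {Γ A B O P Q : Type} (M : Sweeper Γ A B O P Q)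

/-- The control after a sweep over the reversed list. -/
def revAfter (q : Q) : List B → Q
  | [] => q
  | b :: l => (M.move (revAfter q l) b).1

/-- What a sweep over the reversed list writes. -/
def revOut (q : Q) : List B → List O
  | [] => []
  | b :: l => (M.move (M.revAfter q l) b).2.2 ++ revOut q l

theorem revAfter_append (q : Q) (l l' : List B) :
    M.revAfter q (l ++ l') = M.revAfter (M.revAfter q l') l := by
  induction l with
  | nil => rfl
  | cons b l ih => simp [revAfter, ih]

theorem revOut_append (q : Q) (l l' : List B) :
    M.revOut q (l ++ l') = M.revOut (M.revAfter q l') l ++ M.revOut q l' := by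
  induction l with
  | nil => rfl
  | cons b l ih => simp [revOut, revAfter_append, ih]

/-- The row is the input upside down and the output is prepended, so in terms of the reversed row,
which is in input order, the symbols come out in order as well. -/
theorem emit_eq (q : Q) (r : List B) :
    M.emit q r = M.fin (M.revAfter q r.reverse) ++ M.revOut q r.reverse := by
  induction r generalizing q with
  | nil => simp [emit, revOut, revAfter]
  | cons c r ih => simp [emit, ih, revOut_append, revAfter_append, revOut, revAfter]

end Sweeper

namespace Membership

open Hardness (Mode nextMode)

/-! ### The sentence -/

section Sentence

variable (I : VSCInstance)

/-- A term of `f`, in the variables of the copy `κ`: the first variable is the threshold, then the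
coordinates of the two points and of the midpoint alternate. -/
def copyExps (κ : ℕ) (es : List ℕ) : List ℕ :=
  0 :: (List.replicate κ 0 ++ (es.flatMap (fun e => [e, 0, 0]) ++ List.replicate (2 - κ) 0))

/-- The number of variables of the sentence. -/
abbrev numVars (d : ℕ) : ℕ := 3 * d + 3

/-- The term that is a multiple of the threshold variable. -/
def thresholdTerm (d : ℕ) (c : ℤ) : ℤ × (Fin (numVars d) → ℕ) :=
  listTerm _ (c, 1 :: List.replicate (3 * d + 2) 0)

/-- A constant term. -/
def constTerm (d : ℕ) (c : ℤ) : ℤ × (Fin (numVars d) → ℕ) :=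
  listTerm _ (c, 0 :: List.replicate (3 * d + 2) 0)

/-- `f` minus the threshold, in the variables of the copy `κ`. -/
def copyPoly (κ : ℕ) : SumOfMonomials (numVars I.d) :=
  I.f.map (fun t => listTerm _ (t.1, copyExps κ (List.ofFn t.2))) ++ [thresholdTerm I.d (-1)]

/-- The coefficients of the midpoint equations. -/
def linCoef : Fin 3 → ℤ
  | 0 => 1
  | 1 => 1
  | 2 => -2

/-- The midpoint equation for the coordinate with the given number, counted from the end. -/
def linPoly (d k : ℕ) : SumOfMonomials (numVars d) :=
  [0, 1, 2].map fun κ : Fin 3 => listTerm _ (linCoef κ,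
    List.replicate (1 + 3 * (d - 1 - k) + κ) 0 ++
      1 :: List.replicate (3 * k + (4 - κ)) 0)

/-- The part of the formula without the midpoint equations. -/
def core : QFFormula (numVars I.d) :=
  .and (.atom .eq [thresholdTerm I.d I.θ.den, constTerm I.d (-I.θ.num.natAbs)])
    (.and (.atom .ge (copyPoly I 0)) (.and (.atom .ge (copyPoly I 1))
      (.not (.atom .ge (copyPoly I 2)))))

/-- The formula with the last `k` midpoint equations. -/
def chain : ℕ → QFFormula (numVars I.d)
  | 0 => core I
  | k + 1 => .and (.atom .eq (linPoly I.d k)) (chain k)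

/-- The reduction. -/
def toETR : Sentence := ⟨numVars I.d, chain I I.d⟩

end Sentence

/-! ### The machine -/

/-- The symbols of the input, with their meaning. -/
inductive Tok
  | vTodo
  | vCur
  | vDone
  | varsEnd
  | sign (neg : Bool)
  | cBit (b : Bool)
  | cEnd
  | eBit (b : Bool)
  | eEnd
  deriving DecidableEq, Fintype

/-- The instructions of the machine. -/
inductive Instr
  | semi
  | andEq
  | andGe
  | notGe
  | minusT
  | constPart
  | tPart
  | num
  | den
  | copy (κ : Fin 3)
  | lin (κ : Fin 3)
  | advance
  | vars
  deriving DecidableEq, Fintype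

/-- The control of a sweep. Except for `advance`, which looks for the place of the cursor,
it tells how many separators have been met: `1` in the denominator, `2` in the numerator, `3` at the
end of a term, `4` inside a term. -/
abbrev Ctl := Fin 5

/-- The next control. -/
def nextCtl : Instr → Ctl → Tok → Ctl
  | .advance, 0, .vTodo => 1
  | .advance, c, _ => c
  | _, 0, .eEnd => 1
  | _, 1, .eEnd => 2
  | _, 2, .eEnd => 3
  | _, _, .eEnd => 4
  | _, _, .cEnd => 4
  | _, _, .sign _ => 3
  | _, c, _ => c

/-- The new cell. -/
def newTok : Instr → Ctl → Tok → Tok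
  | .advance, 0, .vTodo => .vCur
  | .advance, 0, .vCur => .vDone
  | _, _, t => t

/-- The exponents of a triple of variables. -/
def triple : Fin 3 → List ℕ
  | 0 => [1, 0, 0]
  | 1 => [0, 1, 0]
  | 2 => [0, 0, 1]

/-- Writing a term all of whose exponents, but possibly the first, are zero. -/
def zeroOut : Tok → List Symbol
  | .varsEnd => [.semi, .semi]
  | .vTodo => [.semi, .semi, .semi]
  | .vCur => [.semi, .semi, .semi]
  | .vDone => [.semi, .semi, .semi]
  | _ => []

/-- Writing a term of a midpoint equation. -/
def linOut (κ : Fin 3) : Tok → List Symbol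
  | .vCur => (triple κ).flatMap encNat
  | t => zeroOut t

/-- Declaring the variables. -/
def varsOut : Tok → List Symbol
  | .varsEnd => [.var, .var]
  | .vTodo => [.var, .var, .var]
  | .vCur => [.var, .var, .var]
  | .vDone => [.var, .var, .var]
  | _ => []

/-- Copying `f`. -/
def copyOut (κ : Fin 3) : Ctl → Tok → List Symbol
  | 3, .eEnd => List.replicate 3 .semi ++ List.replicate (2 - κ) .semi
  | 4, .eEnd => List.replicate 3 .semi
  | 3, .cEnd => List.replicate 2 .semi ++ (List.replicate κ .semi ++ List.replicate (2 - κ) .semi)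
  | 4, .cEnd => List.replicate 2 .semi ++ List.replicate κ .semi
  | 4, .eBit b => [.bit b]
  | 4, .cBit b => [.bit b]
  | 4, .sign neg => [if neg then .minus else .plus]
  | _, _ => []

/-- What an instruction writes at a cell. -/
def outTok : Instr → Ctl → Tok → List Symbol
  | .minusT, _, t => zeroOut t
  | .constPart, _, t => zeroOut t
  | .tPart, _, t => zeroOut t
  | .lin κ, _, t => linOut κ t
  | .vars, _, t => varsOut t
  | .den, 0, .eEnd => [.semi]
  | .den, 1, .eBit b => [.bit b]
  | .num, 1, .eEnd => [.semi]
  | .num, 2, .eBit b => [.bit b]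
  | .copy κ, c, t => copyOut κ c t
  | _, _, _ => []

/-- What an instruction writes at the end of its sweep. -/
def finStr : Instr → List Symbol
  | .semi => [.semi]
  | .andEq => [.and, .eq]
  | .andGe => [.and, .ge]
  | .notGe => [.not, .ge]
  | .minusT => encInt (-1) ++ encNat 1
  | .constPart => encNat 0
  | .tPart => encNat 1
  | .num => [.minus]
  | .den => [.plus]
  | .lin κ => encInt (linCoef κ) ++ encNat 0
  | .vars => [.var]
  | _ => []

/-- The meaning of an input symbol. -/
def tok : Mode → Symbol → Tok
  | .vars, .var => .vTodo
  | .vars, _ => .varsEnd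
  | .coef, .bit b => .cBit b
  | .coef, _ => .cEnd
  | .body, .plus => .sign false
  | .body, .minus => .sign true
  | .body, .bit b => .eBit b
  | .body, _ => .eEnd

/-- The meaning of an input string. -/
def toks : Mode → List Symbol → List Tok
  | _, [] => []
  | p, x :: w => tok p x :: toks (nextMode p x) w

/-- The instructions for the part of the formula without the midpoint equations. -/
def coreInstrs : List Instr :=
  [.semi, .minusT, .copy 2, .notGe, .semi, .minusT, .copy 1, .andGe, .semi, .minusT, .copy 0,
    .andGe, .semi, .constPart, .num, .tPart, .den, .andEq]

/-- The instructions for a midpoint equation. -/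
def linInstrs : List Instr := [.advance, .semi, .lin 2, .lin 1, .lin 0, .andEq]

/-- The machine computing the reduction. -/
def machine : Sweeper Symbol Instr Tok Symbol Mode (Instr × Ctl) where
  start := .vars
  base := [.semi, .vars]
  feed p x := (nextMode p x, (match p, x with
    | .vars, .var => linInstrs
    | _, _ => []), [tok p x])
  last := (coreInstrs, [])
  init a := (a, 0)
  move q t := ((q.1, nextCtl q.1 q.2 t), newTok q.1 q.2 t, outTok q.1 q.2 t)
  fin q := finStr q.1

end Membership

end ExistsReals

/-! ### Membership: the machine outputs the encoded sentence. -/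

namespace ExistsReals

namespace Membership

open Hardness (Mode nextMode modeAfter modeAfter_append)

/-! ### The row -/

theorem toks_append (p : Mode) (u v : List Symbol) :
    toks p (u ++ v) = toks p u ++ toks (modeAfter p u) v := by
  induction u generalizing p with
  | nil => rfl
  | cons x u ih => simp [toks, modeAfter, ih]

theorem toks_bits_body (l : List Bool) : toks .body (l.map .bit) = l.map .eBit := by
  induction l with
  | nil => rfl
  | cons b l ih => simpa [toks, nextMode, tok] using ih

theorem toks_bits_coef (l : List Bool) : toks .coef (l.map .bit) = l.map .cBit := by
  induction l with
  | nil => rfl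
  | cons b l ih => simpa [toks, nextMode, tok] using ih

/-- The cells of a number. -/
def eToks (e : ℕ) : List Tok := e.bits.map .eBit ++ [.eEnd]

theorem toks_encNat (e : ℕ) : toks .body (encNat e) = eToks e := by
  rw [encNat, toks_append, toks_bits_body, Hardness.modeAfter_bits _ (by simp)]
  rfl

theorem toks_tuple (es : List ℕ) : toks .body (es.flatMap encNat) = es.flatMap eToks := by
  induction es with
  | nil => rfl
  | cons e es ih =>
    rw [List.flatMap_cons, toks_append, Hardness.modeAfter_encNat _ (by simp), ih, toks_encNat,
      List.flatMap_cons]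

/-- The cells of a term. -/
def termToks {n : ℕ} (t : ℤ × (Fin n → ℕ)) : List Tok :=
  .sign (decide (t.1 < 0)) :: (t.1.natAbs.bits.map .cBit ++
    (.cEnd :: (List.ofFn t.2).flatMap eToks))

theorem toks_encTerm {n : ℕ} (t : ℤ × (Fin n → ℕ)) : toks .body (encTerm t) = termToks t := by
  rw [encTerm, Hardness.encInt_coe, List.cons_append, toks]
  have h₁ : ∀ b : Bool, nextMode .body (if b then Symbol.minus else Symbol.plus) = .coef := by
    intro b; cases b <;> rfl
  have h₂ : ∀ b : Bool, tok .body (if b then Symbol.minus else Symbol.plus) = .sign b := by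
    intro b; cases b <;> rfl
  rw [h₁, h₂, toks_append, Hardness.modeAfter_encNat _ (by simp), toks_tuple, encNat, toks_append,
    toks_bits_coef, Hardness.modeAfter_bits _ (by simp), termToks, List.append_assoc]
  rfl

theorem toks_terms {n : ℕ} (P : SumOfMonomials n) :
    toks .body (P.flatMap encTerm) = P.flatMap termToks := by
  induction P with
  | nil => rfl
  | cons t P ih =>
    rw [List.flatMap_cons, toks_append, Hardness.modeAfter_encTerm, ih, toks_encTerm,
      List.flatMap_cons]

/-- The cells after the declaration of the variables. -/
def bodyToks (I : VSCInstance) : List Tok :=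
  I.f.flatMap termToks ++ (.eEnd :: (eToks I.θ.num.natAbs ++ eToks I.θ.den))

theorem toks_body (I : VSCInstance) :
    toks .body (encPoly I.f ++ encPosRat I.θ) = bodyToks I := by
  rw [encPoly, List.append_assoc, toks_append, toks_terms, Hardness.modeAfter_terms, encPosRat,
    List.singleton_append, toks]
  change _ ++ Tok.eEnd :: toks .body (encNat _ ++ encNat _) = _
  rw [toks_append, toks_encNat, Hardness.modeAfter_encNat _ (by simp), toks_encNat, bodyToks]

/-- The cells of the variables in the order of the sweep, with the cursor at the given place
(counted from one). -/
def vCells : ℕ → ℕ → List Tok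
  | 0, _ => []
  | d + 1, 0 => .vTodo :: vCells d 0
  | d + 1, 1 => .vCur :: vCells d 0
  | d + 1, k + 2 => .vDone :: vCells d (k + 1)

/-- The row. -/
def row (I : VSCInstance) (k : ℕ) : List Tok := (bodyToks I).reverse ++ .varsEnd :: vCells I.d k

theorem load_body (p : Mode) (hp : p ≠ .vars) (w : List Symbol) (J : List Instr) (R : List Tok) :
    machine.load p w J R = (coreInstrs ++ J, (toks p w).reverse ++ R) := by
  induction w generalizing p R with
  | nil => simp [Sweeper.load, toks, machine]
  | cons x w ih =>
    have hp' : nextMode p x ≠ .vars := by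
      cases p <;> cases x <;> simp_all [nextMode]
    have hf : machine.feed p x = (nextMode p x, [], [tok p x]) := by
      cases p <;> simp_all [machine]
    rw [Sweeper.load, hf]
    simp only [List.nil_append]
    rw [ih _ hp', toks]
    simp

theorem load_vars (d : ℕ) (w : List Symbol) (J : List Instr) (R : List Tok) :
    machine.load .vars (encVars d ++ w) J R
      = machine.load .body w ((List.replicate d linInstrs).flatten ++ J)
          (.varsEnd :: (vCells d 0 ++ R)) := by
  induction d generalizing J R with
  | zero => simp [encVars, Sweeper.load, machine, nextMode, tok, vCells]
  | succ d ih =>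
    have : encVars (d + 1) ++ w = .var :: (encVars d ++ w) := by
      simp [encVars, List.replicate_succ]
    have hf : machine.feed .vars .var = (.vars, linInstrs, [.vTodo]) := rfl
    rw [this, Sweeper.load, hf]
    simp only [List.singleton_append]
    rw [ih]
    have h₁ : (List.replicate d linInstrs).flatten ++ (linInstrs ++ J)
        = (List.replicate (d + 1) linInstrs).flatten ++ J := by
      rw [List.replicate_succ']; simp
    have h₂ : ∀ d, vCells d 0 = List.replicate d .vTodo := by
      intro d
      induction d with
      | zero => rfl
      | succ d ih => rw [vCells, ih, List.replicate_succ]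
    have h₃ : vCells d 0 ++ .vTodo :: R = vCells (d + 1) 0 ++ R := by
      rw [h₂, h₂, List.replicate_succ']; simp
    rw [h₁, h₃]

theorem load_encode (I : VSCInstance) : machine.load machine.start I.encode machine.base []
    = (coreInstrs ++ ((List.replicate I.d linInstrs).flatten ++ [.semi, .vars]), row I 0) := by
  have h0 : machine.start = .vars := rfl
  have h1 : machine.base = [.semi, .vars] := rfl
  rw [h0, h1, VSCInstance.encode, load_vars, load_body _ (by simp), toks_body, List.append_nil,
    row]

/-! ### The sweeps -/

theorem rewrite_eq_self (a : Instr) (ha : a ≠ .advance) (c : Ctl) (r : List Tok) :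
    machine.rewrite (a, c) r = r := by
  have h : ∀ c t, newTok a c t = t := by
    intro c t
    unfold newTok
    split <;> simp_all
  induction r generalizing c with
  | nil => rfl
  | cons t r ih =>
    rw [Sweeper.rewrite]
    exact congrArg₂ _ (h c t) (ih _)

theorem revAfter_fst (a : Instr) (c : Ctl) (l : List Tok) :
    (machine.revAfter (a, c) l).1 = a := by
  induction l with
  | nil => rfl
  | cons t l ih => exact ih

/-- What an instruction writes in a sweep over the row. -/
def written (a : Instr) (I : VSCInstance) (k : ℕ) : List Symbol :=
  machine.revOut (machine.revAfter (a, 0) (bodyToks I)) ((vCells I.d k).reverse ++ [.varsEnd]) ++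
    machine.revOut (a, 0) (bodyToks I)

/-- Only `advance` rewrites cells, so every other instruction just prepends a string that depends on
the row. -/
theorem exec_cons (a : Instr) (ha : a ≠ .advance) (J : List Instr) (I : VSCInstance) (k : ℕ)
    (out : List Symbol) :
    machine.exec (a :: J) (row I k) out
      = machine.exec J (row I k) (finStr a ++ (written a I k ++ out)) := by
  have h : machine.init a = (a, 0) := rfl
  rw [Sweeper.exec, h, rewrite_eq_self a ha, Sweeper.emit_eq]
  have hr : (row I k).reverse = ((vCells I.d k).reverse ++ [.varsEnd]) ++ bodyToks I := by
    simp [row]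
  rw [hr, Sweeper.revOut_append, List.append_assoc]
  have hf : machine.fin (machine.revAfter (a, 0) (((vCells I.d k).reverse ++ [.varsEnd]) ++
      bodyToks I)) = finStr a := congrArg finStr (revAfter_fst a 0 _)
  rw [hf]
  rfl

theorem rewrite_advance_body (r w : List Tok) (c : Ctl)
    (h : ∀ t ∈ r, t ≠ .vTodo ∧ t ≠ .vCur) :
    machine.rewrite (.advance, c) (r ++ w) = r ++ machine.rewrite (.advance, c) w := by
  induction r with
  | nil => rfl
  | cons t r ih =>
    have h₁ := h t (by simp)
    have e₁ : nextCtl .advance c t = c := by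
      unfold nextCtl
      split <;> simp_all
    have e₂ : newTok .advance c t = t := by
      unfold newTok
      split <;> simp_all
    rw [List.cons_append, Sweeper.rewrite]
    have : machine.move (.advance, c) t = ((.advance, c), t, outTok .advance c t) := by
      simp only [machine, e₁, e₂]
    rw [this, ih fun t ht => h t (by simp [ht])]
    rfl

/-- The control becomes `1` once the cursor has been placed, after which nothing changes any more.
-/
theorem rewrite_advance_vCells (d k : ℕ) :
    machine.rewrite (.advance, 0) (vCells d k) = vCells d (k + 1) := by
  have h : ∀ d, machine.rewrite (.advance, 1) (vCells d 0) = vCells d 0 := by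
    intro d
    induction d with
    | zero => rfl
    | succ d ih => exact congrArg _ ih
  induction d generalizing k with
  | zero => simp [vCells, Sweeper.rewrite]
  | succ d ih =>
    rcases k with _ | _ | k
    · exact congrArg _ (h d)
    · exact congrArg _ (ih 0)
    · exact congrArg _ (ih (k + 1))

/-- The cells that do not belong to the declaration of the variables. -/
def IsBody (t : Tok) : Prop := t ≠ .vTodo ∧ t ≠ .vCur ∧ t ≠ .vDone ∧ t ≠ .varsEnd

theorem isBody_eToks (e : ℕ) : ∀ t ∈ eToks e, IsBody t := by
  intro t ht
  simp only [eToks, List.mem_append, List.mem_map, List.mem_singleton] at ht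
  rcases ht with ⟨b, _, rfl⟩ | rfl <;> simp [IsBody]

theorem isBody_bodyToks (I : VSCInstance) : ∀ t ∈ bodyToks I, IsBody t := by
  intro t ht
  simp only [bodyToks, List.mem_append, List.mem_flatMap, List.mem_cons, termToks,
    List.mem_map] at ht
  rcases ht with ⟨s, _, rfl | ⟨b, _, rfl⟩ | rfl | ⟨e, _, h⟩⟩ | rfl | h | h
  · simp [IsBody]
  · simp [IsBody]
  · simp [IsBody]
  · exact isBody_eToks e t h
  · simp [IsBody]
  · exact isBody_eToks _ t h
  · exact isBody_eToks _ t h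

theorem exec_advance (J : List Instr) (I : VSCInstance) (k : ℕ) (out : List Symbol) :
    machine.exec (.advance :: J) (row I k) out = machine.exec J (row I (k + 1)) out := by
  have h : machine.init .advance = (.advance, 0) := rfl
  have hr : machine.rewrite (.advance, 0) (row I k) = row I (k + 1) := by
    rw [row, rewrite_advance_body _ _ _ fun t ht => ?_]
    · rw [Sweeper.rewrite, row]
      exact congrArg _ (congrArg _ (rewrite_advance_vCells _ _))
    · have := isBody_bodyToks I t (by simpa using ht)
      exact ⟨this.1, this.2.1⟩
  have he : ∀ c r, machine.emit (.advance, c) r = [] := by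
    intro c r
    induction r generalizing c with
    | nil => rfl
    | cons t r ih =>
      rw [Sweeper.emit]
      exact (List.append_eq_nil_iff.2 ⟨ih _, rfl⟩)
  rw [Sweeper.exec, h, hr, he, List.nil_append]

/-- Instructions whose output does not depend on the control. -/
theorem revOut_of_const {a : Instr} {o : Tok → List Symbol} (h : ∀ c t, outTok a c t = o t)
    (q : Instr × Ctl) (hq : q.1 = a) (l : List Tok) : machine.revOut q l = l.flatMap o := by
  induction l with
  | nil => rfl
  | cons t l ih =>
    have hf : (machine.revAfter q l).1 = a := by
      obtain ⟨b, c⟩ := q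
      simp only at hq
      subst hq
      exact revAfter_fst _ _ _
    rw [Sweeper.revOut, ih, List.flatMap_cons]
    congr 1
    change outTok (machine.revAfter q l).1 _ t = o t
    rw [hf, h]

theorem written_of_const {a : Instr} {o : Tok → List Symbol} (h : ∀ c t, outTok a c t = o t)
    (ho : ∀ t, IsBody t → o t = []) (I : VSCInstance) (k : ℕ) :
    written a I k = (vCells I.d k).reverse.flatMap o ++ o .varsEnd := by
  rw [written, revOut_of_const h _ (revAfter_fst _ _ _), revOut_of_const h _ rfl]
  have : (bodyToks I).flatMap o = [] := by
    rw [List.flatMap_eq_nil_iff]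
    exact fun t ht => ho t (isBody_bodyToks I t ht)
  rw [this]
  simp

theorem written_of_nil {a : Instr} (h : ∀ c t, outTok a c t = []) (I : VSCInstance) (k : ℕ) :
    written a I k = [] := by
  rw [written_of_const (o := fun _ => []) h (fun _ _ => rfl)]
  simp

theorem zeroOut_body (t : Tok) (h : IsBody t) : zeroOut t = [] := by
  cases t <;> simp_all [IsBody, zeroOut]

theorem flatMap_vCells_const {α : Type} (o : Tok → List α) (x : α) (j : ℕ)
    (h : ∀ t, t = .vTodo ∨ t = .vCur ∨ t = .vDone → o t = List.replicate j x) (d k : ℕ) :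
    (vCells d k).reverse.flatMap o = List.replicate (j * d) x := by
  have key : ∀ l : List Tok, (∀ t ∈ l, t = .vTodo ∨ t = .vCur ∨ t = .vDone) →
      l.flatMap o = List.replicate (j * l.length) x := by
    intro l hl
    induction l with
    | nil => simp
    | cons t l ih =>
      rw [List.flatMap_cons, h t (hl t (by simp)), ih fun t ht => hl t (by simp [ht]),
        ← List.replicate_add, List.length_cons, Nat.mul_succ, Nat.add_comm]
  have hmem : ∀ d k, ∀ t ∈ vCells d k, t = .vTodo ∨ t = .vCur ∨ t = .vDone := by
    intro d
    induction d with
    | zero => simp [vCells]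
    | succ d ih =>
      intro k t ht
      rcases k with _ | _ | k <;> simp only [vCells, List.mem_cons] at ht <;>
        rcases ht with rfl | ht <;> first | exact ih _ _ ht | simp
  have hlen : ∀ d k, (vCells d k).length = d := by
    intro d
    induction d with
    | zero => intro k; rfl
    | succ d ih => intro k; rcases k with _ | _ | k <;> simp [vCells, ih]
  rw [key _ fun t ht => hmem d k t (List.mem_reverse.1 ht), List.length_reverse, hlen]

theorem zeros_flatMap (n : ℕ) : (List.replicate n 0).flatMap encNat = List.replicate n .semi := by
  induction n with
  | zero => rfl
  | succ n ih => rw [List.replicate_succ, List.flatMap_cons, ih, List.replicate_succ]; rfl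

/-- Three zero exponents per declared variable and two for the separator; the exponent of the
threshold variable is left to `finStr`. -/
theorem written_zero {a : Instr} (h : ∀ c t, outTok a c t = zeroOut t) (I : VSCInstance) (k : ℕ) :
    written a I k = (List.replicate (3 * I.d + 2) 0).flatMap encNat := by
  rw [written_of_const h zeroOut_body, zeros_flatMap,
    flatMap_vCells_const zeroOut .semi 3 (by rintro t (rfl | rfl | rfl) <;> rfl),
    List.replicate_add]
  rfl

theorem written_vars (I : VSCInstance) (k : ℕ) :
    written .vars I k = List.replicate (3 * I.d + 2) .var := by
  rw [written_of_const (o := varsOut) (fun _ _ => rfl) (fun t h => by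
      cases t <;> simp_all [IsBody, varsOut]),
    flatMap_vCells_const varsOut .var 3 (by rintro t (rfl | rfl | rfl) <;> rfl),
    List.replicate_add]
  rfl

theorem vCells_succ (d k : ℕ) (hk : k < d) : vCells d (k + 1) =
    List.replicate k .vDone ++ .vCur :: List.replicate (d - 1 - k) .vTodo := by
  have h : ∀ d, vCells d 0 = List.replicate d .vTodo := by
    intro d
    induction d with
    | zero => rfl
    | succ d ih => rw [vCells, ih, List.replicate_succ]
  induction d generalizing k with
  | zero => omega
  | succ d ih =>
    rcases k with _ | k
    · rw [vCells, h]
      simp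
    · rw [vCells, ih k (by omega), List.replicate_succ]
      have : d + 1 - 1 - (k + 1) = d - 1 - k := by omega
      rw [this]
      rfl

/-- Cells behind the cursor are swept first, so their zeros end up to the right of the `1`, and
those still ahead to its left. The summand `encNat 0` is the exponent of the threshold variable. -/
theorem written_lin (κ : Fin 3) (I : VSCInstance) (k : ℕ) (hk : k < I.d) :
    encNat 0 ++ written (.lin κ) I (k + 1) =
      (List.replicate (1 + 3 * (I.d - 1 - k) + κ) 0 ++
        1 :: List.replicate (3 * k + (4 - κ)) 0).flatMap encNat := by
  have hc : ∀ n t, linOut κ t = List.replicate 3 .semi →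
      (List.replicate n t).flatMap (linOut κ) = List.replicate (3 * n) .semi := by
    intro n t ht
    induction n with
    | zero => rfl
    | succ n ih =>
      rw [List.replicate_succ, List.flatMap_cons, ih, ht, ← List.replicate_add, Nat.mul_succ,
        Nat.add_comm]
  have hb : ∀ t, IsBody t → linOut κ t = [] := fun t h => by
    cases t <;> simp_all [IsBody, linOut, zeroOut]
  rw [written_of_const (o := linOut κ) (fun _ _ => rfl) hb, vCells_succ _ _ hk]
  simp only [List.reverse_append, List.reverse_cons, List.reverse_replicate, List.append_assoc,
    List.flatMap_append, List.flatMap_cons, List.singleton_append, zeros_flatMap]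
  rw [hc _ .vTodo rfl, hc _ .vDone rfl]
  have e₁ : linOut κ .vCur =
      List.replicate κ .semi ++ (encNat 1 ++ List.replicate (2 - κ) .semi) := by
    fin_cases κ <;> rfl
  have e₂ : 3 * k + (4 - (κ : ℕ)) = (2 - κ) + (3 * k + 2) := by omega
  have e₃ : linOut κ .varsEnd = List.replicate 2 .semi := rfl
  have e₄ : encNat 0 = List.replicate 1 .semi := rfl
  rw [e₁, e₂, e₃, e₄]
  simp only [List.replicate_add, List.append_assoc]

/-! ### Copying numbers -/

theorem revAfter_eBits (a : Instr) (ha : a ≠ .advance) (c : Ctl) (l : List Bool) :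
    machine.revAfter (a, c) (l.map .eBit) = (a, c) := by
  induction l with
  | nil => rfl
  | cons b l ih =>
    rw [List.map_cons, Sweeper.revAfter, ih]
    change (a, nextCtl a c (.eBit b)) = _
    congr 1
    fin_cases c <;> cases a <;> rfl

theorem revAfter_eToks (a : Instr) (ha : a ≠ .advance) (c : Ctl) (e : ℕ) :
    machine.revAfter (a, c) (eToks e) = (a, nextCtl a c .eEnd) := by
  rw [eToks, Sweeper.revAfter_append]
  exact revAfter_eBits a ha _ _

theorem revOut_eBits (a : Instr) (ha : a ≠ .advance) (c : Ctl) (l : List Bool) :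
    machine.revOut (a, c) (l.map .eBit) = l.flatMap fun b => outTok a c (.eBit b) := by
  induction l with
  | nil => rfl
  | cons b l ih =>
    rw [List.map_cons, Sweeper.revOut, ih, revAfter_eBits a ha]
    rfl

theorem revOut_eToks (a : Instr) (ha : a ≠ .advance) (c : Ctl) (e : ℕ) :
    machine.revOut (a, c) (eToks e) =
      (e.bits.flatMap fun b => outTok a (nextCtl a c .eEnd) (.eBit b)) ++ outTok a c .eEnd := by
  rw [eToks, Sweeper.revOut_append]
  have : machine.revAfter (a, c) [.eEnd] = (a, nextCtl a c .eEnd) := rfl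
  rw [this, revOut_eBits a ha]
  congr 1
  exact List.append_nil _

theorem nextCtl_of_ne (a : Instr) (ha : a ≠ .advance) :
    nextCtl a 0 .eEnd = 1 ∧ nextCtl a 1 .eEnd = 2 ∧ nextCtl a 2 .eEnd = 3 := by
  cases a <;> first | exact ⟨rfl, rfl, rfl⟩ | exact absurd rfl ha

/-- From the right the sweep meets the ends of denominator, numerator and polynomial. Counting these
three separators locates each number and leaves control `3`, the end of a term. -/
theorem revAfter_tail (a : Instr) (ha : a ≠ .advance) (n m : ℕ) :
    machine.revAfter (a, 0) (.eEnd :: (eToks n ++ eToks m)) = (a, 3) := by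
  obtain ⟨h₀, h₁, h₂⟩ := nextCtl_of_ne a ha
  rw [Sweeper.revAfter, Sweeper.revAfter_append, revAfter_eToks a ha, h₀, revAfter_eToks a ha, h₁]
  change (a, nextCtl a 2 .eEnd) = _
  rw [h₂]

theorem revOut_tail (a : Instr) (ha : a ≠ .advance) (n m : ℕ) :
    machine.revOut (a, 0) (.eEnd :: (eToks n ++ eToks m)) =
      outTok a 2 .eEnd ++ (((n.bits.flatMap fun b => outTok a 2 (.eBit b)) ++ outTok a 1 .eEnd) ++
        ((m.bits.flatMap fun b => outTok a 1 (.eBit b)) ++ outTok a 0 .eEnd)) := by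
  obtain ⟨h₀, h₁, -⟩ := nextCtl_of_ne a ha
  rw [Sweeper.revOut, Sweeper.revAfter_append, Sweeper.revOut_append, revAfter_eToks a ha, h₀,
    revAfter_eToks a ha, h₁, revOut_eToks a ha, revOut_eToks a ha, h₀, h₁]
  rfl

theorem revOut_nil_of (a : Instr) (l : List Tok) (c : Ctl) (h : ∀ t ∈ l, ∀ c, outTok a c t = []) :
    machine.revOut (a, c) l = [] := by
  induction l with
  | nil => rfl
  | cons t l ih =>
    rw [Sweeper.revOut, ih fun t ht => h t (by simp [ht]), List.append_nil]
    change outTok (machine.revAfter (a, c) l).1 _ t = []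
    rw [revAfter_fst, h t (by simp)]

theorem mem_vPart {d k : ℕ} {t : Tok} (h : t ∈ (vCells d k).reverse ++ [.varsEnd]) :
    ¬ IsBody t := by
  have hmem : ∀ d k, ∀ t ∈ vCells d k, ¬ IsBody t := by
    intro d
    induction d with
    | zero => simp [vCells]
    | succ d ih =>
      intro k t ht
      rcases k with _ | _ | k <;> simp only [vCells, List.mem_cons] at ht <;>
        rcases ht with rfl | ht <;> first | exact ih _ _ ht | simp [IsBody]
  simp only [List.mem_append, List.mem_reverse, List.mem_singleton] at h
  rcases h with h | rfl
  · exact hmem _ _ _ h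
  · simp [IsBody]

theorem revAfter_terms_ctl {a : Instr} (c : Ctl) (l : List Tok) (hc : c = 3 ∨ c = 4)
    (ha : a ≠ .advance) : ∃ c', (c' = 3 ∨ c' = 4) ∧ machine.revAfter (a, c) l = (a, c') := by
  induction l with
  | nil => exact ⟨c, hc, rfl⟩
  | cons t l ih =>
    obtain ⟨c', hc', h⟩ := ih
    refine ⟨nextCtl a c' t, ?_, ?_⟩
    · rcases hc' with rfl | rfl <;> cases t <;> cases a <;>
        first | exact Or.inl rfl | exact Or.inr rfl
    · rw [Sweeper.revAfter, h]; rfl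

theorem revOut_terms_nil {a : Instr} (l : List Tok) (ha : a ≠ .advance)
    (h : ∀ t, outTok a 3 t = [] ∧ outTok a 4 t = []) : machine.revOut (a, 3) l = [] := by
  induction l with
  | nil => rfl
  | cons t l ih =>
    obtain ⟨c', hc', h'⟩ := revAfter_terms_ctl (a := a) 3 l (Or.inl rfl) ha
    rw [Sweeper.revOut, ih, h', List.append_nil]
    change outTok a c' t = []
    rcases hc' with rfl | rfl
    · exact (h t).1
    · exact (h t).2

/-- An instruction silent in the controls `3` and `4` ignores the terms and the variables, since
these controls are never left again. -/
theorem written_tail {a : Instr} (ha : a ≠ .advance)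
    (h : ∀ t, outTok a 3 t = [] ∧ outTok a 4 t = []) (I : VSCInstance) (k : ℕ) :
    written a I k = machine.revOut (a, 0)
      (.eEnd :: (eToks I.θ.num.natAbs ++ eToks I.θ.den)) := by
  rw [written, bodyToks, Sweeper.revAfter_append, Sweeper.revOut_append _ _ (I.f.flatMap termToks),
    revAfter_tail a ha, ← List.append_assoc, ← Sweeper.revOut_append, revOut_terms_nil _ ha h,
    List.nil_append]

theorem flatMap_bit (l : List Bool) : (l.flatMap fun b => [Symbol.bit b]) = l.map .bit := by
  induction l with
  | nil => rfl
  | cons b l ih => rw [List.flatMap_cons, ih]; rfl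

theorem written_num (I : VSCInstance) (k : ℕ) : written .num I k = encNat I.θ.num.natAbs := by
  rw [written_tail (by simp) (fun t => by cases t <;> exact ⟨rfl, rfl⟩), revOut_tail _ (by simp)]
  simp [outTok, flatMap_bit, encNat]

theorem written_den (I : VSCInstance) (k : ℕ) : written .den I k = encNat I.θ.den := by
  rw [written_tail (by simp) (fun t => by cases t <;> exact ⟨rfl, rfl⟩), revOut_tail _ (by simp)]
  simp [outTok, flatMap_bit, encNat]

/-! ### Copying the polynomial -/

/-- A zero is encoded by a bare separator, so spreading the exponents means inserting separators.
Control `3` recognizes the last exponent of a term, which also receives the `2 - κ` trailing zeros.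
-/
theorem copy_tuple (κ : Fin 3) (es : List ℕ) :
    machine.revAfter (.copy κ, 3) (es.flatMap eToks) = (.copy κ, if es = [] then 3 else 4) ∧
      machine.revOut (.copy κ, 3) (es.flatMap eToks) =
        if es = [] then [] else
          (es.flatMap fun e => [e, 0, 0]).flatMap encNat ++ List.replicate (2 - κ) .semi := by
  induction es with
  | nil => exact ⟨rfl, rfl⟩
  | cons e es ih =>
    rw [List.flatMap_cons, Sweeper.revAfter_append, Sweeper.revOut_append, ih.1, ih.2,
      revAfter_eToks _ (by simp), revOut_eToks _ (by simp)]
    by_cases h : es = []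
    · subst h
      refine ⟨rfl, ?_⟩
      simp only [if_true, List.cons_ne_nil, if_false]
      have : nextCtl (.copy κ) 3 .eEnd = 4 := rfl
      rw [this]
      simp only [outTok, copyOut, flatMap_bit]
      simp [encNat]
    · simp only [h, List.cons_ne_nil, if_false]
      refine ⟨rfl, ?_⟩
      have : nextCtl (.copy κ) 4 .eEnd = 4 := rfl
      rw [this]
      simp only [outTok, copyOut, flatMap_bit]
      simp [encNat]

theorem copy_cBits (κ : Fin 3) (l : List Bool) :
    machine.revAfter (.copy κ, 4) (l.map .cBit) = (.copy κ, 4) ∧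
      machine.revOut (.copy κ, 4) (l.map .cBit) = l.map .bit := by
  induction l with
  | nil => exact ⟨rfl, rfl⟩
  | cons b l ih =>
    rw [List.map_cons, Sweeper.revAfter, Sweeper.revOut, ih.1, ih.2]
    exact ⟨rfl, rfl⟩

theorem length_copyExps {κ d : ℕ} (hκ : κ ≤ 2) (es : List ℕ) (h : es.length = d) :
    (copyExps κ es).length = numVars d := by
  have : (es.flatMap fun e => [e, 0, 0]).length = 3 * d := by
    rw [← h]
    clear h
    induction es with
    | nil => rfl
    | cons e es ih => rw [List.flatMap_cons, List.length_append, ih]; simp; omega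
  simp only [copyExps, List.length_cons, List.length_append, List.length_replicate, this, numVars]
  omega

/-- The end of the coefficient receives the zero of the threshold variable and the `κ` leading
zeros, and without exponents (`d = 0`) the trailing ones too. The sign resets the control to `3`, so
terms can follow one another. -/
theorem copy_term (κ : Fin 3) {d : ℕ} (t : ℤ × (Fin d → ℕ)) :
    machine.revAfter (.copy κ, 3) (termToks t) = (.copy κ, 3) ∧
      machine.revOut (.copy κ, 3) (termToks t) =
        encTerm (listTerm (numVars d) (t.1, copyExps κ (List.ofFn t.2))) := by
  obtain ⟨h₁, h₂⟩ := copy_tuple κ (List.ofFn t.2)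
  have h₃ : machine.revAfter (.copy κ, 3) (.cEnd :: (List.ofFn t.2).flatMap eToks)
      = (.copy κ, 4) := by
    rw [Sweeper.revAfter, h₁]
    split_ifs <;> rfl
  have h₄ : machine.revOut (.copy κ, 3) (.cEnd :: (List.ofFn t.2).flatMap eToks)
      = .semi :: (copyExps κ (List.ofFn t.2)).flatMap encNat := by
    rw [Sweeper.revOut, h₁, h₂]
    change outTok (.copy κ) _ .cEnd ++ _ = _
    simp only [copyExps, List.flatMap_cons, List.flatMap_append, zeros_flatMap]
    split_ifs with h
    · simp only [h, outTok, copyOut, List.flatMap_nil, List.nil_append, List.append_nil]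
      rfl
    · simp only [outTok, copyOut, List.append_assoc]
      rfl
  have h₅ := copy_cBits κ t.1.natAbs.bits
  have h₆ : machine.revAfter (.copy κ, 3) (t.1.natAbs.bits.map .cBit ++
      (.cEnd :: (List.ofFn t.2).flatMap eToks)) = (.copy κ, 4) := by
    rw [Sweeper.revAfter_append, h₃, h₅.1]
  refine ⟨?_, ?_⟩
  · rw [termToks, Sweeper.revAfter, h₆]
    rfl
  · rw [termToks, Sweeper.revOut, h₆, Sweeper.revOut_append, h₃, h₄, h₅.2,
      encTerm_listTerm (length_copyExps (by omega) _ (by simp)), Hardness.encInt_coe, encNat]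
    change [if decide (t.1 < 0) then Symbol.minus else Symbol.plus] ++ _ = _
    simp

theorem copy_terms (κ : Fin 3) {d : ℕ} (P : SumOfMonomials d) :
    machine.revAfter (.copy κ, 3) (P.flatMap termToks) = (.copy κ, 3) ∧
      machine.revOut (.copy κ, 3) (P.flatMap termToks) =
        (P.map fun t => listTerm (numVars d) (t.1, copyExps κ (List.ofFn t.2))).flatMap
          encTerm := by
  induction P with
  | nil => exact ⟨rfl, rfl⟩
  | cons t P ih =>
    rw [List.flatMap_cons, Sweeper.revAfter_append, Sweeper.revOut_append, ih.1, ih.2,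
      (copy_term κ t).1, (copy_term κ t).2]
    exact ⟨rfl, by simp⟩

theorem written_copy (κ : Fin 3) (I : VSCInstance) (k : ℕ) : written (.copy κ) I k =
    (I.f.map fun t => listTerm (numVars I.d) (t.1, copyExps κ (List.ofFn t.2))).flatMap
      encTerm := by
  have hv : machine.revOut (machine.revAfter (.copy κ, 0) (bodyToks I))
      ((vCells I.d k).reverse ++ [.varsEnd]) = [] := by
    have : machine.revAfter (.copy κ, 0) (bodyToks I) = (.copy κ, 3) := by
      rw [bodyToks, Sweeper.revAfter_append, revAfter_tail _ (by simp), (copy_terms κ I.f).1]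
    rw [this]
    refine revOut_nil_of _ _ _ fun t ht c => ?_
    have := mem_vPart ht
    cases t with
    | sign | cBit | cEnd | eBit | eEnd => exact absurd (by simp [IsBody]) this
    | _ => fin_cases c <;> rfl
  rw [written, hv, List.nil_append, bodyToks, Sweeper.revOut_append, revAfter_tail _ (by simp),
    (copy_terms κ I.f).2, revOut_tail _ (by simp)]
  simp [outTok, copyOut]

/-! ### The output of the machine -/

theorem length_threshold (d e : ℕ) : (e :: List.replicate (3 * d + 2) 0).length = numVars d := by
  simp

theorem encTerm_thresholdTerm (d : ℕ) (c : ℤ) : encTerm (thresholdTerm d c) =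
    encInt c ++ (encNat 1 ++ (List.replicate (3 * d + 2) 0).flatMap encNat) :=
  encTerm_listTerm (t := (c, 1 :: List.replicate (3 * d + 2) 0)) (length_threshold d 1)

theorem encTerm_constTerm (d : ℕ) (c : ℤ) : encTerm (constTerm d c) =
    encInt c ++ (encNat 0 ++ (List.replicate (3 * d + 2) 0).flatMap encNat) :=
  encTerm_listTerm (t := (c, 0 :: List.replicate (3 * d + 2) 0)) (length_threshold d 0)

theorem exec_copy (κ : Fin 3) (J : List Instr) (I : VSCInstance) (k : ℕ) (out : List Symbol) :
    machine.exec (.semi :: .minusT :: .copy κ :: J) (row I k) out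
      = machine.exec J (row I k) (encPoly (copyPoly I κ) ++ out) := by
  rw [exec_cons _ (by simp), exec_cons _ (by simp), exec_cons _ (by simp), written_copy,
    written_zero (a := .minusT) (fun _ _ => rfl), written_of_nil (a := .semi) (fun _ _ => rfl)]
  congr 1
  rw [encPoly, copyPoly, List.flatMap_append]
  simp only [List.flatMap_cons, List.flatMap_nil, encTerm_thresholdTerm, finStr]
  simp

theorem exec_core (J : List Instr) (I : VSCInstance) (k : ℕ) :
    machine.exec (coreInstrs ++ J) (row I k) []
      = machine.exec J (row I k) (encFormula (core I)) := by
  -- The machine writes a fixed minus sign before the numerator, which is right because `θ` is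
  -- positive: the sign of zero would be a plus.
  have hneg : encInt (-(I.θ.num.natAbs : ℤ)) = .minus :: encNat I.θ.num.natAbs := by
    have : -(I.θ.num.natAbs : ℤ) < 0 := by
      have := Rat.num_pos.2 I.θ_pos
      omega
    rw [encInt, if_pos this, Int.natAbs_neg, Int.natAbs_natCast]
  have hpos : encInt (I.θ.den : ℤ) = .plus :: encNat I.θ.den := by
    rw [encInt, if_neg (by omega), Int.natAbs_natCast]
  rw [coreInstrs]
  simp only [List.cons_append, List.nil_append]
  rw [exec_copy, exec_cons _ (by simp), exec_copy, exec_cons _ (by simp), exec_copy,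
    exec_cons _ (by simp)]
  rw [exec_cons .semi (by simp), exec_cons .constPart (by simp), exec_cons .num (by simp),
    exec_cons .tPart (by simp), exec_cons .den (by simp), exec_cons .andEq (by simp), written_num,
    written_den, written_zero (a := .constPart) (fun _ _ => rfl),
    written_zero (a := .tPart) (fun _ _ => rfl), written_of_nil (a := .semi) (fun _ _ => rfl),
    written_of_nil (a := .andGe) (fun _ _ => rfl), written_of_nil (a := .notGe) (fun _ _ => rfl),
    written_of_nil (a := .andEq) (fun _ _ => rfl)]
  congr 1
  have heq : encPoly [thresholdTerm I.d I.θ.den, constTerm I.d (-I.θ.num.natAbs)] =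
      encTerm (thresholdTerm I.d I.θ.den) ++ (encTerm (constTerm I.d (-I.θ.num.natAbs)) ++
        [.semi]) := by
    simp only [encPoly, List.flatMap_cons, List.flatMap_nil, List.append_nil, List.append_assoc]
  simp only [core, encFormula, heq, encTerm_thresholdTerm, encTerm_constTerm, hneg, hpos,
    finStr, Comparison.symbol, List.append_assoc, List.cons_append, List.nil_append,
    List.append_nil]
  rfl

theorem length_lin {d k : ℕ} (hk : k < d) (κ : Fin 3) :
    (List.replicate (1 + 3 * (d - 1 - k) + κ) 0 ++
      1 :: List.replicate (3 * k + (4 - κ)) 0).length = numVars d := by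
  simp only [List.length_append, List.length_replicate, List.length_cons, numVars]
  omega

theorem exec_lin (J : List Instr) (I : VSCInstance) (k : ℕ) (hk : k < I.d) (out : List Symbol) :
    machine.exec (linInstrs ++ J) (row I k) out = machine.exec J (row I (k + 1))
      (.and :: .eq :: (encPoly (linPoly I.d k) ++ out)) := by
  have hterm : ∀ κ : Fin 3, finStr (.lin κ) ++ written (.lin κ) I (k + 1) =
      encTerm (listTerm (numVars I.d) (linCoef κ,
        List.replicate (1 + 3 * (I.d - 1 - k) + κ) 0 ++
          1 :: List.replicate (3 * k + (4 - κ)) 0)) := by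
    intro κ
    rw [encTerm_listTerm (length_lin hk κ), ← written_lin κ I k hk, finStr, List.append_assoc]
  rw [linInstrs]
  simp only [List.cons_append, List.nil_append]
  rw [exec_advance, exec_cons .semi (by simp), exec_cons (.lin 2) (by simp),
    exec_cons (.lin 1) (by simp), exec_cons (.lin 0) (by simp), exec_cons .andEq (by simp),
    written_of_nil (a := .semi) (fun _ _ => rfl), written_of_nil (a := .andEq) (fun _ _ => rfl),
    ← List.append_assoc (finStr (.lin 0)), ← List.append_assoc (finStr (.lin 1)),
    ← List.append_assoc (finStr (.lin 2)), hterm, hterm, hterm]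
  congr 1
  simp only [linPoly, encPoly, List.map_cons, List.map_nil, List.flatMap_cons, List.flatMap_nil,
    finStr]
  simp

/-- Each round moves the cursor one place and puts a further midpoint equation in front, so the
place of the cursor and the length of the chain grow together. -/
theorem exec_chain (J : List Instr) (I : VSCInstance) (j k : ℕ) (hk : k + j ≤ I.d) :
    machine.exec ((List.replicate j linInstrs).flatten ++ J) (row I k) (encFormula (chain I k))
      = machine.exec J (row I (k + j)) (encFormula (chain I (k + j))) := by
  induction j generalizing k with
  | zero => simp
  | succ j ih =>
    rw [List.replicate_succ, List.flatten_cons, List.append_assoc, exec_lin _ _ _ (by omega)]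
    have := ih (k + 1) (by omega)
    rw [chain, encFormula, encFormula] at this
    have e : k + (j + 1) = k + 1 + j := by omega
    rw [e, ← this]
    rfl

theorem run_machine (I : VSCInstance) : machine.run I.encode = (toETR I).encode := by
  rw [Sweeper.run, load_encode, exec_core]
  have := exec_chain [.semi, .vars] I I.d 0 (by omega)
  rw [chain] at this
  rw [this, exec_cons .semi (by simp), exec_cons .vars (by simp), written_vars,
    written_of_nil (a := .semi) (fun _ _ => rfl), Sweeper.exec, Nat.zero_add]
  simp only [Sentence.encode, toETR, encVars, finStr, numVars, List.nil_append,
    List.replicate_succ, List.append_assoc, List.singleton_append]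
  rfl

theorem polyTime_toETR :
    Nonempty (Turing.TM2ComputableInPolyTime VSCInstance.encode Sentence.encode toETR) :=
  machine.polyTime run_machine

end Membership

end ExistsReals

/-! ### Membership: correctness of the reduction. -/

namespace ExistsReals

namespace Membership

/-! ### Correctness -/

/-- The monomial with the given exponents. -/
def monomialVal (Y : ℕ → ℝ) : List ℕ → ℝ
  | [] => 1
  | e :: L => Y 0 ^ e * monomialVal (fun i => Y (i + 1)) L

/-- Points are infinite sequences here, so that passing to later variables is a mere shift, without
bounds to maintain. -/
theorem monomialVal_append (Y : ℕ → ℝ) (L L' : List ℕ) : monomialVal Y (L ++ L') =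
    monomialVal Y L * monomialVal (fun i => Y (i + L.length)) L' := by
  induction L generalizing Y with
  | nil => simp [monomialVal]
  | cons e L ih =>
    simp only [List.cons_append, monomialVal, ih, List.length_cons, mul_assoc]
    simp only [add_assoc]

theorem monomialVal_zeros (Y : ℕ → ℝ) (n : ℕ) : monomialVal Y (List.replicate n 0) = 1 := by
  induction n generalizing Y with
  | zero => rfl
  | succ n ih => simp [List.replicate_succ, monomialVal, ih]

theorem monomialVal_spread (Y : ℕ → ℝ) (es : List ℕ) :
    monomialVal Y (es.flatMap fun e => [e, 0, 0]) = monomialVal (fun i => Y (3 * i)) es := by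
  induction es generalizing Y with
  | nil => rfl
  | cons e es ih =>
    simp only [List.flatMap_cons, List.cons_append, List.nil_append, monomialVal, ih, pow_zero,
      one_mul]
    rfl

theorem monomialVal_ofFn (Y : ℕ → ℝ) {n : ℕ} (e : Fin n → ℕ) :
    monomialVal Y (List.ofFn e) = ∏ i : Fin n, Y i ^ e i := by
  induction n generalizing Y with
  | zero => simp [monomialVal]
  | succ n ih => simp [List.ofFn_succ, monomialVal, ih, Fin.prod_univ_succ]

theorem prod_listTerm (Y : ℕ → ℝ) {n : ℕ} (c : ℤ) (L : List ℕ) (h : L.length = n) :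
    ∏ j : Fin n, Y j ^ (listTerm n (c, L)).2 j = monomialVal Y L := by
  rw [← monomialVal_ofFn]
  exact congrArg _ (ofFn_getD h 0)

theorem prod_thresholdTerm (Y : ℕ → ℝ) (d : ℕ) (c : ℤ) :
    ∏ j : Fin (numVars d), Y j ^ (thresholdTerm d c).2 j = Y 0 := by
  rw [thresholdTerm, prod_listTerm _ _ _ (length_threshold d 1), monomialVal, monomialVal_zeros,
    pow_one, mul_one]

theorem prod_constTerm (Y : ℕ → ℝ) (d : ℕ) (c : ℤ) :
    ∏ j : Fin (numVars d), Y j ^ (constTerm d c).2 j = 1 := by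
  rw [constTerm, prod_listTerm _ _ _ (length_threshold d 0), monomialVal, monomialVal_zeros,
    pow_zero, mul_one]

/-- The padding with zeros contributes `1`; the threshold exponent and the `κ` leading zeros shift
the coordinate `i`, spread to place `3 * i`, to `3 * i + κ + 1`. -/
theorem monomialVal_copyExps (Y : ℕ → ℝ) (κ : ℕ) {d : ℕ} (e : Fin d → ℕ) :
    monomialVal Y (copyExps κ (List.ofFn e)) = ∏ i : Fin d, Y (3 * i + κ + 1) ^ e i := by
  rw [copyExps, monomialVal, pow_zero, one_mul, monomialVal_append, monomialVal_zeros, one_mul,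
    monomialVal_append, monomialVal_zeros, mul_one, monomialVal_spread, monomialVal_ofFn]
  simp

theorem eval_copyPoly (Y : ℕ → ℝ) (I : VSCInstance) {κ : ℕ} (hκ : κ ≤ 2) :
    (copyPoly I κ).eval (fun j => Y j) = I.f.eval (fun i => Y (3 * i + κ + 1)) - Y 0 := by
  rw [copyPoly, SumOfMonomials.eval_append, SumOfMonomials.eval_eq, SumOfMonomials.eval_eq,
    SumOfMonomials.eval_eq, List.map_map]
  congr 1
  · congr 1
    refine List.map_congr_left fun t _ => ?_
    rw [Function.comp, prod_listTerm _ _ _ (length_copyExps hκ _ (by simp)),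
      monomialVal_copyExps]
    rfl
  · rw [List.map_singleton, List.sum_singleton, prod_thresholdTerm]
    simp [thresholdTerm, listTerm]

theorem eval_threshold (Y : ℕ → ℝ) (d : ℕ) (a b : ℤ) :
    SumOfMonomials.eval [thresholdTerm d a, constTerm d b] (fun j => Y j) = a * Y 0 + b := by
  rw [SumOfMonomials.eval_eq]
  simp only [List.map_cons, List.map_nil, List.sum_cons, List.sum_nil, prod_thresholdTerm,
    prod_constTerm]
  simp [thresholdTerm, constTerm, listTerm]

theorem eval_linPoly (Y : ℕ → ℝ) {d k : ℕ} (hk : k < d) :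
    (linPoly d k).eval (fun j => Y j) = Y (3 * (d - 1 - k) + 1) + Y (3 * (d - 1 - k) + 2)
      - 2 * Y (3 * (d - 1 - k) + 3) := by
  rw [SumOfMonomials.eval_eq, linPoly, List.map_map]
  have h (κ : Fin 3) : ((fun t : ℤ × (Fin (numVars d) → ℕ) =>
      (t.1 : ℝ) * ∏ i : Fin (numVars d), Y i ^ t.2 i) ∘ fun κ : Fin 3 => listTerm _ (linCoef κ,
        List.replicate (1 + 3 * (d - 1 - k) + κ) 0 ++ 1 :: List.replicate (3 * k + (4 - κ)) 0)) κ
      = linCoef κ * Y (3 * (d - 1 - k) + 1 + κ) := by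
    rw [Function.comp, prod_listTerm _ _ _ (length_lin hk κ), monomialVal_append,
      monomialVal_zeros, monomialVal, monomialVal_zeros, List.length_replicate, zero_add]
    simp [listTerm, add_comm 1]
  simp only [List.map_cons, List.map_nil, List.sum_cons, List.sum_nil, h]
  simp [linCoef]
  ring

theorem holds_core (Y : ℕ → ℝ) (I : VSCInstance) : (core I).Holds (fun j => Y j) ↔
    Y 0 = I.θ ∧ Y 0 ≤ I.f.eval (fun i => Y (3 * i + 1)) ∧
      Y 0 ≤ I.f.eval (fun i => Y (3 * i + 2)) ∧ I.f.eval (fun i => Y (3 * i + 3)) < Y 0 := by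
  -- The threshold equation with denominators cleared; positivity of `θ` identifies the numerator
  -- with its absolute value.
  have hθ : I.θ.den * Y 0 + ((-I.θ.num.natAbs : ℤ) : ℝ) = 0 ↔ Y 0 = I.θ := by
    have h₁ : (I.θ.num.natAbs : ℤ) = I.θ.num :=
      Int.natAbs_of_nonneg (Rat.num_pos.2 I.θ_pos).le
    have h₂ : (I.θ.den : ℝ) ≠ 0 := Nat.cast_ne_zero.2 I.θ.den_nz
    rw [h₁, Rat.cast_def, eq_div_iff h₂, Int.cast_neg, add_neg_eq_zero, mul_comm]
  simp only [core, QFFormula.Holds, Comparison.Holds, eval_copyPoly Y I (Nat.zero_le 2),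
    eval_copyPoly Y I one_le_two, eval_copyPoly Y I le_rfl, eval_threshold, Int.cast_natCast, hθ,
    sub_nonneg, not_le, add_assoc, Nat.reduceAdd]

theorem holds_chain (Y : ℕ → ℝ) (I : VSCInstance) {k : ℕ} (hk : k ≤ I.d) :
    (chain I k).Holds (fun j => Y j) ↔ (core I).Holds (fun j => Y j) ∧
      ∀ i, i < I.d → I.d ≤ i + k → Y (3 * i + 1) + Y (3 * i + 2) = 2 * Y (3 * i + 3) := by
  induction k with
  | zero => exact ⟨fun h => ⟨h, fun i h₁ h₂ => by omega⟩, fun h => h.1⟩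
  | succ k ih =>
    rw [chain, QFFormula.Holds, ih (by omega), QFFormula.Holds, Comparison.Holds,
      eval_linPoly Y (by omega), sub_eq_zero]
    constructor
    · rintro ⟨h₁, h₂, h₃⟩
      refine ⟨h₂, fun i hi hd => ?_⟩
      by_cases h : I.d ≤ i + k
      · exact h₃ i hi h
      · obtain rfl : i = I.d - 1 - k := by omega
        exact h₁
    · rintro ⟨h₁, h₂⟩
      exact ⟨h₂ _ (by omega) (by omega), h₁, fun i hi hd => h₂ i hi (by omega)⟩

/-- Listing the threshold and then the coordinates of the points and of their midpoint. -/
noncomputable def assignment (t : ℝ) {d : ℕ} (p q : Fin d → ℝ) (j : ℕ) : ℝ :=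
  if j = 0 then t else
    -- Among the variables of the sentence this fails only for the two spare ones, `3 * d + 1` and
    -- `3 * d + 2`.
    if h : (j - 1) / 3 < d then
      if j % 3 = 1 then p ⟨_, h⟩ else
        if j % 3 = 2 then q ⟨_, h⟩ else (1 / 2 : ℝ) * (p ⟨_, h⟩ + q ⟨_, h⟩)
    else 0

theorem assignment_coord (t : ℝ) {d : ℕ} (p q : Fin d → ℝ) (i : Fin d) :
    assignment t p q (3 * i + 1) = p i ∧ assignment t p q (3 * i + 2) = q i ∧
      assignment t p q (3 * i + 3) = (1 / 2 : ℝ) * (p i + q i) := by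
  have h₂ : (3 * (i : ℕ) + 1) / 3 = i := by omega
  have h₃ : (3 * (i : ℕ) + 2) / 3 = i := by omega
  simp [assignment, h₂, h₃, Nat.add_mod]

theorem toETR_correct (I : VSCInstance) : I.HasValley ↔ (toETR I).IsTrue := by
  constructor
  · rintro ⟨p, q, hp, hq, hm⟩
    have h := assignment_coord (I.θ : ℝ) p q
    refine ⟨fun j => assignment I.θ p q j, (holds_chain _ _ le_rfl).2
      ⟨(holds_core _ _).2 ?_, fun i hi _ => ?_⟩⟩
    · simp only [(h _).1, (h _).2.1, (h _).2.2]
      exact ⟨rfl, hp, hq, hm⟩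
    · have := h ⟨i, hi⟩
      rw [this.1, this.2.1, this.2.2]
      ring
  · rintro ⟨y, hy⟩
    let Y : ℕ → ℝ := fun j => if h : j < numVars I.d then y ⟨j, h⟩ else 0
    have hY : y = fun j : Fin (numVars I.d) => Y j :=
      funext fun j => by
        have h : (j : ℕ) < numVars I.d := j.2
        simp only [Y, dif_pos h]
    rw [hY] at hy
    obtain ⟨hc, hl⟩ := (holds_chain Y I le_rfl).1 hy
    obtain ⟨h₀, hp, hq, hm⟩ := (holds_core Y I).1 hc
    rw [h₀] at hp hq hm
    -- The points are read off from the places `3 * i + 1` and `3 * i + 2`; the midpoint equations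
    -- identify place `3 * i + 3` with their midpoint.
    refine ⟨_, _, hp, hq, ?_⟩
    convert hm using 2
    funext i
    have := hl i i.2 (by omega)
    simp only [Pi.smul_apply, Pi.add_apply, smul_eq_mul]
    linarith

end Membership

end ExistsReals

theorem mainTheorem2 : ExistsReals.ExistsRComplete ExistsReals.VSC := by
  refine ⟨⟨ExistsReals.Membership.toETR, ExistsReals.Membership.polyTime_toETR,
    ExistsReals.Membership.toETR_correct⟩, fun P hP => ?_⟩
  exact ExistsReals.PolyTimeReducible.trans hP ⟨ExistsReals.Hardness.toVSC,
    ExistsReals.Hardness.polyTime_toVSC, ExistsReals.Hardness.toVSC_correct⟩
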